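/- **Definitions.** A *diagram of a long singular knot* is an oriented, generically immersed line in the plane, running from left to right outside a compact set, each of whose finitely many transverse double points (*vertices*) is a positive crossing, a negative crossing, or a singular double point. Diagrams are taken up to isotopy of the plane, i.e. given by their planar signed Gauss codes. Two diagrams represent *isotopic* long singular knots if they are related by a finite sequence of the following moves and their inverses, in all oriented versions: the Reidemeister moves RI, RII, RIII; the move SII, where a double point $p$ and a crossing $c$ are the two vertices of a bigon and $c$ is moved, with its sign, to the opposite side of $p$ (which is turned over); and the move SIII, where a strand is moved across a double point, passing over both of its strands or under both of them. Let $D$ be a diagram with exactly $d$ double points, numbered $p_1,\dots,p_d$ in the order in which they are first passed along the line, and let $w(D)$ be the number of positive minus the number of negative crossings. At each vertex turn the picture so that both strands point upwards; the quadrants are then called top (between the outgoing half-edges), bottom (between the incoming ones), left and right. *Singular Kauffman bracket.* Smooth every vertex either in the way that respects the orientation or in the other way. The two choices have weights $A,\ A^{-1}$ at a positive crossing, $A^{-1},\ A$ at a negative crossing, and $B_i,\ B_i^{-1}$ at $p_i$. Then $$\langle D\rangle_s=\sum_S \Big(\prod_{v}\mathrm{weight}_v(S)\Big)(-A^2-A^{-2})^{|S|-1},\qquad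 V^s_D=(-A)^{-3w(D)}\langle D\rangle_s\in\mathbb Z[A^{\pm1},B_1^{\pm1},\dots,B_d^{\pm1}],$$ where $|S|$ is the number of components of the smoothed diagram, including the long one. *Kauffman-state Alexander sum.* The two unbounded regions of the plane are the star regions. A Kauffman state places one dot in one quadrant at each vertex such that every region other than the star regions contains exactly one dot and the star regions contain none. A dot on the left or on the right contributes $1$. A dot at the top, respectively at the bottom, contributes $A$, $-A^{-1}$ at a positive crossing, $A^{-1}$, $-A$ at a negative crossing, and $B_i$, $B_i-A-A^{-1}$ at $p_i$. Let $\Delta^s_D\in\mathbb Z[A^{\pm1},B_1,\dots,B_d]$ be the sum over all Kauffman states of the product of the contributions of the dots. **Theorem 2.** $V^s$ and $\Delta^s$ are isotopy invariants of oriented long singular knots: if the diagrams $D$ and $D'$ represent isotopic long singular knots, then they have the same number $d$ of double points, and $V^s_D=V^s_{D'}$ in $\mathbb Z[A^{\pm1},B_1^{\pm1},\dots,B_d^{\pm1}]$ and $\Delta^s_D=\Delta^s_{D'}$ in $\mathbb Z[A^{\pm1},B_1,\dots,B_d]$. -/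

import Mathlib

/-!
Long singular knots, given by their diagrams. A diagram is an oriented generically immersed
line in the plane, running from left to right outside a compact set, each of whose transverse
double points (the *vertices*) is a positive crossing, a negative crossing or a singular double
point. It is recorded by its planar signed Gauss code, which determines it up to isotopy of
the plane.
-/

open scoped LaurentPolynomial

noncomputable section

namespace LongSingular

/-- The type of a vertex: positive crossing, negative crossing, singular double point. -/
inductive Kind
  | pos
  | neg
  | dbl
  deriving DecidableEq

/-- Rotate a vertex so that its two oriented strands point upwards. Then one strand, `ne`, runs
from south-west to north-east, and the other one, `nw`, from south-east to north-west. -/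
inductive Strand
  | ne
  | nw
  deriving DecidableEq

instance : Fintype Strand :=
  ⟨{.ne, .nw}, fun x => by cases x <;> simp⟩

/-- The other strand at the same vertex. -/
def Strand.opp : Strand → Strand
  | .ne => .nw
  | .nw => .ne

/-- The four quadrants at a vertex whose strands point upwards: `top` lies between the two
outgoing half-edges, `bottom` between the two incoming ones. -/
inductive Quadrant
  | top
  | left
  | bottom
  | right
  deriving DecidableEq

instance : Fintype Quadrant :=
  ⟨{.top, .left, .bottom, .right}, fun x => by cases x <;> simp⟩

/-- The two sides of an oriented edge. -/
inductive Side
  | left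
  | right
  deriving DecidableEq

instance : Fintype Side :=
  ⟨{.left, .right}, fun x => by cases x <;> simp⟩

/-- A long signed Gauss code: `word` lists the passages through the vertices in the order in
which they are met along the line; each vertex is passed exactly once on each of its two
strands. The values of `kind` matter only on the labels that occur in `word`. -/
structure GaussCode where
  word : List (ℕ × Strand)
  kind : ℕ → Kind
  nodup : word.Nodup
  paired : ∀ (v : ℕ) (s : Strand), (v, s) ∈ word → (v, s.opp) ∈ word

namespace GaussCode

/-- The set of vertices. -/
def verts (D : GaussCode) : Finset ℕ := (D.word.map Prod.fst).toFinset

/-- The type of vertices. -/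
abbrev Vertex (D : GaussCode) : Type := {v : ℕ // v ∈ D.verts}

theorem mem_word (D : GaussCode) (v : D.Vertex) (s : Strand) : (v.1, s) ∈ D.word := by
  obtain ⟨v, hv⟩ := v
  simp only [verts, List.mem_toFinset, List.mem_map] at hv
  obtain ⟨⟨w, t⟩, hw, rfl⟩ := hv
  have h := D.paired _ _ hw
  cases s <;> cases t <;> first | exact hw | exact h

/-- The edges: the vertex passages cut the line into `word.length + 1` oriented pieces, numbered
along the line. Edge `0` comes from the far left, the last edge goes to the far right. -/
abbrev Edge (D : GaussCode) : Type := Fin (D.word.length + 1)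

/-- The position in the word of the passage through `v` along the strand `s`. -/
def pos (D : GaussCode) (v : D.Vertex) (s : Strand) : Fin D.word.length :=
  ⟨D.word.idxOf (v.1, s), List.idxOf_lt_length_of_mem (D.mem_word v s)⟩

/-- The incoming edge of the strand `s` at `v`. -/
def inEdge (D : GaussCode) (v : D.Vertex) (s : Strand) : D.Edge := (D.pos v s).castSucc

/-- The outgoing edge of the strand `s` at `v`. -/
def outEdge (D : GaussCode) (v : D.Vertex) (s : Strand) : D.Edge := (D.pos v s).succ

/-! ### Regions -/

/-- The two sides of edges that bound a given quadrant at a vertex. -/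
def corner (D : GaussCode) (v : D.Vertex) : Quadrant → (D.Edge × Side) × (D.Edge × Side)
  | .top => ((D.outEdge v .nw, .right), (D.outEdge v .ne, .left))
  | .left => ((D.outEdge v .nw, .left), (D.inEdge v .ne, .left))
  | .bottom => ((D.inEdge v .ne, .right), (D.inEdge v .nw, .left))
  | .right => ((D.inEdge v .nw, .right), (D.outEdge v .ne, .right))

/-- Two sides of edges belong to the same region if they meet in a quadrant of a vertex, or if
they are the left (right) sides of the first and of the last edge, which both bound the upper
(lower) unbounded region. -/
inductive SameRegion (D : GaussCode) : D.Edge × Side → D.Edge × Side → Prop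
  | corner (v : D.Vertex) (q : Quadrant) : SameRegion D (D.corner v q).1 (D.corner v q).2
  | unbounded (s : Side) : SameRegion D (0, s) (Fin.last _, s)

/-- The regions of the diagram: classes of the equivalence relation generated by `SameRegion`. -/
def Region (D : GaussCode) : Type := Quot D.SameRegion

/-- The region that contains the quadrant `q` at `v`. -/
def regionAt (D : GaussCode) (v : D.Vertex) (q : Quadrant) : D.Region :=
  Quot.mk _ (D.corner v q).1

/-- The star regions: the two unbounded regions, to the left and to the right of the ends. -/
def IsStar (D : GaussCode) (f : D.Region) : Prop := ∃ s : Side, f = Quot.mk _ (0, s)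

/-- The Gauss code comes from a diagram in the plane. (On the sphere, with the point at infinity
as an additional bivalent vertex, there are `n + 1` vertices and `2n + 1` edges, so that by
Euler's formula the genus is zero if and only if there are `n + 2` regions.) -/
def IsPlanar (D : GaussCode) : Prop := Nat.card D.Region = D.verts.card + 2

/-! ### Double points and their order -/

/-- The set of singular double points. -/
def doublePoints (D : GaussCode) : Finset ℕ := D.verts.filter fun v => D.kind v = .dbl

/-- The number of singular double points. -/
def numDouble (D : GaussCode) : ℕ := D.doublePoints.card

/-- The time of the first passage through the vertex labelled `v`. -/
def firstPassage (D : GaussCode) (v : ℕ) : ℕ := (D.word.map Prod.fst).idxOf v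

/-- The number of double points that are met for the first time before `v`. -/
def rank (D : GaussCode) (v : ℕ) : ℕ :=
  (D.doublePoints.filter fun u => D.firstPassage u < D.firstPassage v).card

theorem rank_lt (D : GaussCode) (v : D.Vertex) (hv : D.kind v.1 = .dbl) :
    D.rank v.1 < D.numDouble := by
  apply Finset.card_lt_card
  rw [Finset.filter_ssubset]
  exact ⟨v.1, by simp [doublePoints, hv], lt_irrefl _⟩

/-- The index of a double point in the order of first passage. The `i`-th double point in this
order, counted from `0`, is the one with index `i`. -/
def ordinal (D : GaussCode) {d : ℕ} (hd : D.numDouble = d) (v : D.Vertex)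
    (hv : D.kind v.1 = .dbl) : Fin d :=
  ⟨D.rank v.1, hd ▸ D.rank_lt v hv⟩

/-- The writhe: the number of positive crossings minus the number of negative crossings. -/
def writhe (D : GaussCode) : ℤ :=
  ∑ v : D.Vertex, match D.kind v.1 with
    | .pos => 1
    | .neg => -1
    | .dbl => 0

/-! ### The singular Kauffman bracket -/

/-- The two ways to smooth a vertex: respecting the orientation of the strands or not. -/
inductive Smoothing
  | oriented
  | unoriented
  deriving DecidableEq

instance : Fintype Smoothing :=
  ⟨{.oriented, .unoriented}, fun x => by cases x <;> simp⟩

/-- The edges joined when every vertex `v` is smoothed according to `S v`. -/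
inductive Joined (D : GaussCode) (S : D.Vertex → Smoothing) : D.Edge → D.Edge → Prop
  | oriented (v : D.Vertex) (s : Strand) (h : S v = .oriented) :
      Joined D S (D.inEdge v s) (D.outEdge v s.opp)
  | unoriented_in (v : D.Vertex) (h : S v = .unoriented) :
      Joined D S (D.inEdge v .ne) (D.inEdge v .nw)
  | unoriented_out (v : D.Vertex) (h : S v = .unoriented) :
      Joined D S (D.outEdge v .ne) (D.outEdge v .nw)

/-- The number of components of the smoothed diagram, including the long one. -/
def numComponents (D : GaussCode) (S : D.Vertex → Smoothing) : ℕ := Nat.card (Quot (D.Joined S))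

end GaussCode

/-- The ring `ℤ[A^{±1}, B_1^{±1}, …, B_d^{±1}]`, as the group ring of `ℤ^d` over
`ℤ[A^{±1}]`. -/
abbrev JonesRing (d : ℕ) : Type := AddMonoidAlgebra ℤ[T;T⁻¹] (Fin d →₀ ℤ)

/-- The element `A ^ k` of `JonesRing d`. -/
def JonesRing.A (d : ℕ) (k : ℤ) : JonesRing d := AddMonoidAlgebra.single 0 (LaurentPolynomial.T k)

/-- The element `B_i ^ k` of `JonesRing d`. -/
def JonesRing.B {d : ℕ} (i : Fin d) (k : ℤ) : JonesRing d :=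
  AddMonoidAlgebra.single (Finsupp.single i k) 1

/-- The ring `ℤ[A^{±1}, B_1, …, B_d]`. -/
abbrev AlexanderRing (d : ℕ) : Type := MvPolynomial (Fin d) ℤ[T;T⁻¹]

/-- The element `A ^ k` of `AlexanderRing d`. -/
def AlexanderRing.A (d : ℕ) (k : ℤ) : AlexanderRing d := MvPolynomial.C (LaurentPolynomial.T k)

/-- The element `B_i` of `AlexanderRing d`. -/
def AlexanderRing.B {d : ℕ} (i : Fin d) : AlexanderRing d := MvPolynomial.X i

namespace GaussCode

/-- The weight of a smoothing at a vertex. The `A`-smoothing of a crossing is the oriented one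
if the crossing is positive and the unoriented one if it is negative. At the `i`-th double point
the oriented smoothing has weight `B_i` and the other one `B_i⁻¹`. -/
def smoothingWeight (D : GaussCode) {d : ℕ} (hd : D.numDouble = d) (v : D.Vertex)
    (t : Smoothing) : JonesRing d :=
  if hv : D.kind v.1 = .dbl then
    match t with
    | .oriented => JonesRing.B (D.ordinal hd v hv) 1
    | .unoriented => JonesRing.B (D.ordinal hd v hv) (-1)
  else if D.kind v.1 = .pos then
    match t with
    | .oriented => JonesRing.A d 1
    | .unoriented => JonesRing.A d (-1)
  else
    match t with
    | .oriented => JonesRing.A d (-1)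
    | .unoriented => JonesRing.A d 1

open Classical in
/-- The multivariable singular Kauffman bracket `⟨D⟩_s`, normalized to be `1` on the diagram
without vertices. -/
def bracket (D : GaussCode) {d : ℕ} (hd : D.numDouble = d) : JonesRing d :=
  ∑ S : D.Vertex → Smoothing,
    (∏ v : D.Vertex, D.smoothingWeight hd v (S v)) *
      (-JonesRing.A d 2 - JonesRing.A d (-2)) ^ (D.numComponents S - 1)

/-- The polynomial `V^s = (-A)^{-3w} ⟨D⟩_s`. -/
def jones (D : GaussCode) {d : ℕ} (hd : D.numDouble = d) : JonesRing d :=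
  (((-1 : ℤˣ) ^ (-3 * D.writhe) : ℤˣ) : ℤ) • JonesRing.A d (-3 * D.writhe) * D.bracket hd

/-! ### The Kauffman-state Alexander sum -/

/-- A Kauffman state places a dot in one of the four quadrants at each vertex such that there is
exactly one dot in each region that is not a star region, and no dot in the star regions. -/
def IsKauffmanState (D : GaussCode) (t : D.Vertex → Quadrant) : Prop :=
  (∀ v : D.Vertex, ¬ D.IsStar (D.regionAt v (t v))) ∧
    ∀ f : D.Region, ¬ D.IsStar f → ∃! v : D.Vertex, D.regionAt v (t v) = f

/-- The contribution of a dot in a quadrant at a vertex. -/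
def dotWeight (D : GaussCode) {d : ℕ} (hd : D.numDouble = d) (v : D.Vertex)
    (q : Quadrant) : AlexanderRing d :=
  if hv : D.kind v.1 = .dbl then
    match q with
    | .top => AlexanderRing.B (D.ordinal hd v hv)
    | .bottom => AlexanderRing.B (D.ordinal hd v hv) - AlexanderRing.A d 1 - AlexanderRing.A d (-1)
    | .left => 1
    | .right => 1
  else if D.kind v.1 = .pos then
    match q with
    | .top => AlexanderRing.A d 1
    | .bottom => -AlexanderRing.A d (-1)
    | .left => 1
    | .right => 1
  else
    match q with
    | .top => AlexanderRing.A d (-1)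
    | .bottom => -AlexanderRing.A d 1
    | .left => 1
    | .right => 1

open Classical in
/-- The polynomial `Δ^s`: the sum over all Kauffman states of the product of the contributions
of the dots. -/
def alexander (D : GaussCode) {d : ℕ} (hd : D.numDouble = d) : AlexanderRing d :=
  ∑ t : D.Vertex → Quadrant with D.IsKauffmanState t, ∏ v : D.Vertex, D.dotWeight hd v (t v)

end GaussCode

/-! ### Moves -/

/-- The passages of two strands through the two vertices `c`, `c'` of a bigon. The first strand
meets `c`, then `c'`; the second one meets them in the same order if `parallel` is true, and
in the opposite order otherwise. A strand crosses the other one from left to right at one of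
the vertices and from right to left at the other one. -/
def bigon (parallel : Bool) (s : Strand) (c c' : ℕ) :
    List (ℕ × Strand) × List (ℕ × Strand) :=
  ([(c, s), (c', s.opp)],
    if parallel then [(c, s.opp), (c', s)] else [(c', s), (c, s.opp)])

/-- The kind of a crossing at which the strand `s` passes over the other one. -/
def overKind : Strand → Kind
  | .ne => .pos
  | .nw => .neg

/-- The passages of three strands `X`, `Y`, `Z` along the sides of a triangle with the vertices
`xy`, `yz`, `zx` (where `xy` is the intersection of `X` and `Y`, and so on). Here `s₁` is the
strand of `X` at `xy`, `s₂` the strand of `Y` at `yz`, and `s₃` the strand of `Z` at `zx`.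
For three oriented lines in general position with these intersection signs there are two
possible triangles, in which the order of the vertices is reversed on each of the three lines;
this is one of them. -/
def triangle (xy yz zx : ℕ) (s₁ s₂ s₃ : Strand) : List (List (ℕ × Strand)) :=
  [if s₂ = .ne then [(zx, s₃.opp), (xy, s₁)] else [(xy, s₁), (zx, s₃.opp)],
    if s₃ = .ne then [(xy, s₁.opp), (yz, s₂)] else [(yz, s₂), (xy, s₁.opp)],
    if s₁ = .ne then [(yz, s₂.opp), (zx, s₃)] else [(zx, s₃), (yz, s₂.opp)]]

/-- The elementary moves, in all their oriented versions. -/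
inductive Move : GaussCode → GaussCode → Prop
  /-- Renaming the vertices. -/
  | relabel (D D' : GaussCode) (f : ℕ → ℕ)
      (hw : D'.word = D.word.map fun x => (f x.1, x.2))
      (hk : ∀ v ∈ D.verts, D'.kind (f v) = D.kind v) : Move D D'
  /-- Reidemeister move I: a kink is added. -/
  | RI (D D' : GaussCode) (l₁ l₂ : List (ℕ × Strand)) (c : ℕ) (s : Strand)
      (hk : D'.kind = D.kind) (hc : D.kind c ≠ .dbl)
      (hw : D.word = l₁ ++ l₂)
      (hw' : D'.word = l₁ ++ [(c, s), (c, s.opp)] ++ l₂) : Move D D'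
  /-- Reidemeister move II: a bigon is added, one of its strands passing over the other one. -/
  | RII (D D' : GaussCode) (l₁ l₂ l₃ : List (ℕ × Strand)) (parallel : Bool) (c c' : ℕ)
      (s : Strand) (hk : D'.kind = D.kind)
      (hc : (D.kind c = .pos ∧ D.kind c' = .neg) ∨ (D.kind c = .neg ∧ D.kind c' = .pos))
      (hw : D.word = l₁ ++ l₂ ++ l₃)
      (hw' : D'.word = l₁ ++ (bigon parallel s c c').1 ++ l₂ ++ (bigon parallel s c c').2 ++ l₃) :
      Move D D'
  /-- Reidemeister move III, and the move SIII: the strand `Z`, which passes over both `X` and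
  `Y` or under both of them, is moved over, respectively under, the vertex `xy`. It is
  the move RIII if `xy` is a crossing, and the move SIII if `xy` is a double point. The sides
  `u₁`, `u₂`, `u₃` of the triangle are met in any order along the knot. -/
  | RIII_SIII (D D' : GaussCode) (l₀ l₁ l₂ l₃ u₁ u₂ u₃ : List (ℕ × Strand)) (xy yz zx : ℕ)
      (s₁ s₂ s₃ : Strand) (hk : D'.kind = D.kind)
      (hc : (D.kind zx = overKind s₃ ∧ D.kind yz = overKind s₂.opp) ∨
        (D.kind zx = overKind s₃.opp ∧ D.kind yz = overKind s₂))
      (hu : [u₁, u₂, u₃].Perm (triangle xy yz zx s₁ s₂ s₃))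
      (hw : D.word = l₀ ++ u₁ ++ l₁ ++ u₂ ++ l₂ ++ u₃ ++ l₃)
      (hw' : D'.word = l₀ ++ u₁.reverse ++ l₁ ++ u₂.reverse ++ l₂ ++ u₃.reverse ++ l₃) :
      Move D D'
  /-- The move SII: a double point `p` and a crossing `c` form a bigon, and the crossing is
  moved to the opposite side of the double point, which is turned over. -/
  | SII (D D' : GaussCode) (l₁ l₂ l₃ : List (ℕ × Strand)) (parallel : Bool) (p c : ℕ)
      (s : Strand) (hk : D'.kind = D.kind) (hp : D.kind p = .dbl) (hc : D.kind c ≠ .dbl)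
      (hw : D.word = l₁ ++ (bigon parallel s p c).1 ++ l₂ ++ (bigon parallel s p c).2 ++ l₃)
      (hw' : D'.word = l₁ ++ (bigon parallel s c p).1 ++ l₂ ++ (bigon parallel s c p).2 ++ l₃) :
      Move D D'

/-- A diagram, in the plane, of an oriented long singular knot. -/
structure Diagram extends GaussCode where
  planar : toGaussCode.IsPlanar

/-- Two diagrams represent isotopic long singular knots if they are related by a finite sequence
of moves and inverse moves through diagrams in the plane. -/
def Isotopic : Diagram → Diagram → Prop :=
  Relation.EqvGen fun D D' => Move D.toGaussCode D'.toGaussCode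

end LongSingular

end

open scoped LaurentPolynomial

noncomputable section

namespace LongSingular

/-! Both invariants are sums over local choices at the vertices, and apart from renaming labels a
move changes a diagram at one, two or three vertices only. Each such move is therefore checked on a
`Net`, the bare incidence of half-edges and edges, with vertices indexed by an iterated `Option V`:
the `none`s are the vertices of the move, and `V` consists of the vertices outside it.

For the bracket, fix the smoothing of the outside vertices. What remains is a finite sum over the
smoothings of the move, in which only numbers of components matter. These are cardinalities of
quotients, and they are compared by absorbing the inner edges, which meet no outside vertex
(`components_pendant`). A kink of sign `ε` multiplies the bracket by `A^ε δ + A^(-ε) = -A^(3ε)`,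
which the writhe factor cancels (`bracket_kink`). At a bigon the two mixed smoothings connect the
four ends in the same way, so the bracket is symmetric in the two vertices whatever their weights:
this is SII (`Bigon.bracket_swap`). For a pair of opposite crossings, `δ = -A^2 - A^(-2)` cancels
the mixed states against the state with a circle: this is RII (`Bigon.bracket_eq`). The same
relation at the two crossings of the strand `Z` yields RIII with an arbitrary weight at the third
vertex, hence also SIII (`Triangle.bracket_eq`).

For the Alexander sum, give every region a variable and every vertex the linear form of its four
weighted quadrants. The state sum is the coefficient, in the product of these forms, of the
squarefree monomial in the regions that are not star regions (`stateSum_eq_sum`). With `z = A +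
A^(-1)` the weights at every vertex are `b, 1, b - z, 1`, and `b^2 = z b - 1` at a crossing. The
inner region of a move occurs only in the forms at its vertices, so only the part linear in its
variable counts. For a bigon this part is symmetric in the two vertices, which is SII; for RII it
reduces to the sum of the variables of the two end regions, which become one region when the bigon
is removed (`coeff_rename_split`). For a triangle the two linear parts agree up to squares of
variables (`triangle_weights`), and squares cannot contribute to a squarefree monomial; again `b` is
arbitrary at the third vertex.

Planarity enters only through the regions. There are natural surjections between the regions on the
two sides of a move, after suitable identifications, and the numbers of regions given by Euler's
formula make them bijections. The brackets are compared without it.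

Finally, the index of a double point depends only on the word `dblWord` of double-point passages.
The moves preserve this word, up to renaming, so the indeterminates correspond. -/

section

/-! ### Gluing points of a quotient -/

section Glue

variable {α : Type}

/-- The relation `r` enlarged by the pairs in `L`. -/
def glue (r : α → α → Prop) (L : List (α × α)) : α → α → Prop :=
  fun a b => r a b ∨ (a, b) ∈ L

/-- The map `φ` identifies the pairs in `L`. -/
def Identifies {β : Type} (φ : α → β) (L : List (α × α)) : Prop := ∀ p ∈ L, φ p.1 = φ p.2

theorem identifies_nil {β : Type} (φ : α → β) : Identifies φ [] ↔ True := by simp [Identifies]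

theorem identifies_cons {β : Type} (φ : α → β) (p : α × α) (L : List (α × α)) :
    Identifies φ (p :: L) ↔ φ p.1 = φ p.2 ∧ Identifies φ L := by simp [Identifies]

theorem identifies_append {β : Type} (φ : α → β) (L L' : List (α × α)) :
    Identifies φ (L ++ L') ↔ Identifies φ L ∧ Identifies φ L' := by
  simp [Identifies, or_imp, forall_and]

theorem identifies_glue (r : α → α → Prop) (L : List (α × α)) :
    Identifies (Quot.mk (glue r L)) L := fun _ hp => Quot.sound (Or.inr hp)

/-- Maps that are mutually inverse up to the relations identify the quotients. -/
def quotEquiv {β : Type} {r : α → α → Prop} {r' : β → β → Prop} (f : α → β) (g : β → α)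
    (hf : ∀ a b, r a b → Quot.mk r' (f a) = Quot.mk r' (f b))
    (hg : ∀ a b, r' a b → Quot.mk r (g a) = Quot.mk r (g b))
    (hgf : ∀ a, Quot.mk r (g (f a)) = Quot.mk r a)
    (hfg : ∀ b, Quot.mk r' (f (g b)) = Quot.mk r' b) : Quot r ≃ Quot r' where
  toFun := Quot.lift (fun a => Quot.mk r' (f a)) hf
  invFun := Quot.lift (fun b => Quot.mk r (g b)) hg
  left_inv := by rintro ⟨a⟩; exact hgf a
  right_inv := by rintro ⟨b⟩; exact hfg b

/-- Applied to the two quotient maps, the hypothesis makes each of them factor through the other.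
Comparing numbers of components thus becomes equational reasoning about an arbitrary map `φ`. -/
theorem card_glue_congr (r : α → α → Prop) {L L' : List (α × α)}
    (h : ∀ (β : Type) (φ : α → β), Identifies φ L ↔ Identifies φ L') :
    Nat.card (Quot (glue r L)) = Nat.card (Quot (glue r L')) := by
  refine Nat.card_congr (quotEquiv id id ?_ ?_ (fun _ => rfl) fun _ => rfl)
  · rintro a b (hab | hab)
    · exact Quot.sound (Or.inl hab)
    · exact (h _ _).2 (identifies_glue r L') _ hab
  · rintro a b (hab | hab)
    · exact Quot.sound (Or.inl hab)
    · exact (h _ _).1 (identifies_glue r L) _ hab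

theorem glue_glue (r : α → α → Prop) (L L' : List (α × α)) :
    glue (glue r L) L' = glue r (L ++ L') := by
  funext a b
  simp [glue, or_assoc]

/-- One more pair can merge only the class of `p` with the class of `q`: the map that moves the
class of `q` to that of `p` and fixes all other classes respects the enlarged relation. -/
theorem mk_glue_cons_eq (r : α → α → Prop) (p q : α) (L : List (α × α)) (a b : α) :
    Quot.mk (glue r ((p, q) :: L)) a = Quot.mk _ b →
      Quot.mk (glue r L) a = Quot.mk _ b ∨
      ((Quot.mk (glue r L) a = Quot.mk _ p ∨ Quot.mk (glue r L) a = Quot.mk _ q) ∧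
        (Quot.mk (glue r L) b = Quot.mk _ p ∨ Quot.mk (glue r L) b = Quot.mk _ q)) := by
  classical
  intro h
  let F : α → Quot (glue r L) := fun x =>
    if Quot.mk (glue r L) x = Quot.mk _ q then Quot.mk _ p else Quot.mk _ x
  have hF : ∀ x y, glue r ((p, q) :: L) x y → F x = F y := by
    intro x y hxy
    have h0 : (x = p ∧ y = q) ∨ Quot.mk (glue r L) x = Quot.mk _ y := by
      rcases hxy with hxy | hxy
      · exact Or.inr (Quot.sound (Or.inl hxy))
      · rcases List.mem_cons.1 hxy with hxy | hxy
        · exact Or.inl (by simpa using hxy)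
        · exact Or.inr (Quot.sound (Or.inr hxy))
    rcases h0 with ⟨rfl, rfl⟩ | h0
    · simp [F]
    · simp [F, h0]
  have h1 : F a = F b := congrArg (Quot.lift F hF) h
  simp only [F] at h1
  split_ifs at h1 with h2 h3 h3 <;> grind

/-- Once the class of `q` is removed, the projection to the coarser quotient is a bijection. -/
theorem card_glue_cons [Finite α] (r : α → α → Prop) (p q : α) (L : List (α × α))
    (h : Quot.mk (glue r L) p ≠ Quot.mk _ q) :
    Nat.card (Quot (glue r ((p, q) :: L))) + 1 = Nat.card (Quot (glue r L)) := by
  classical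
  have hr : ∀ a b, glue r L a b →
      Quot.mk (glue r ((p, q) :: L)) a = Quot.mk _ b := by
    rintro a b (hab | hab)
    · exact Quot.sound (Or.inl hab)
    · exact Quot.sound (Or.inr (List.mem_cons_of_mem _ hab))
  let f : {x : Quot (glue r L) // x ≠ Quot.mk _ q} → Quot (glue r ((p, q) :: L)) :=
    fun x => Quot.lift _ hr x.1
  have hf : Function.Bijective f := by
    constructor
    · rintro ⟨⟨a⟩, ha⟩ ⟨⟨b⟩, hb⟩ hab
      have := mk_glue_cons_eq r p q L a b hab
      apply Subtype.ext
      change Quot.mk _ a = Quot.mk _ b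
      change Quot.mk _ a ≠ _ at ha
      change Quot.mk _ b ≠ _ at hb
      grind
    · rintro ⟨a⟩
      by_cases ha : Quot.mk (glue r L) a = Quot.mk _ q
      · refine ⟨⟨Quot.mk _ p, h⟩, ?_⟩
        change Quot.mk (glue r ((p, q) :: L)) p = Quot.mk _ a
        have h1 : Quot.mk (glue r ((p, q) :: L)) a = Quot.mk _ q := congrArg (Quot.lift _ hr) ha
        rw [h1]
        exact Quot.sound (Or.inr (by simp))
      · exact ⟨⟨Quot.mk _ a, ha⟩, rfl⟩
  rw [← Nat.card_congr (Equiv.ofBijective f hf),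
    ← Nat.card_congr (Equiv.optionSubtypeNe (Quot.mk (glue r L) q)), Finite.card_option]

theorem card_glue_cons_of_eq (r : α → α → Prop) (p q : α) (L : List (α × α))
    (h : Quot.mk (glue r L) p = Quot.mk _ q) :
    Nat.card (Quot (glue r ((p, q) :: L))) = Nat.card (Quot (glue r L)) := by
  refine Nat.card_congr (quotEquiv id id ?_ ?_ (fun _ => rfl) fun _ => rfl)
  · rintro a b (hab | hab)
    · exact Quot.sound (Or.inl hab)
    · rcases List.mem_cons.1 hab with hab | hab
      · obtain ⟨rfl, rfl⟩ : a = p ∧ b = q := by simpa using hab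
        exact h
      · exact Quot.sound (Or.inr hab)
  · rintro a b (hab | hab)
    · exact Quot.sound (Or.inl hab)
    · exact Quot.sound (Or.inr (List.mem_cons_of_mem _ hab))

/-- A predicate that is compatible with the relation separates classes. -/
theorem mk_ne_mk {r : α → α → Prop} (P : α → Prop) (hP : ∀ a b, r a b → (P a ↔ P b)) {a b : α}
    (ha : P a) (hb : ¬ P b) : Quot.mk r a ≠ Quot.mk r b := by
  intro h
  have := congrArg (Quot.lift P fun x y hxy => propext (hP x y hxy)) h
  exact hb (this.mp ha)

/-- Gluing an isolated point to another point lowers the number of classes by one. -/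
theorem card_glue_pendant [Finite α] {r : α → α → Prop} {e p : α} {L : List (α × α)}
    (hr : ∀ x y, r x y → x ≠ e ∧ y ≠ e) (hL : ∀ x ∈ L, x.1 ≠ e ∧ x.2 ≠ e) (hp : p ≠ e) :
    Nat.card (Quot (glue r ((e, p) :: L))) + 1 = Nat.card (Quot (glue r L)) := by
  refine card_glue_cons r e p L (mk_ne_mk (fun x => x = e) ?_ rfl hp)
  rintro a b (hab | hab)
  · simp [hr a b hab]
  · simp [hL _ hab]

end Glue

/-! ### Sums over functions on `Option V` -/

theorem sum_option_fun {V K : Type} [Fintype V] [DecidableEq V] [AddCommMonoid K]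
    {σ : Type} [Fintype σ] (F : (Option V → σ) → K) :
    ∑ S, F S = ∑ t : σ, ∑ S : V → σ, F (fun x => x.elim t S) := by
  classical
  rw [← Fintype.sum_prod_type' (f := fun t (S : V → σ) => F fun x => x.elim t S)]
  refine Fintype.sum_equiv ((Equiv.piOptionEquivProd (β := fun _ : Option V => σ))) _ _ fun S => ?_
  congr 1
  funext x
  cases x <;> rfl

theorem sum_smoothing {K : Type} [AddCommMonoid K] (F : GaussCode.Smoothing → K) :
    ∑ t, F t = F .oriented + F .unoriented := by
  have : (Finset.univ : Finset GaussCode.Smoothing) = {.oriented, .unoriented} := rfl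
  rw [this, Finset.sum_pair (by decide)]

theorem sum_quadrant {K : Type} [AddCommMonoid K] (F : Quadrant → K) :
    ∑ q, F q = F .top + F .left + F .bottom + F .right := by
  have : (Finset.univ : Finset Quadrant) = {.top, .left, .bottom, .right} := rfl
  rw [this, Finset.sum_insert (by decide), Finset.sum_insert (by decide),
    Finset.sum_pair (by decide)]
  simp only [add_assoc]

end

/-! ### Nets, their brackets, and the bracket of a kink. -/

section

open GaussCode (Smoothing)

/-- The edges that meet at the vertices of a long diagram. -/
structure Net (V E : Type) where
  inn : V → Strand → E
  out : V → Strand → E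
  first : E
  last : E

namespace Net

variable {V V' E E' K : Type}

/-- The incoming half-edge of a strand, after reversing the strand if `ε` is false. -/
def rin (N : Net V E) (v : V) (s : Strand) (ε : Bool) : E := if ε then N.inn v s else N.out v s

/-- The outgoing half-edge of a strand, after reversing the strand if `ε` is false. -/
def rout (N : Net V E) (v : V) (s : Strand) (ε : Bool) : E := if ε then N.out v s else N.inn v s

/-- The net without the vertex `none`. -/
def restrict (N : Net (Option V) E) : Net V E :=
  ⟨fun v => N.inn (some v), fun v => N.out (some v), N.first, N.last⟩

/-- Rename the vertices and the edges. -/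
def map (N : Net V E) (f : V' → V) (g : E → E') : Net V' E' :=
  ⟨fun v s => g (N.inn (f v) s), fun v s => g (N.out (f v) s), g N.first, g N.last⟩

/-! ### The bracket of a net -/

/-- The pairs of half-edges joined by a smoothing. -/
def pairs (N : Net V E) (v : V) : Smoothing → List (E × E)
  | .oriented => [(N.inn v .ne, N.out v .nw), (N.inn v .nw, N.out v .ne)]
  | .unoriented => [(N.inn v .ne, N.inn v .nw), (N.out v .ne, N.out v .nw)]

/-- The relation generating the components of a smoothed net. -/
def joined (N : Net V E) (S : V → Smoothing) : E → E → Prop :=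
  fun a b => ∃ v, (a, b) ∈ N.pairs v (S v)

/-- The state sum of the Kauffman bracket of a net. -/
def bracket [Fintype V] [DecidableEq V] [CommRing K] (N : Net V E) (δ : K)
    (w : V → Smoothing → K) : K :=
  ∑ S : V → Smoothing, (∏ v, w v (S v)) * δ ^ (Nat.card (Quot (N.joined S)) - 1)

theorem pairs_map (N : Net V E) (f : V' → V) (g : E → E') (v : V') (t : Smoothing) :
    (N.map f g).pairs v t = (N.pairs (f v) t).map (Prod.map g g) := by
  cases t <;> rfl

theorem bracket_map [Fintype V] [DecidableEq V] [Fintype V'] [DecidableEq V'] [CommRing K]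
    (N : Net V E) (f : V' ≃ V) (g : E ≃ E') (δ : K) (w : V → Smoothing → K) :
    (N.map f g).bracket δ (fun v => w (f v)) = N.bracket δ w := by
  refine Fintype.sum_equiv (f.arrowCongr (Equiv.refl _)) _ _ fun S => ?_
  have h1 : ∏ v, w (f v) (S v) = ∏ v, w v (f.arrowCongr (Equiv.refl _) S v) :=
    Fintype.prod_equiv f _ _ fun v => by simp
  have h2 : Nat.card (Quot ((N.map f g).joined S)) =
      Nat.card (Quot (N.joined (f.arrowCongr (Equiv.refl _) S))) := by
    refine Nat.card_congr (quotEquiv g.symm g ?_ ?_ (by simp) (by simp))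
    · rintro a b ⟨v, hv⟩
      rw [pairs_map] at hv
      obtain ⟨⟨a', b'⟩, hp, hab⟩ := List.mem_map.1 hv
      obtain ⟨rfl, rfl⟩ : g a' = a ∧ g b' = b := by simpa using hab
      refine Quot.sound ⟨f v, ?_⟩
      simpa using hp
    · rintro a b ⟨v, hv⟩
      refine Quot.sound ⟨f.symm v, ?_⟩
      rw [pairs_map]
      refine List.mem_map.2 ⟨(a, b), ?_, rfl⟩
      simpa using hv
  rw [h1, h2]

theorem pairs_restrict (N : Net (Option V) E) (v : V) (t : Smoothing) :
    N.restrict.pairs v t = N.pairs (some v) t := by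
  cases t <;> rfl

/-- This makes the state sum local: the outside smoothings enter through one fixed relation, to
which the smoothing at `none` adds two glued pairs. -/
theorem joined_option (N : Net (Option V) E) (t : Smoothing) (S : V → Smoothing) :
    N.joined (fun x => x.elim t S) = glue (N.restrict.joined S) (N.pairs none t) := by
  funext a b
  apply propext
  constructor
  · rintro ⟨_ | v, hv⟩
    · exact Or.inr hv
    · refine Or.inl ⟨v, ?_⟩
      rw [pairs_restrict]
      exact hv
  · rintro (⟨v, hv⟩ | hv)
    · refine ⟨some v, ?_⟩
      rw [pairs_restrict] at hv
      exact hv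
    · exact ⟨none, hv⟩

/-- The number of components of the net with vertex set `V`, smoothed according to `S`, after
joining the pairs in `L`. -/
def components (N : Net V E) (S : V → Smoothing) (L : List (E × E)) : ℕ :=
  Nat.card (Quot (glue (N.joined S) L))

theorem components_pos [Finite E] (N : Net V E) (S : V → Smoothing) (L : List (E × E)) :
    0 < N.components S L := by
  have : Nonempty (Quot (glue (N.joined S) L)) := ⟨Quot.mk _ N.first⟩
  exact Nat.card_pos

theorem components_congr (N : Net V E) (S : V → Smoothing) {L L' : List (E × E)}
    (h : ∀ (β : Type) (φ : E → β), Identifies φ L ↔ Identifies φ L') :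
    N.components S L = N.components S L' := card_glue_congr _ h

section Option

variable [Fintype V] [DecidableEq V] [CommRing K]

theorem bracket_option (N : Net (Option V) E) (δ : K) (w : Option V → Smoothing → K) :
    N.bracket δ w = ∑ S : V → Smoothing, (∏ v, w (some v) (S v)) *
      ∑ t, w none t * δ ^ (N.restrict.components S (N.pairs none t) - 1) := by
  rw [bracket, sum_option_fun, Finset.sum_comm]
  refine Finset.sum_congr rfl fun S _ => ?_
  rw [Finset.mul_sum]
  refine Finset.sum_congr rfl fun t _ => ?_
  rw [Fintype.prod_option, joined_option]
  simp only [Option.elim_none, Option.elim_some, components]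
  ring

theorem bracket_option_option (N : Net (Option (Option V)) E) (δ : K)
    (w : Option (Option V) → Smoothing → K) :
    N.bracket δ w = ∑ S : V → Smoothing, (∏ v, w (some (some v)) (S v)) *
      ∑ t, ∑ t', w none t * w (some none) t' * δ ^ (N.restrict.restrict.components S
        (N.pairs none t ++ N.pairs (some none) t') - 1) := by
  rw [bracket_option, sum_option_fun, Finset.sum_comm]
  refine Finset.sum_congr rfl fun S _ => ?_
  simp only [Finset.mul_sum]
  rw [Finset.sum_comm]
  refine Finset.sum_congr rfl fun t _ => Finset.sum_congr rfl fun t' _ => ?_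
  rw [Fintype.prod_option]
  simp only [Option.elim_none, Option.elim_some]
  have h : N.restrict.components (fun x => x.elim t' S) (N.pairs none t) =
      N.restrict.restrict.components S (N.pairs none t ++ N.pairs (some none) t') := by
    rw [components, joined_option, glue_glue]
    refine components_congr _ _ fun β φ => ?_
    rw [identifies_append, identifies_append, and_comm, pairs_restrict]
  rw [h]
  ring

theorem bracket_option_option_option (N : Net (Option (Option (Option V))) E) (δ : K)
    (w : Option (Option (Option V)) → Smoothing → K) :
    N.bracket δ w = ∑ S : V → Smoothing, (∏ v, w (some (some (some v))) (S v)) *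
      ∑ t, ∑ t', ∑ t'', w none t * w (some none) t' * w (some (some none)) t'' *
        δ ^ (N.restrict.restrict.restrict.components S
        (N.pairs none t ++ (N.pairs (some none) t' ++ N.pairs (some (some none)) t'')) - 1) := by
  rw [bracket_option_option, sum_option_fun, Finset.sum_comm]
  refine Finset.sum_congr rfl fun S _ => ?_
  simp only [Finset.mul_sum]
  rw [Finset.sum_comm]
  refine Finset.sum_congr rfl fun t _ => ?_
  rw [Finset.sum_comm]
  refine Finset.sum_congr rfl fun t' _ => Finset.sum_congr rfl fun t'' _ => ?_
  rw [Fintype.prod_option]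
  simp only [Option.elim_none, Option.elim_some]
  have h : N.restrict.restrict.components (fun x => x.elim t'' S)
      (N.pairs none t ++ N.pairs (some none) t') =
      N.restrict.restrict.restrict.components S (N.pairs none t ++
        (N.pairs (some none) t' ++ N.pairs (some (some none)) t'')) := by
    rw [components, joined_option, glue_glue]
    refine components_congr _ _ fun β φ => ?_
    simp only [identifies_append, pairs_restrict]
    tauto
  rw [h]
  ring

end Option

/-! ### The smoothings seen from two strands with chosen directions -/

/-- The smoothing that respects the directions given by `εx` and `εy`. -/
def along (εx εy : Bool) : Smoothing := if εx = εy then .oriented else .unoriented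

/-- The smoothing that does not respect the directions given by `εx` and `εy`. -/
def against (εx εy : Bool) : Smoothing := if εx = εy then .unoriented else .oriented

theorem sum_smoothing_along {K : Type} [AddCommMonoid K] (εx εy : Bool) (F : Smoothing → K) :
    ∑ t, F t = F (along εx εy) + F (against εx εy) := by
  rw [sum_smoothing]
  cases εx <;> cases εy <;> simp [along, against, add_comm]

/-- Reading a strand backwards exchanges its two half-edges, so a smoothing can be described
relative to any directions of the strands. One argument then serves all oriented versions of a move.
-/
theorem identifies_pairs_along {β : Type} (φ : E → β) (N : Net V E) (v : V) (s : Strand)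
    (εx εy : Bool) : Identifies φ (N.pairs v (along εx εy)) ↔
      φ (N.rin v s εx) = φ (N.rout v s.opp εy) ∧ φ (N.rout v s εx) = φ (N.rin v s.opp εy) := by
  cases s <;> cases εx <;> cases εy <;>
    simp [along, pairs, identifies_cons, identifies_nil, rin, rout, Strand.opp] <;> grind

theorem identifies_pairs_against {β : Type} (φ : E → β) (N : Net V E) (v : V) (s : Strand)
    (εx εy : Bool) : Identifies φ (N.pairs v (against εx εy)) ↔
      φ (N.rin v s εx) = φ (N.rin v s.opp εy) ∧ φ (N.rout v s εx) = φ (N.rout v s.opp εy) := by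
  cases s <;> cases εx <;> cases εy <;>
    simp [against, pairs, identifies_cons, identifies_nil, rin, rout, Strand.opp] <;> grind

/-- No half-edge at a vertex is `e`. -/
def Avoids (N : Net V E) (e : E) : Prop := ∀ v s, N.inn v s ≠ e ∧ N.out v s ≠ e

theorem Avoids.joined {N : Net V E} {e : E} (h : N.Avoids e) (S : V → Smoothing) (x y : E)
    (hxy : N.joined S x y) : x ≠ e ∧ y ≠ e := by
  obtain ⟨v, hv⟩ := hxy
  have h1 := h v .ne
  have h2 := h v .nw
  cases ht : S v <;> rw [ht] at hv <;> simp only [pairs, List.mem_cons, Prod.mk.injEq,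
    List.not_mem_nil, or_false] at hv <;> grind

/-- Used from right to left, this attaches an inner edge to the point to which a smoothing joins it,
so that two lists of glued pairs can be matched by `components_congr`. -/
theorem components_pendant [Finite E] {N : Net V E} (S : V → Smoothing) {e p : E}
    {L : List (E × E)} (h : N.Avoids e) (hL : ∀ x ∈ L, x.1 ≠ e ∧ x.2 ≠ e) (hp : p ≠ e) :
    N.components S ((e, p) :: L) + 1 = N.components S L :=
  card_glue_pendant (h.joined S) hL hp

/-! ### Subdivided edges -/

/-- The edges of `E'` are pieces of the edges of `E`; the triples in `C` list the pieces of
the edges that are cut. -/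
structure Subdivision (col : E' → E) (sec : E → E') (C : List (E' × E' × E')) : Prop where
  col_sec : ∀ e, col (sec e) = e
  col_eq : ∀ t ∈ C, col t.1 = col t.2.1 ∧ col t.2.1 = col t.2.2
  sec_col : ∀ (β : Type) (φ : E' → β), (∀ t ∈ C, φ t.1 = φ t.2.2) →
    ∀ e, (∀ t ∈ C, e ≠ t.2.1) → φ (sec (col e)) = φ e

/-- The pairs of consecutive pieces. -/
def cuts (C : List (E' × E' × E')) : List (E' × E') :=
  C.flatMap fun t => [(t.1, t.2.1), (t.2.1, t.2.2)]

/-- Since `sec` selects a single piece of each edge, the equality can hold only after the pieces are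
identified. A middle piece is first traded for the first piece of its triple, to which `sec_col`
applies because `hC` prevents it from being a middle piece itself. -/
theorem Subdivision.sec_col_of_identifies {col : E' → E} {sec : E → E'}
    {C : List (E' × E' × E')} (h : Subdivision col sec C) {β : Type} (φ : E' → β)
    (hφ : Identifies φ (cuts C)) (hC : ∀ t ∈ C, ∀ t' ∈ C, t.1 ≠ t'.2.1) (e : E') :
    φ (sec (col e)) = φ e := by
  have h1 : ∀ t ∈ C, φ t.1 = φ t.2.1 ∧ φ t.2.1 = φ t.2.2 := by
    intro t ht
    constructor
    · exact hφ (t.1, t.2.1) (List.mem_flatMap.2 ⟨t, ht, by simp⟩)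
    · exact hφ (t.2.1, t.2.2) (List.mem_flatMap.2 ⟨t, ht, by simp⟩)
  have h2 := h.sec_col β φ fun t ht => (h1 t ht).1.trans (h1 t ht).2
  by_cases he : ∀ t ∈ C, e ≠ t.2.1
  · exact h2 e he
  · push Not at he
    obtain ⟨t, ht, rfl⟩ := he
    rw [← (h.col_eq t ht).1, h2 _ (hC t ht)]
    exact (h1 t ht).1

theorem card_joined_map_col {col : E' → E} {sec : E → E'} {C : List (E' × E' × E')}
    (h : Subdivision col sec C) (hC : ∀ t ∈ C, ∀ t' ∈ C, t.1 ≠ t'.2.1) (N : Net V E')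
    (S : V → Smoothing) :
    Nat.card (Quot ((N.map id col).joined S)) = N.components S (cuts C) := by
  refine Nat.card_congr (quotEquiv sec col ?_ ?_ ?_ ?_)
  · rintro a b ⟨v, hv⟩
    rw [pairs_map] at hv
    obtain ⟨⟨a', b'⟩, hp, hab⟩ := List.mem_map.1 hv
    obtain ⟨rfl, rfl⟩ : col a' = a ∧ col b' = b := by simpa using hab
    rw [h.sec_col_of_identifies _ (identifies_glue _ _) hC,
      h.sec_col_of_identifies _ (identifies_glue _ _) hC]
    exact Quot.sound (Or.inl ⟨v, hp⟩)
  · rintro a b (⟨v, hv⟩ | hab)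
    · refine Quot.sound ⟨v, ?_⟩
      rw [pairs_map]
      exact List.mem_map.2 ⟨(a, b), hv, rfl⟩
    · obtain ⟨t, ht, hab⟩ := List.mem_flatMap.1 hab
      have := h.col_eq t ht
      simp only [List.mem_cons, Prod.mk.injEq, List.not_mem_nil, or_false] at hab
      congr 1
      rcases hab with ⟨rfl, rfl⟩ | ⟨rfl, rfl⟩ <;> simp [this]
  · intro a
    rw [h.col_sec]
  · exact fun b => h.sec_col_of_identifies _ (identifies_glue _ _) hC b

/-! ### Kinks -/

/-- The vertex `c` is a kink: the strand `s` leaves it along the edge `e₁`, which comes back along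
the other strand. -/
structure Kink (N : Net V E) (c : V) (s : Strand) (e₀ e₁ e₂ : E) : Prop where
  inn : N.inn c s = e₀
  out : N.out c s = e₁
  inn_opp : N.inn c s.opp = e₁
  out_opp : N.out c s.opp = e₂
  ne₀ : e₀ ≠ e₁
  ne₂ : e₂ ≠ e₁
  avoids : ∀ v, v ≠ c → ∀ t, N.inn v t ≠ e₁ ∧ N.out v t ≠ e₁
  first_ne : N.first ≠ e₁
  last_ne : N.last ≠ e₁

/-- The oriented smoothing of a kink splits off `e₁` as a circle and the other one straightens the
strand, so the kink contributes a factor that does not depend on the other smoothings. -/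
theorem bracket_kink [Fintype V] [DecidableEq V] [CommRing K] [Finite E']
    {N : Net (Option V) E'} {s : Strand} {e₀ e₁ e₂ : E'} (h : N.Kink none s e₀ e₁ e₂)
    {col : E' → E} {sec : E → E'} (hs : Subdivision col sec [(e₀, e₁, e₂)])
    (δ : K) (w : Option V → Smoothing → K) :
    N.bracket δ w = (w none .oriented * δ + w none .unoriented) *
      (N.restrict.map id col).bracket δ (fun v => w (some v)) := by
  rw [bracket_option, bracket, Finset.mul_sum]
  refine Finset.sum_congr rfl fun S _ => ?_
  have hav : N.restrict.Avoids e₁ := fun v t => h.avoids (some v) (by simp) t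
  rw [card_joined_map_col hs (by simpa using h.ne₀), sum_smoothing]
  have h1 : N.restrict.components S (cuts [(e₀, e₁, e₂)]) + 1 =
      N.restrict.components S [(e₀, e₂)] := by
    rw [← components_pendant S hav (L := [(e₀, e₂)]) (by simp [h.ne₀, h.ne₂]) h.ne₀]
    congr 1
    refine components_congr _ _ fun β φ => ?_
    simp only [cuts, List.flatMap_cons, List.flatMap_nil, List.append_nil, identifies_cons,
      identifies_nil]
    grind
  -- Here `e₁` is glued only to itself, so the quotient has one class more than the straightened
  -- strand.
  have h2 : N.restrict.components S (N.pairs none .oriented) =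
      N.restrict.components S [(e₀, e₂)] := by
    refine components_congr _ _ fun β φ => ?_
    have := identifies_pairs_along φ N none s true true
    simp only [along, if_true, rin, rout, h.inn, h.out, h.inn_opp, h.out_opp] at this
    rw [this]
    simp [identifies_cons, identifies_nil]
  have h3 : N.restrict.components S (N.pairs none .unoriented) =
      N.restrict.components S (cuts [(e₀, e₁, e₂)]) := by
    refine components_congr _ _ fun β φ => ?_
    have := identifies_pairs_against φ N none s true true
    simp only [against, if_true, rin, rout, h.inn, h.out, h.inn_opp, h.out_opp] at this
    rw [this]
    simp [identifies_cons, identifies_nil, cuts]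
  have h4 := N.restrict.components_pos S (cuts [(e₀, e₁, e₂)])
  rw [h3, h2, ← h1]
  obtain ⟨k, hk⟩ := Nat.exists_eq_add_of_lt h4
  rw [hk]
  simp only [Nat.add_sub_cancel, zero_add]
  ring

end Net

end

/-! ### Brackets near bigons and triangles. -/

section

open GaussCode (Smoothing)

theorem Strand.opp_opp (s : Strand) : s.opp.opp = s := by cases s <;> rfl

namespace Net

variable {V V' E E' K : Type}

/-! ### Bigons -/

/-- The vertices `c` and `c'` span a bigon. One of its strands runs along `a₀`, `a₁`, `a₂` and is
the strand `s` at `c`; the other one runs along `b₀`, `b₁`, `b₂` if `ε` is true, and backwards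
otherwise. -/
structure Bigon (N : Net V E) (c c' : V) (s : Strand) (ε : Bool) (a₀ a₁ a₂ b₀ b₁ b₂ : E) :
    Prop where
  a_in : N.rin c s true = a₀
  a_out : N.rout c s true = a₁
  a_in' : N.rin c' s.opp true = a₁
  a_out' : N.rout c' s.opp true = a₂
  b_in : N.rin c s.opp ε = b₀
  b_out : N.rout c s.opp ε = b₁
  b_in' : N.rin c' s ε = b₁
  b_out' : N.rout c' s ε = b₂
  ne : a₁ ≠ b₁
  ne_a : a₀ ≠ a₁ ∧ a₂ ≠ a₁ ∧ b₀ ≠ a₁ ∧ b₂ ≠ a₁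
  ne_b : a₀ ≠ b₁ ∧ a₂ ≠ b₁ ∧ b₀ ≠ b₁ ∧ b₂ ≠ b₁
  avoids : ∀ v, v ≠ c → v ≠ c' → ∀ t,
    (N.inn v t ≠ a₁ ∧ N.out v t ≠ a₁) ∧ N.inn v t ≠ b₁ ∧ N.out v t ≠ b₁
  first_ne : N.first ≠ a₁ ∧ N.first ≠ b₁
  last_ne : N.last ≠ a₁ ∧ N.last ≠ b₁

section Bigon

variable {N : Net (Option (Option V)) E} {s : Strand} {ε : Bool} {a₀ a₁ a₂ b₀ b₁ b₂ : E}

theorem Bigon.avoids_a (h : N.Bigon none (some none) s ε a₀ a₁ a₂ b₀ b₁ b₂) :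
    N.restrict.restrict.Avoids a₁ :=
  fun v t => (h.avoids (some (some v)) (by simp) (by simp) t).1

theorem Bigon.avoids_b (h : N.Bigon none (some none) s ε a₀ a₁ a₂ b₀ b₁ b₂) :
    N.restrict.restrict.Avoids b₁ :=
  fun v t => (h.avoids (some (some v)) (by simp) (by simp) t).2

theorem components_pendant_two [Finite E] {N : Net V E} (S : V → Smoothing) {e f p q : E}
    {L : List (E × E)} (he : N.Avoids e) (hf : N.Avoids f) (hef : e ≠ f) (hp : p ≠ e)
    (hq : q ≠ e ∧ q ≠ f) (hL : ∀ x ∈ L, (x.1 ≠ e ∧ x.2 ≠ e) ∧ x.1 ≠ f ∧ x.2 ≠ f) :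
    N.components S ((e, p) :: (f, q) :: L) + 2 = N.components S L := by
  rw [← components_pendant S hf (fun x hx => (hL x hx).2) hq.2,
    ← components_pendant S he (L := (f, q) :: L) _ hp]
  intro x hx
  rcases List.mem_cons.1 hx with rfl | hx
  · exact ⟨hef.symm, hq.1⟩
  · exact (hL x hx).1

theorem components_pendant_three [Finite E] {N : Net V E} (S : V → Smoothing) {e f g p q o : E}
    {L : List (E × E)} (he : N.Avoids e) (hf : N.Avoids f) (hg : N.Avoids g) (hef : e ≠ f)
    (heg : e ≠ g) (hfg : f ≠ g) (hp : p ≠ e) (hq : q ≠ e ∧ q ≠ f) (ho : o ≠ e ∧ o ≠ f ∧ o ≠ g)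
    (hL : ∀ x ∈ L, (x.1 ≠ e ∧ x.2 ≠ e) ∧ (x.1 ≠ f ∧ x.2 ≠ f) ∧ x.1 ≠ g ∧ x.2 ≠ g) :
    N.components S ((e, p) :: (f, q) :: (g, o) :: L) + 3 = N.components S L := by
  rw [← components_pendant S hg (fun x hx => (hL x hx).2.2) ho.2.2,
    ← components_pendant_two S he hf hef hp hq (L := (g, o) :: L)]
  intro x hx
  rcases List.mem_cons.1 hx with rfl | hx
  · exact ⟨⟨heg.symm, ho.1⟩, hfg.symm, ho.2.1⟩
  · exact ⟨(hL x hx).1, (hL x hx).2.1⟩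

/-- The numbers of components of the four smoothings of a bigon. -/
theorem Bigon.components [Finite E]
    (h : N.Bigon none (some none) s ε a₀ a₁ a₂ b₀ b₁ b₂) (S : V → Smoothing) :
    N.restrict.restrict.components S
        (N.pairs none (along true ε) ++ N.pairs (some none) (along true ε)) + 2 =
      N.restrict.restrict.components S [(a₀, a₂), (b₀, b₂)] ∧
    N.restrict.restrict.components S
        (N.pairs none (along true ε) ++ N.pairs (some none) (against true ε)) + 2 =
      N.restrict.restrict.components S [(a₀, b₀), (a₂, b₂)] ∧
    N.restrict.restrict.components S
        (N.pairs none (against true ε) ++ N.pairs (some none) (along true ε)) + 2 =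
      N.restrict.restrict.components S [(a₀, b₀), (a₂, b₂)] ∧
    N.restrict.restrict.components S
        (N.pairs none (against true ε) ++ N.pairs (some none) (against true ε)) + 1 =
      N.restrict.restrict.components S [(a₀, b₀), (a₂, b₂)] := by
  obtain ⟨ha0, ha1, ha2, ha3⟩ := h.ne_a
  obtain ⟨hb0, hb1, hb2, hb3⟩ := h.ne_b
  have hne := h.ne
  have e1 : ∀ {β : Type} (φ : E → β), _ := fun φ => identifies_pairs_along φ N none s true ε
  have e2 : ∀ {β : Type} (φ : E → β), _ := fun φ => identifies_pairs_against φ N none s true ε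
  have e3 : ∀ {β : Type} (φ : E → β), _ :=
    fun φ => identifies_pairs_along φ N (some none) s.opp true ε
  have e4 : ∀ {β : Type} (φ : E → β), _ :=
    fun φ => identifies_pairs_against φ N (some none) s.opp true ε
  simp only [Strand.opp_opp, h.a_in, h.a_out, h.a_in', h.a_out', h.b_in, h.b_out, h.b_in',
    h.b_out'] at e1 e2 e3 e4
  refine ⟨?_, ?_, ?_, ?_⟩
  -- In each state `p` and `q` are outer ends to which the smoothing joins the inner edges `a₁` and
  -- `b₁`.
  · rw [← components_pendant_two S h.avoids_a h.avoids_b hne ha2 (p := b₀) (q := a₀)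
      (L := [(a₀, a₂), (b₀, b₂)]) ⟨ha0, hb0⟩
      (by simp; tauto)]
    congr 1
    refine components_congr _ _ fun β φ => ?_
    rw [identifies_append, e1, e3]
    simp only [identifies_cons, identifies_nil]
    grind
  · rw [← components_pendant_two S h.avoids_a h.avoids_b hne ha0 (p := a₀) (q := a₀)
      (L := [(a₀, b₀), (a₂, b₂)]) ⟨ha0, hb0⟩
      (by simp; tauto)]
    congr 1
    refine components_congr _ _ fun β φ => ?_
    rw [identifies_append, e1, e4]
    simp only [identifies_cons, identifies_nil]
    grind
  · rw [← components_pendant_two S h.avoids_a h.avoids_b hne ha1 (p := a₂) (q := a₂)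
      (L := [(a₀, b₀), (a₂, b₂)]) ⟨ha1, hb1⟩
      (by simp; tauto)]
    congr 1
    refine components_congr _ _ fun β φ => ?_
    rw [identifies_append, e2, e3]
    simp only [identifies_cons, identifies_nil]
    grind
  -- Now `a₁` and `b₁` close up to a circle. Only one edge is absorbed, and the circle remains as an
  -- additional component.
  · rw [← components_pendant S h.avoids_a (p := b₁)
      (L := [(a₀, b₀), (a₂, b₂)]) (by simp; tauto) hne.symm]
    congr 1
    refine components_congr _ _ fun β φ => ?_
    rw [identifies_append, e2, e4]
    simp only [identifies_cons, identifies_nil]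
    grind

variable [Fintype V] [DecidableEq V] [CommRing K]

/-- The vertices of a bigon may be exchanged. -/
theorem Bigon.bracket_swap [Finite E] (h : N.Bigon none (some none) s ε a₀ a₁ a₂ b₀ b₁ b₂)
    (δ : K) (w w' : Option (Option V) → Smoothing → K) (hc : w' none = w (some none))
    (hc' : w' (some none) = w none) (hw : ∀ v, w' (some (some v)) = w (some (some v))) :
    N.bracket δ w = N.bracket δ w' := by
  rw [bracket_option_option, bracket_option_option]
  refine Finset.sum_congr rfl fun S _ => ?_
  simp only [hw, hc, hc', sum_smoothing_along true ε]
  obtain ⟨h1, h2, h3, h4⟩ := h.components S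
  -- Exchanging the weights exchanges the two mixed states, and these have equally many components.
  have h5 := h2.trans h3.symm
  rw [Nat.add_right_cancel h5]
  ring

/-- The bracket is invariant under the second Reidemeister move. -/
theorem Bigon.bracket_eq [Finite E'] {N : Net (Option (Option V)) E'} {a₀ a₁ a₂ b₀ b₁ b₂ : E'}
    (h : N.Bigon none (some none) s ε a₀ a₁ a₂ b₀ b₁ b₂) {col : E' → E} {sec : E → E'}
    (hs : Subdivision col sec [(a₀, a₁, a₂), (b₀, b₁, b₂)]) (δ : K)
    (w : Option (Option V) → Smoothing → K)
    (h₁ : w none (along true ε) * w (some none) (along true ε) = 1)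
    (h₂ : w none (against true ε) * w (some none) (against true ε) = 1)
    (h₃ : w none (along true ε) * w (some none) (against true ε) +
      w none (against true ε) * w (some none) (along true ε) = -δ) :
    N.bracket δ w = (N.restrict.restrict.map id col).bracket δ (fun v => w (some (some v))) := by
  rw [bracket_option_option, bracket]
  refine Finset.sum_congr rfl fun S _ => ?_
  simp only [sum_smoothing_along true ε]
  obtain ⟨ha0, ha1, ha2, ha3⟩ := h.ne_a
  obtain ⟨hb0, hb1, hb2, hb3⟩ := h.ne_b
  have hne := h.ne
  rw [card_joined_map_col hs (by simp; tauto)]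
  obtain ⟨h1, h2, h3, h4⟩ := h.components S
  have h5 : N.restrict.restrict.components S (cuts [(a₀, a₁, a₂), (b₀, b₁, b₂)]) + 2 =
      N.restrict.restrict.components S [(a₀, a₂), (b₀, b₂)] := by
    rw [← components_pendant_two S h.avoids_a h.avoids_b hne ha0 (p := a₀) (q := b₀)
      (L := [(a₀, a₂), (b₀, b₂)]) ⟨ha2, hb2⟩
      (by simp; tauto)]
    congr 1
    refine components_congr _ _ fun β φ => ?_
    simp only [cuts, List.flatMap_cons, List.flatMap_nil, List.append_nil, identifies_cons,
      identifies_nil, List.cons_append, List.nil_append]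
    grind
  rw [Nat.add_right_cancel (h1.trans h5.symm), Nat.add_right_cancel (h2.trans h3.symm)]
  have h6 := N.restrict.restrict.components_pos S
    (N.pairs none (against true ε) ++ N.pairs (some none) (along true ε))
  obtain ⟨k, hk⟩ := Nat.exists_eq_add_of_lt h6
  have h7 : N.restrict.restrict.components S
      (N.pairs none (against true ε) ++ N.pairs (some none) (against true ε)) = k + 2 := by omega
  rw [hk, h7]
  simp only [zero_add, Nat.add_sub_cancel, show k + 2 - 1 = k + 1 from rfl]
  congr 1
  -- By `h₃` and `h₂`, the mixed states, with exponent `k`, cancel against the state with the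
  -- circle, with exponent `k + 1`. The remaining state is that of the diagram without the bigon.
  linear_combination (δ ^ (N.restrict.restrict.components S
    (cuts [(a₀, a₁, a₂), (b₀, b₁, b₂)]) - 1)) * h₁ + δ ^ k * h₃ + δ ^ (k + 1) * h₂

end Bigon

/-! ### Triangles -/

/-- The vertices `xy`, `yz`, `zx` span a triangle. Its sides `X`, `Y`, `Z` run from `zx` to `xy`,
from `xy` to `yz` and from `yz` to `zx`, with the orientation of the net if `εx`, `εy`, `εz` are
true, and against it otherwise. The edges of `X` are `x₀`, `x₁`, `x₂`, and so on. -/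
structure Triangle (N : Net V E) (xy yz zx : V) (s₁ s₂ s₃ : Strand) (εx εy εz : Bool)
    (x₀ x₁ x₂ y₀ y₁ y₂ z₀ z₁ z₂ : E) : Prop where
  x_in : N.rin zx s₃.opp εx = x₀
  x_out : N.rout zx s₃.opp εx = x₁
  x_in' : N.rin xy s₁ εx = x₁
  x_out' : N.rout xy s₁ εx = x₂
  y_in : N.rin xy s₁.opp εy = y₀
  y_out : N.rout xy s₁.opp εy = y₁
  y_in' : N.rin yz s₂ εy = y₁
  y_out' : N.rout yz s₂ εy = y₂
  z_in : N.rin yz s₂.opp εz = z₀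
  z_out : N.rout yz s₂.opp εz = z₁
  z_in' : N.rin zx s₃ εz = z₁
  z_out' : N.rout zx s₃ εz = z₂

/-- The edges `x₁`, `y₁`, `z₁` are distinct, and they are met only at `xy`, `yz` and `zx`. -/
structure TriangleEdges (N : Net V E) (xy yz zx : V) (x₀ x₁ x₂ y₀ y₁ y₂ z₀ z₁ z₂ : E) :
    Prop where
  ne_xy : x₁ ≠ y₁
  ne_yz : y₁ ≠ z₁
  ne_zx : z₁ ≠ x₁
  ne_x : x₀ ≠ x₁ ∧ x₂ ≠ x₁ ∧ y₀ ≠ x₁ ∧ y₂ ≠ x₁ ∧ z₀ ≠ x₁ ∧ z₂ ≠ x₁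
  ne_y : x₀ ≠ y₁ ∧ x₂ ≠ y₁ ∧ y₀ ≠ y₁ ∧ y₂ ≠ y₁ ∧ z₀ ≠ y₁ ∧ z₂ ≠ y₁
  ne_z : x₀ ≠ z₁ ∧ x₂ ≠ z₁ ∧ y₀ ≠ z₁ ∧ y₂ ≠ z₁ ∧ z₀ ≠ z₁ ∧ z₂ ≠ z₁
  avoids : ∀ v, v ≠ xy → v ≠ yz → v ≠ zx → ∀ t, (N.inn v t ≠ x₁ ∧ N.out v t ≠ x₁) ∧
    (N.inn v t ≠ y₁ ∧ N.out v t ≠ y₁) ∧ N.inn v t ≠ z₁ ∧ N.out v t ≠ z₁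
  first_ne : N.first ≠ x₁ ∧ N.first ≠ y₁ ∧ N.first ≠ z₁
  last_ne : N.last ≠ x₁ ∧ N.last ≠ y₁ ∧ N.last ≠ z₁

section Triangle

variable {N : Net (Option (Option (Option V))) E} {s₁ s₂ s₃ : Strand} {εx εy εz : Bool}
  {x₀ x₁ x₂ y₀ y₁ y₂ z₀ z₁ z₂ : E}

theorem TriangleEdges.avoids_x
    (h : N.TriangleEdges none (some none) (some (some none)) x₀ x₁ x₂ y₀ y₁ y₂ z₀ z₁ z₂) :
    N.restrict.restrict.restrict.Avoids x₁ :=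
  fun v t => (h.avoids (some (some (some v))) (by simp) (by simp) (by simp) t).1

theorem TriangleEdges.avoids_y
    (h : N.TriangleEdges none (some none) (some (some none)) x₀ x₁ x₂ y₀ y₁ y₂ z₀ z₁ z₂) :
    N.restrict.restrict.restrict.Avoids y₁ :=
  fun v t => (h.avoids (some (some (some v))) (by simp) (by simp) (by simp) t).2.1

theorem TriangleEdges.avoids_z
    (h : N.TriangleEdges none (some none) (some (some none)) x₀ x₁ x₂ y₀ y₁ y₂ z₀ z₁ z₂) :
    N.restrict.restrict.restrict.Avoids z₁ :=
  fun v t => (h.avoids (some (some (some v))) (by simp) (by simp) (by simp) t).2.2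

/-- The numbers of components of the eight smoothings of a triangle. -/
theorem Triangle.components [Finite E]
    (h : N.Triangle none (some none) (some (some none)) s₁ s₂ s₃ εx εy εz
      x₀ x₁ x₂ y₀ y₁ y₂ z₀ z₁ z₂)
    (he : N.TriangleEdges none (some none) (some (some none)) x₀ x₁ x₂ y₀ y₁ y₂ z₀ z₁ z₂)
    (S : V → Smoothing) (k : Smoothing → Smoothing → Smoothing → ℕ)
    (hk : ∀ t t' t'', k t t' t'' = N.restrict.restrict.restrict.components S
      (N.pairs none t ++ (N.pairs (some none) t' ++ N.pairs (some (some none)) t''))) :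
    (k (along εx εy) (along εy εz) (along εz εx) + 2 =
        N.restrict.restrict.restrict.components S [(x₂, y₀), (y₂, z₀), (z₂, x₀)] ∧
      k (along εx εy) (along εy εz) (against εz εx) + 3 =
        N.restrict.restrict.restrict.components S [(x₂, y₀), (y₂, z₀), (z₂, x₀)] ∧
      k (along εx εy) (against εy εz) (along εz εx) + 3 =
        N.restrict.restrict.restrict.components S [(x₂, y₀), (y₂, z₀), (z₂, x₀)] ∧
      k (against εx εy) (along εy εz) (along εz εx) + 3 =
        N.restrict.restrict.restrict.components S [(x₂, y₀), (y₂, z₀), (z₂, x₀)]) ∧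
    (k (along εx εy) (against εy εz) (against εz εx) + 3 =
        N.restrict.restrict.restrict.components S [(x₂, y₀), (z₀, z₂), (y₂, x₀)] ∧
      k (against εx εy) (along εy εz) (against εz εx) + 3 =
        N.restrict.restrict.restrict.components S [(y₂, z₀), (x₀, x₂), (z₂, y₀)] ∧
      k (against εx εy) (against εy εz) (along εz εx) + 3 =
        N.restrict.restrict.restrict.components S [(z₂, x₀), (y₀, y₂), (x₂, z₀)]) ∧
    k (against εx εy) (against εy εz) (against εz εx) + 3 =
        N.restrict.restrict.restrict.components S [(x₀, y₂), (y₀, z₂), (z₀, x₂)] := by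
  have hx := he.ne_x
  have hy := he.ne_y
  have hz := he.ne_z
  have hxy := he.ne_xy
  have hyz := he.ne_yz
  have hzx := he.ne_zx
  have e1 : ∀ {β : Type} (φ : E → β), _ := fun φ => identifies_pairs_along φ N none s₁ εx εy
  have e2 : ∀ {β : Type} (φ : E → β), _ := fun φ => identifies_pairs_against φ N none s₁ εx εy
  have e3 : ∀ {β : Type} (φ : E → β), _ :=
    fun φ => identifies_pairs_along φ N (some none) s₂ εy εz
  have e4 : ∀ {β : Type} (φ : E → β), _ :=
    fun φ => identifies_pairs_against φ N (some none) s₂ εy εz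
  have e5 : ∀ {β : Type} (φ : E → β), _ :=
    fun φ => identifies_pairs_along φ N (some (some none)) s₃ εz εx
  have e6 : ∀ {β : Type} (φ : E → β), _ :=
    fun φ => identifies_pairs_against φ N (some (some none)) s₃ εz εx
  simp only [h.x_in, h.x_out, h.x_in', h.x_out', h.y_in, h.y_out, h.y_in', h.y_out', h.z_in,
    h.z_out, h.z_in', h.z_out'] at e1 e2 e3 e4 e5 e6
  have key : ∀ (p q o : E) (L : List (E × E)), p ≠ x₁ → (q ≠ x₁ ∧ q ≠ y₁) →
      (o ≠ x₁ ∧ o ≠ y₁ ∧ o ≠ z₁) →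
      (∀ x ∈ L, (x.1 ≠ x₁ ∧ x.2 ≠ x₁) ∧ (x.1 ≠ y₁ ∧ x.2 ≠ y₁) ∧ x.1 ≠ z₁ ∧ x.2 ≠ z₁) → _ :=
    fun p q o L hp hq ho hL => components_pendant_three S (p := p) (q := q) (o := o) (L := L)
      he.avoids_x he.avoids_y he.avoids_z hxy hzx.symm hyz hp hq ho hL
  refine ⟨⟨?_, ?_, ?_, ?_⟩, ⟨?_, ?_, ?_⟩, ?_⟩
  -- In this state `x₁`, `y₁`, `z₁` form a circle, so only two of them are absorbed. In the seven
  -- other states all three are.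
  · rw [hk, ← components_pendant_two S he.avoids_x he.avoids_y hxy (p := y₁) (q := z₁)
      (L := [(x₂, y₀), (y₂, z₀), (z₂, x₀)]) hxy.symm ⟨hzx, hyz.symm⟩ (by simp; tauto)]
    congr 1
    refine components_congr _ _ fun β φ => ?_
    rw [identifies_append, identifies_append, e1, e3, e5]
    simp only [identifies_cons, identifies_nil]
    grind
  · rw [hk, ← key x₀ x₀ x₀ [(x₂, y₀), (y₂, z₀), (z₂, x₀)] (by tauto) (by tauto) (by tauto)
      (by simp; tauto)]
    congr 1
    refine components_congr _ _ fun β φ => ?_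
    rw [identifies_append, identifies_append, e1, e3, e6]
    simp only [identifies_cons, identifies_nil]
    grind
  · rw [hk, ← key y₂ y₂ y₂ [(x₂, y₀), (y₂, z₀), (z₂, x₀)] (by tauto) (by tauto) (by tauto)
      (by simp; tauto)]
    congr 1
    refine components_congr _ _ fun β φ => ?_
    rw [identifies_append, identifies_append, e1, e4, e5]
    simp only [identifies_cons, identifies_nil]
    grind
  · rw [hk, ← key x₂ x₂ x₂ [(x₂, y₀), (y₂, z₀), (z₂, x₀)] (by tauto) (by tauto) (by tauto)
      (by simp; tauto)]
    congr 1
    refine components_congr _ _ fun β φ => ?_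
    rw [identifies_append, identifies_append, e2, e3, e5]
    simp only [identifies_cons, identifies_nil]
    grind
  · rw [hk, ← key z₀ z₀ x₀ [(x₂, y₀), (z₀, z₂), (y₂, x₀)] (by tauto) (by tauto) (by tauto)
      (by simp; tauto)]
    congr 1
    refine components_congr _ _ fun β φ => ?_
    rw [identifies_append, identifies_append, e1, e4, e6]
    simp only [identifies_cons, identifies_nil]
    grind
  · rw [hk, ← key y₀ x₀ x₀ [(y₂, z₀), (x₀, x₂), (z₂, y₀)] (by tauto) (by tauto) (by tauto)
      (by simp; tauto)]
    congr 1
    refine components_congr _ _ fun β φ => ?_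
    rw [identifies_append, identifies_append, e2, e3, e6]
    simp only [identifies_cons, identifies_nil]
    grind
  · rw [hk, ← key y₀ z₀ y₀ [(z₂, x₀), (y₀, y₂), (x₂, z₀)] (by tauto) (by tauto) (by tauto)
      (by simp; tauto)]
    congr 1
    refine components_congr _ _ fun β φ => ?_
    rw [identifies_append, identifies_append, e2, e4, e5]
    simp only [identifies_cons, identifies_nil]
    grind
  · rw [hk, ← key y₀ z₀ x₀ [(x₀, y₂), (y₀, z₂), (z₀, x₂)] (by tauto) (by tauto) (by tauto)
      (by simp; tauto)]
    congr 1
    refine components_congr _ _ fun β φ => ?_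
    rw [identifies_append, identifies_append, e2, e4, e6]
    simp only [identifies_cons, identifies_nil]
    grind

theorem along_not (εx εy : Bool) : along (!εx) (!εy) = along εx εy := by
  cases εx <;> cases εy <;> rfl

theorem against_not (εx εy : Bool) : against (!εx) (!εy) = against εx εy := by
  cases εx <;> cases εy <;> rfl

variable [Fintype V] [DecidableEq V] [CommRing K]

/-- The bracket is invariant under the third Reidemeister move. -/
theorem Triangle.bracket_eq [Finite E] {N' : Net (Option (Option (Option V))) E}
    (h : N.Triangle none (some none) (some (some none)) s₁ s₂ s₃ εx εy εz
      x₀ x₁ x₂ y₀ y₁ y₂ z₀ z₁ z₂)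
    (he : N.TriangleEdges none (some none) (some (some none)) x₀ x₁ x₂ y₀ y₁ y₂ z₀ z₁ z₂)
    (h' : N'.Triangle none (some none) (some (some none)) s₁ s₂ s₃ (!εx) (!εy) (!εz)
      x₂ x₁ x₀ y₂ y₁ y₀ z₂ z₁ z₀)
    (he' : N'.TriangleEdges none (some none) (some (some none)) x₂ x₁ x₀ y₂ y₁ y₀ z₂ z₁ z₀)
    (hN : N'.restrict.restrict.restrict = N.restrict.restrict.restrict) (δ : K)
    (w : Option (Option (Option V)) → Smoothing → K)
    (h₁ : w (some none) (along εy εz) * w (some (some none)) (along εz εx) = 1)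
    (h₂ : w (some none) (against εy εz) * w (some (some none)) (against εz εx) = 1)
    (h₃ : w (some none) (along εy εz) * w (some (some none)) (against εz εx) +
      w (some none) (against εy εz) * w (some (some none)) (along εz εx) = -δ) :
    N.bracket δ w = N'.bracket δ w := by
  rw [bracket_option_option_option, bracket_option_option_option]
  refine Finset.sum_congr rfl fun S _ => ?_
  congr 1
  set k : Smoothing → Smoothing → Smoothing → ℕ := fun t t' t'' =>
    N.restrict.restrict.restrict.components S
      (N.pairs none t ++ (N.pairs (some none) t' ++ N.pairs (some (some none)) t'')) with hk
  set k' : Smoothing → Smoothing → Smoothing → ℕ := fun t t' t'' =>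
    N'.restrict.restrict.restrict.components S
      (N'.pairs none t ++ (N'.pairs (some none) t' ++ N'.pairs (some (some none)) t'')) with hk'
  change ∑ t, ∑ t', ∑ t'', w none t * w (some none) t' * w (some (some none)) t'' *
      δ ^ (k t t' t'' - 1) = ∑ t, ∑ t', ∑ t'', w none t * w (some none) t' *
      w (some (some none)) t'' * δ ^ (k' t t' t'' - 1)
  have hp : ∀ t t' t'', 0 < k t t' t'' := fun t t' t'' => components_pos _ _ _
  have hp' : ∀ t t' t'', 0 < k' t t' t'' := fun t t' t'' => components_pos _ _ _
  obtain ⟨⟨c1, c2, c3, c4⟩, ⟨c5, c6, c7⟩, c8⟩ := h.components he S k fun _ _ _ => rfl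
  obtain ⟨⟨d1, d2, d3, d4⟩, ⟨d5, d6, d7⟩, d8⟩ := h'.components he' S k' fun _ _ _ => rfl
  simp only [along_not, against_not, hN] at d1 d2 d3 d4 d5 d6 d7 d8
  -- The states with exactly two vertices smoothed against the directions connect the outer ends in
  -- the same way before and after the move.
  have f5 : N.restrict.restrict.restrict.components S [(x₀, y₂), (z₂, z₀), (y₀, x₂)] =
      N.restrict.restrict.restrict.components S [(x₂, y₀), (z₀, z₂), (y₂, x₀)] := by
    refine components_congr _ _ fun β φ => ?_
    simp only [identifies_cons, identifies_nil]
    grind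
  have f6 : N.restrict.restrict.restrict.components S [(y₀, z₂), (x₂, x₀), (z₀, y₂)] =
      N.restrict.restrict.restrict.components S [(y₂, z₀), (x₀, x₂), (z₂, y₀)] := by
    refine components_congr _ _ fun β φ => ?_
    simp only [identifies_cons, identifies_nil]
    grind
  have f7 : N.restrict.restrict.restrict.components S [(z₀, x₂), (y₂, y₀), (x₀, z₂)] =
      N.restrict.restrict.restrict.components S [(z₂, x₀), (y₀, y₂), (x₂, z₀)] := by
    refine components_congr _ _ fun β φ => ?_
    simp only [identifies_cons, identifies_nil]
    grind
  have expand : ∀ F : Smoothing → Smoothing → Smoothing → K, ∑ t, ∑ t', ∑ t'', F t t' t'' = _ :=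
    fun F => (sum_smoothing_along εx εy _).trans (congrArg₂ (· + ·)
      ((sum_smoothing_along εy εz _).trans (congrArg₂ (· + ·) (sum_smoothing_along εz εx _)
        (sum_smoothing_along εz εx _)))
      ((sum_smoothing_along εy εz _).trans (congrArg₂ (· + ·) (sum_smoothing_along εz εx _)
        (sum_smoothing_along εz εx _))))
  rw [expand, expand]
  -- All remaining exponents are expressed by two numbers. Before the move `m` belongs to the states
  -- with one vertex smoothed against the directions and `n` to the state with all three; after the
  -- move `m` and `n` change roles.
  obtain ⟨m, hm⟩ := Nat.exists_eq_add_of_lt (hp (along εx εy) (along εy εz) (against εz εx))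
  obtain ⟨n, hn⟩ := Nat.exists_eq_add_of_lt (hp (against εx εy) (against εy εz) (against εz εx))
  rw [show k (along εx εy) (along εy εz) (along εz εx) - 1 = m + 1 by omega,
    show k (along εx εy) (along εy εz) (against εz εx) - 1 = m by omega,
    show k (along εx εy) (against εy εz) (along εz εx) - 1 = m by omega,
    show k (against εx εy) (along εy εz) (along εz εx) - 1 = m by omega,
    show k (against εx εy) (against εy εz) (against εz εx) - 1 = n by omega,
    show k' (along εx εy) (along εy εz) (along εz εx) - 1 = n + 1 by omega,
    show k' (along εx εy) (along εy εz) (against εz εx) - 1 = n by omega,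
    show k' (along εx εy) (against εy εz) (along εz εx) - 1 = n by omega,
    show k' (against εx εy) (along εy εz) (along εz εx) - 1 = n by omega,
    show k' (against εx εy) (against εy εz) (against εz εx) - 1 = m by omega,
    show k' (along εx εy) (against εy εz) (against εz εx) =
      k (along εx εy) (against εy εz) (against εz εx) by omega,
    show k' (against εx εy) (along εy εz) (against εz εx) =
      k (against εx εy) (along εy εz) (against εz εx) by omega,
    show k' (against εx εy) (against εy εz) (along εz εx) =
      k (against εx εy) (against εy εz) (along εz εx) by omega]
  -- When `xy` is smoothed along the directions, the terms in `m` and in `n` cancel by `h₁` and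
  -- `h₃`. When it is smoothed against them, `h₁` and `h₂` leave `δ ^ m + δ ^ n`, which is
  -- symmetric.
  linear_combination (w none (along εx εy) * δ * (δ ^ m - δ ^ n) +
    w none (against εx εy) * (δ ^ m - δ ^ n)) * h₁ +
    w none (along εx εy) * (δ ^ m - δ ^ n) * h₃ -
    w none (against εx εy) * (δ ^ m - δ ^ n) * h₂

end Triangle

end Net

end

/-! ### Kauffman states as coefficients of products of linear forms. -/

section

open MvPolynomial

/-! ### Coefficients of multilinear monomials -/

section Coeff

variable {ρ ρ' V V' K : Type} [CommRing K]

/-- Kauffman states are counted by a squarefree monomial. Local identities are therefore needed only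
up to multiples of squares of region variables. -/
theorem coeff_X_sq_mul {N : ρ →₀ ℕ} {f : ρ} (hN : N f ≤ 1) (p : MvPolynomial ρ K) :
    coeff N (X f ^ 2 * p) = 0 := by
  classical
  rw [X_pow_eq_monomial, coeff_monomial_mul', if_neg]
  intro h
  have := h f
  simp at this
  omega

theorem coeff_eq_zero_of_supported {N : ρ →₀ ℕ} {f : ρ} (hN : N f ≠ 0) {p : MvPolynomial ρ K}
    (hp : p ∈ supported K ({f}ᶜ : Set ρ)) : coeff N p = 0 := by
  classical
  by_contra h
  have h1 : f ∈ p.vars := mem_vars_iff_mem_support f |>.2 ⟨N, mem_support_iff.2 h, Finsupp.mem_support_iff.2 hN⟩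
  exact (mem_supported.1 hp h1) rfl

/-- The part of a product of two linear forms that is linear in the variable `f`. -/
theorem coeff_two {N : ρ →₀ ℕ} {f : ρ} (hN : N f = 1) {l₁ l₂ p : MvPolynomial ρ K} (a₁ a₂ : K)
    (h₁ : l₁ ∈ supported K ({f}ᶜ : Set ρ)) (h₂ : l₂ ∈ supported K ({f}ᶜ : Set ρ))
    (hp : p ∈ supported K ({f}ᶜ : Set ρ)) :
    coeff N ((C a₁ * X f + l₁) * ((C a₂ * X f + l₂) * p)) =
      coeff N (X f * ((C a₁ * l₂ + C a₂ * l₁) * p)) := by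
  have h0 := coeff_eq_zero_of_supported (by omega) (mul_mem (mul_mem h₁ h₂) hp)
    (N := N) (f := f)
  have h2 := coeff_X_sq_mul (N := N) (f := f) (by omega) (C a₁ * C a₂ * p)
  have : (C a₁ * X f + l₁) * ((C a₂ * X f + l₂) * p) =
      X f * ((C a₁ * l₂ + C a₂ * l₁) * p) + (X f ^ 2 * (C a₁ * C a₂ * p) + l₁ * l₂ * p) := by
    ring
  rw [this, coeff_add, coeff_add, h0, h2, add_zero, add_zero]

/-- The part of a product of three linear forms that is linear in the variable `f`. -/
theorem coeff_three {N : ρ →₀ ℕ} {f : ρ} (hN : N f = 1) {l₁ l₂ l₃ p : MvPolynomial ρ K}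
    (a₁ a₂ a₃ : K) (h₁ : l₁ ∈ supported K ({f}ᶜ : Set ρ)) (h₂ : l₂ ∈ supported K ({f}ᶜ : Set ρ))
    (h₃ : l₃ ∈ supported K ({f}ᶜ : Set ρ)) (hp : p ∈ supported K ({f}ᶜ : Set ρ)) :
    coeff N ((C a₁ * X f + l₁) * ((C a₂ * X f + l₂) * ((C a₃ * X f + l₃) * p))) =
      coeff N (X f * ((C a₁ * l₂ * l₃ + C a₂ * l₁ * l₃ + C a₃ * l₁ * l₂) * p)) := by
  have h0 := coeff_eq_zero_of_supported (by omega) (mul_mem (mul_mem (mul_mem h₁ h₂) h₃) hp)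
    (N := N) (f := f)
  have h2 := coeff_X_sq_mul (N := N) (f := f) (by omega)
    ((C a₁ * C a₂ * C a₃ * X f + C a₁ * C a₂ * l₃ + C a₁ * C a₃ * l₂ + C a₂ * C a₃ * l₁) * p)
  have : (C a₁ * X f + l₁) * ((C a₂ * X f + l₂) * ((C a₃ * X f + l₃) * p)) =
      X f * ((C a₁ * l₂ * l₃ + C a₂ * l₁ * l₃ + C a₃ * l₁ * l₂) * p) + (X f ^ 2 *
      ((C a₁ * C a₂ * C a₃ * X f + C a₁ * C a₂ * l₃ + C a₁ * C a₃ * l₂ + C a₂ * C a₃ * l₁) * p) +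
      l₁ * l₂ * l₃ * p) := by
    ring
  rw [this, coeff_add, coeff_add, h0, h2, add_zero, add_zero]

open Classical in
/-- The indicator function of the regions that are not star regions. -/
def nonstar [Finite ρ] (st : Side → ρ) : ρ →₀ ℕ :=
  Finsupp.equivFunOnFinite.symm fun f => if ∃ s, st s = f then 0 else 1

open Classical in
theorem nonstar_apply [Finite ρ] (st : Side → ρ) (f : ρ) :
    nonstar st f = if ∃ s, st s = f then 0 else 1 := rfl

theorem nonstar_congr [Finite ρ] [Finite ρ'] {st : Side → ρ} {st' : Side → ρ'} {f : ρ} {f' : ρ'}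
    (h : (∃ s, st s = f) ↔ ∃ s, st' s = f') : nonstar st f = nonstar st' f' := by
  rw [nonstar_apply, nonstar_apply]
  by_cases h' : ∃ s, st s = f
  · rw [if_pos h', if_pos (h.1 h')]
  · rw [if_neg h', if_neg (h'.imp h.2)]

theorem nonstar_le_one [Finite ρ] (st : Side → ρ) (f : ρ) : nonstar st f ≤ 1 := by
  rw [nonstar_apply]
  split_ifs <;> simp

/-- The weights of the dots at a vertex. -/
def dotCoeff (z b : K) : Quadrant → K
  | .top => b
  | .left => 1
  | .bottom => b - z
  | .right => 1

/-- The sum of the dots at a vertex. -/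
def dotForm (z b : K) (reg : Quadrant → ρ) : MvPolynomial ρ K :=
  ∑ q, C (dotCoeff z b q) * X (reg q)

/-- The sum over the Kauffman states of a diagram with the regions `ρ`. -/
def stateSum [Fintype V] [Finite ρ] (z : K) (b : V → K) (reg : V → Quadrant → ρ)
    (st : Side → ρ) : K :=
  coeff (nonstar st) (∏ v, dotForm z (b v) (reg v))

theorem rename_dotForm (f : ρ → ρ') (z b : K) (reg : Quadrant → ρ) :
    rename f (dotForm z b reg) = dotForm z b fun q => f (reg q) := by
  simp [dotForm]

theorem rename_prod_dotForm [Fintype V] (f : ρ → ρ') (z : K) (b : V → K)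
    (reg : V → Quadrant → ρ) :
    rename f (∏ v, dotForm z (b v) (reg v)) = ∏ v, dotForm z (b v) fun q => f (reg v q) := by
  simp [map_prod, rename_dotForm]

theorem isHomogeneous_dotForm (z b : K) (reg : Quadrant → ρ) :
    (dotForm z b reg).IsHomogeneous 1 :=
  IsHomogeneous.sum _ _ _ fun q _ => by simpa using (isHomogeneous_C _ _).mul (isHomogeneous_X K _)

theorem isHomogeneous_prod_dotForm [Fintype V] (z : K) (b : V → K) (reg : V → Quadrant → ρ) :
    (∏ v, dotForm z (b v) (reg v)).IsHomogeneous (Fintype.card V) := by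
  simpa using IsHomogeneous.prod Finset.univ _ (fun _ => 1)
    fun v _ => isHomogeneous_dotForm z (b v) (reg v)

theorem dotForm_mem_supported {f : ρ} (z b : K) (reg : Quadrant → ρ) (h : ∀ q, reg q ≠ f) :
    dotForm z b reg ∈ supported K ({f}ᶜ : Set ρ) :=
  sum_mem fun q _ => mul_mem (Subalgebra.algebraMap_mem _ _)
    (Algebra.subset_adjoin ⟨reg q, h q, rfl⟩)

theorem prod_dotForm_mem_supported [Fintype V] {f : ρ} (z : K) (b : V → K)
    (reg : V → Quadrant → ρ) (h : ∀ v q, reg v q ≠ f) :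
    ∏ v, dotForm z (b v) (reg v) ∈ supported K ({f}ᶜ : Set ρ) :=
  prod_mem fun v _ => dotForm_mem_supported z (b v) (reg v) (h v)

theorem C_mul_X_mem_supported {f g : ρ} (a : K) (h : g ≠ f) :
    C a * X g ∈ supported K ({f}ᶜ : Set ρ) :=
  mul_mem (Subalgebra.algebraMap_mem _ _) (Algebra.subset_adjoin ⟨g, h, rfl⟩)

theorem mapDomain_nonstar [Finite ρ] [Finite ρ'] (e : ρ ≃ ρ') (st : Side → ρ) :
    (nonstar st).mapDomain e = nonstar fun s => e (st s) := by
  ext f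
  obtain ⟨f, rfl⟩ := e.surjective f
  rw [Finsupp.mapDomain_apply e.injective]
  exact nonstar_congr (by simp)

theorem stateSum_map [Fintype V] [Finite ρ] [Finite ρ'] (e : ρ ≃ ρ') (z : K) (b : V → K)
    (reg : V → Quadrant → ρ) (st : Side → ρ) :
    stateSum z b (fun v q => e (reg v q)) (fun s => e (st s)) = stateSum z b reg st := by
  rw [stateSum, stateSum, ← mapDomain_nonstar, ← rename_prod_dotForm,
    coeff_rename_mapDomain _ e.injective]

theorem stateSum_option [Fintype V] [Finite ρ] (z : K) (b : Option V → K)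
    (reg : Option V → Quadrant → ρ) (st : Side → ρ) :
    stateSum z b reg st = coeff (nonstar st) (dotForm z (b none) (reg none) *
      ∏ v, dotForm z (b (some v)) (reg (some v))) := by
  rw [stateSum, Fintype.prod_option]

/-- The new region `none` is never a star region, so the monomial to be extracted is `X none` times
the old one. -/
theorem coeff_X_none_mul [Finite ρ] (st : Side → ρ) (p : MvPolynomial ρ K) :
    coeff (nonstar fun s => some (st s)) (X none * rename some p) = coeff (nonstar st) p := by
  have : nonstar (fun s => some (st s)) =
      Finsupp.single none 1 + (nonstar st).mapDomain some := by
    ext (_ | f)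
    · rw [Finsupp.add_apply, Finsupp.mapDomain_of_notMem_range _ _ (by simp)]
      simp [nonstar_apply]
    · rw [Finsupp.add_apply, Finsupp.mapDomain_apply (Option.some_injective _),
        Finsupp.single_eq_of_ne (by simp), zero_add]
      exact nonstar_congr (by simp)
  rw [this, coeff_X_mul, coeff_rename_mapDomain _ (Option.some_injective _)]

theorem nonstar_eq_zero [Finite ρ] {st : Side → ρ} {f : ρ} (h : ∃ s, st s = f) :
    nonstar st f = 0 := if_pos h

theorem nonstar_eq_one [Finite ρ] {st : Side → ρ} {f : ρ} (h : ∀ s, st s ≠ f) :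
    nonstar st f = 1 := if_neg (by simpa using h)

open Classical in
theorem mapDomain_apply_eq_sum {M : Type} [AddCommMonoid M] [Fintype ρ] (τ : ρ → ρ')
    (m : ρ →₀ M) (y : ρ') : m.mapDomain τ y = ∑ x, if τ x = y then m x else 0 := by
  rw [Finsupp.mapDomain, Finsupp.sum_fintype _ _ (by simp), Finsupp.finsetSum_apply]
  simp [Finsupp.single_apply]

section Split

variable [Finite ρ] {t f g : ρ} {τ : ρ → Option ρ'}

theorem mapDomain_split_apply
    (hinj : ∀ x y, τ x = τ y → x = y ∨ ((x = f ∨ x = g) ∧ (y = f ∨ y = g)))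
    (m : ρ →₀ ℕ) {x : ρ} (hf : x ≠ f) (hg : x ≠ g) : m.mapDomain τ (τ x) = m x := by
  classical
  have := Fintype.ofFinite ρ
  rw [mapDomain_apply_eq_sum, Finset.sum_eq_single x]
  · simp
  · intro y _ hy
    rw [if_neg]
    intro h
    have := hinj y x h
    tauto
  · simp

theorem mapDomain_split_apply_left
    (hinj : ∀ x y, τ x = τ y → x = y ∨ ((x = f ∨ x = g) ∧ (y = f ∨ y = g)))
    (hfg : f ≠ g) (hτ : τ f = τ g) (m : ρ →₀ ℕ) : m.mapDomain τ (τ f) = m f + m g := by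
  classical
  have := Fintype.ofFinite ρ
  rw [mapDomain_apply_eq_sum, Finset.sum_eq_add f g hfg]
  · simp [hτ]
  · intro y _ hy
    rw [if_neg]
    intro h
    have := hinj y f h
    tauto
  · simp
  · simp

theorem coeff_some_nonstar [Finite ρ'] (st' : Side → ρ') (p : MvPolynomial ρ' K) :
    coeff ((nonstar st').mapDomain some) (rename some p) = coeff (nonstar st') p :=
  coeff_rename_mapDomain _ (Option.some_injective _) _ _

theorem mapDomain_nonstar_split [Finite ρ'] {st : Side → ρ} {st' : Side → ρ'}
    (hinj : ∀ x y, τ x = τ y → x = y ∨ ((x = f ∨ x = g) ∧ (y = f ∨ y = g)))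
    (hst : ∀ s, τ (st s) = some (st' s)) {x : ρ} (hx : τ x ≠ none) (hf : x ≠ f) (hg : x ≠ g) :
    (nonstar st').mapDomain some (τ x) = nonstar st x := by
  obtain ⟨y, hy⟩ := Option.ne_none_iff_exists'.1 hx
  rw [hy, Finsupp.mapDomain_apply (Option.some_injective _)]
  refine nonstar_congr ⟨?_, ?_⟩
  · rintro ⟨s, rfl⟩
    have := hinj (st s) x ((hst s).trans hy.symm)
    exact ⟨s, by tauto⟩
  · rintro ⟨s, rfl⟩
    exact ⟨s, Option.some_injective _ ((hst s).symm.trans hy)⟩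

/-- The merged region is a star region as soon as one of `f` and `g` is, hence the product of the
two exponents. -/
theorem mapDomain_nonstar_split_left [Finite ρ'] {st : Side → ρ} {st' : Side → ρ'}
    (hinj : ∀ x y, τ x = τ y → x = y ∨ ((x = f ∨ x = g) ∧ (y = f ∨ y = g)))
    (hτ : τ f = τ g) (hst : ∀ s, τ (st s) = some (st' s)) (hf : τ f ≠ none) :
    (nonstar st').mapDomain some (τ f) = nonstar st f * nonstar st g := by
  obtain ⟨y, hy⟩ := Option.ne_none_iff_exists'.1 hf
  rw [hy, Finsupp.mapDomain_apply (Option.some_injective _)]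
  by_cases h : ∃ s, st' s = y
  · rw [nonstar_eq_zero h]
    obtain ⟨s, rfl⟩ := h
    have := hinj (st s) f ((hst s).trans hy.symm)
    rcases (show st s = f ∨ st s = g by tauto) with h | h
    · rw [nonstar_eq_zero ⟨s, h⟩, zero_mul]
    · rw [nonstar_eq_zero (f := g) ⟨s, h⟩, mul_zero]
  · push Not at h
    rw [nonstar_eq_one h, nonstar_eq_one, nonstar_eq_one]
    · rintro s rfl
      exact h s (Option.some_injective _ ((hst s).symm.trans (hτ.symm.trans hy)))
    · rintro s rfl
      exact h s (Option.some_injective _ ((hst s).symm.trans hy))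

/-- A variable that is split into `f` and `g`. -/
theorem coeff_rename_split [Finite ρ'] {n : ℕ} (hsurj : Function.Surjective τ)
    (st : Side → ρ) (st' : Side → ρ') (hst : ∀ s, τ (st s) = some (st' s))
    (ht : τ t = none) (hfg : f ≠ g) (hτ : τ f = τ g) (hf : τ f ≠ none)
    (hinj : ∀ x y, τ x = τ y → x = y ∨ ((x = f ∨ x = g) ∧ (y = f ∨ y = g)))
    (hcard : Nat.card ρ = n + 4) {p : MvPolynomial ρ K} (hp : p.IsHomogeneous n)
    (hpt : p ∈ supported K ({t}ᶜ : Set ρ)) (p' : MvPolynomial ρ' K)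
    (hp' : rename some p' = rename τ p) :
    coeff (nonstar st) (X t * ((X f + X g) * p)) = coeff (nonstar st') p' := by
  classical
  have := Fintype.ofFinite ρ
  rw [← coeff_some_nonstar st', hp']
  have htf : t ≠ f := by rintro rfl; exact hf ht
  have htg : t ≠ g := by rintro rfl; exact hf (hτ.trans ht)
  have hNt : nonstar st t = 1 := nonstar_eq_one fun s h => by simp [← h, hst] at ht
  have hτ' : ∀ x, x ≠ t → τ x ≠ none := by
    intro x hx h
    rcases hinj x t (h.trans ht.symm) with h | h
    · exact hx h
    · tauto
  have hM1 : ∀ x, x ≠ t → x ≠ f → x ≠ g →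
      (nonstar st').mapDomain some (τ x) = nonstar st x := fun x hx hxf hxg =>
    mapDomain_nonstar_split hinj hst (hτ' x hx) hxf hxg
  have hM2 := mapDomain_nonstar_split_left hinj hτ hst hf
  have hM3 : (nonstar st').mapDomain some (τ t) = 0 := by
    rw [ht, Finsupp.mapDomain_of_notMem_range _ _ (by simp)]
  have hN : ∀ x, nonstar st x ≤ 1 := nonstar_le_one st
  -- There are at most two star regions. If `f` and `g` both are, no other region is.
  have hN0 : nonstar st f = 0 → nonstar st g = 0 →
      ∀ x, x ≠ f → x ≠ g → nonstar st x = 1 := by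
    intro h1 h2 x hxf hxg
    have h3 : ∃ s, st s = f := by
      by_contra h
      rw [nonstar_eq_one (by simpa using h)] at h1
      omega
    have h4 : ∃ s, st s = g := by
      by_contra h
      rw [nonstar_eq_one (by simpa using h)] at h2
      omega
    obtain ⟨a, ha⟩ := h3
    obtain ⟨b, hb⟩ := h4
    refine nonstar_eq_one fun s hs => ?_
    cases a <;> cases b <;> cases s <;> simp_all
  generalize nonstar st = N at *
  generalize (nonstar st').mapDomain some = M at *
  -- Monomial by monomial: if neither `f` nor `g` is a star region, exactly one of them is missing
  -- from a contributing `m`, and the factor `X f + X g` supplies it. If just one is a star region,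
  -- `m` contains neither and the factor supplies the other one.
  have key : ∀ m ∈ p.support, ∀ a : K,
      coeff N (X t * ((X f + X g) * monomial m a)) = coeff M (rename τ (monomial m a)) := by
    intro m hm a
    have hmt : m t = 0 := by
      by_contra h
      exact mem_supported.1 hpt ((mem_vars_iff_mem_support t).2
        ⟨m, hm, Finsupp.mem_support_iff.2 h⟩) rfl
    have hdeg : ∑ x, m x = n := by
      rw [← Finsupp.degree_eq_sum]
      rw [Finsupp.degree_eq_weight_one]
      exact hp (mem_support_iff.1 hm)
    have e1 : ∀ u v : ρ, t ≠ u → t ≠ v → u ≠ v →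
        ((Finsupp.single t 1 + (Finsupp.single u 1 + m) = N) ↔
        (∀ x, x ≠ t → x ≠ u → x ≠ v → m x = N x) ∧ 1 + m u = N u ∧ m v = N v) := by
      intro u v hu hv huv
      rw [Finsupp.ext_iff]
      simp only [Finsupp.add_apply, Finsupp.single_apply]
      constructor
      · refine fun h => ⟨fun x hx hxu hxv => ?_, ?_, ?_⟩
        · simpa [hx.symm, hxu.symm] using h x
        · simpa [hu] using h u
        · simpa [hv, huv] using h v
      · rintro ⟨h1, h2, h3⟩ x
        rcases eq_or_ne x t with rfl | hx
        · simp [hu.symm, hmt, hNt]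
        rcases eq_or_ne x u with rfl | hxu
        · simpa [hx.symm] using h2
        rcases eq_or_ne x v with rfl | hxv
        · simpa [hx.symm, hxu.symm] using h3
        simpa [hx.symm, hxu.symm] using h1 x hx hxu hxv
    have e3 : m.mapDomain τ = M ↔
        (∀ x, x ≠ t → x ≠ f → x ≠ g → m x = N x) ∧ m f + m g = N f * N g := by
      rw [Finsupp.ext_iff]
      constructor
      · refine fun h => ⟨fun x hx hxf hxg => ?_, ?_⟩
        · rw [← mapDomain_split_apply hinj m hxf hxg, h, hM1 x hx hxf hxg]
        · rw [← mapDomain_split_apply_left hinj hfg hτ, h, hM2]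
      · rintro ⟨h1, h2⟩ y
        obtain ⟨x, rfl⟩ := hsurj y
        rcases eq_or_ne x t with rfl | hx
        · rw [mapDomain_split_apply hinj m htf htg, hM3, hmt]
        rcases eq_or_ne x f with rfl | hxf
        · rw [mapDomain_split_apply_left hinj hfg hτ, hM2, h2]
        rcases eq_or_ne x g with rfl | hxg
        · rw [← hτ, mapDomain_split_apply_left hinj hfg hτ, hM2, h2]
        rw [mapDomain_split_apply hinj m hxf hxg, hM1 x hx hxf hxg, h1 x hx hxf hxg]
    -- This rules out the case of two star regions, in which the left side vanishes. A monomial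
    -- counted on the right would contain every region except `t`, `f`, `g` once, so its degree
    -- would be `n + 1`.
    have e4 : (∀ x, x ≠ t → x ≠ f → x ≠ g → m x = N x) → m f = 0 → m g = 0 →
        N f = 0 → N g = 0 → False := by
      intro h1 h2 h3 h4 h5
      have h6 : ∀ x, m x + ((if x = t then 1 else 0) + (if x = f then 1 else 0) +
          (if x = g then 1 else 0)) = 1 := by
        intro x
        rcases eq_or_ne x t with rfl | hx
        · simp [htf, htg, hmt]
        rcases eq_or_ne x f with rfl | hxf
        · simp [hx, hfg, h2]
        rcases eq_or_ne x g with rfl | hxg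
        · simp [hx, hxf, h3]
        simp [hx, hxf, hxg, h1 x hx hxf hxg, hN0 h4 h5 x hxf hxg]
      have h7 : ∑ x : ρ, (m x + ((if x = t then 1 else 0) + (if x = f then 1 else 0) +
          (if x = g then 1 else 0))) = n + 4 := by
        rw [Finset.sum_congr rfl fun x _ => h6 x]
        simp [← hcard, Nat.card_eq_fintype_card]
      simp only [Finset.sum_add_distrib, hdeg, Finset.sum_ite_eq', Finset.mem_univ, if_true] at h7
      omega
    rw [rename_monomial, coeff_monomial, add_mul, mul_add, coeff_add]
    simp only [X, monomial_mul, one_mul, coeff_monomial]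
    simp only [e1 f g htf htg hfg, e1 g f htg htf hfg.symm, e3]
    have h8 := hN f
    have h9 := hN g
    by_cases hA : ∀ x, x ≠ t → x ≠ f → x ≠ g → m x = N x
    · have hA' : ∀ x, x ≠ t → x ≠ g → x ≠ f → m x = N x := fun x h1 h2 h3 => hA x h1 h3 h2
      rw [if_congr (and_iff_right hA) rfl rfl, if_congr (and_iff_right hA') rfl rfl,
        if_congr (and_iff_right hA) rfl rfl]
      have h12 : ¬ (m f = 0 ∧ m g = 0 ∧ N f = 0 ∧ N g = 0) :=
        fun ⟨h1, h2, h3, h4⟩ => e4 hA h1 h2 h3 h4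
      obtain h10 | h10 : N f = 0 ∨ N f = 1 := by omega
      all_goals
        obtain h11 | h11 : N g = 0 ∨ N g = 1 := by omega
        all_goals
          rw [h10, h11]
          split_ifs <;> first | (exfalso; omega) | simp
    · have hA' : ¬ ∀ x, x ≠ t → x ≠ g → x ≠ f → m x = N x :=
        fun h => hA fun x h1 h2 h3 => h x h1 h3 h2
      simp only [hA, hA', false_and, if_false, add_zero]
  conv_lhs => rw [p.as_sum]
  conv_rhs => rw [p.as_sum]
  simp only [Finset.mul_sum, map_sum, coeff_sum]
  exact Finset.sum_congr rfl fun m hm => key m hm _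

end Split

end Coeff

end

/-! ### Quadrants, sides and regions of a net. -/

section

/-- The left side if `ε` is true, and the right side otherwise. -/
def Side.ofBool (ε : Bool) : Side := if ε then .left else .right

/-- True for the strand `ne`. -/
def Strand.sign : Strand → Bool
  | .ne => true
  | .nw => false

theorem Strand.sign_opp (s : Strand) : s.opp.sign = !s.sign := by cases s <;> rfl

theorem Side.eq_ofBool (σ : Side) (ε : Bool) : σ = Side.ofBool ε ∨ σ = Side.ofBool (!ε) := by
  cases σ <;> cases ε <;> simp [Side.ofBool]

theorem Side.ofBool_inj (ε ε' : Bool) : Side.ofBool ε = Side.ofBool ε' ↔ ε = ε' := by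
  cases ε <;> cases ε' <;> simp [Side.ofBool]

/-- The opposite quadrant. -/
def Quadrant.opp : Quadrant → Quadrant
  | .top => .bottom
  | .bottom => .top
  | .left => .right
  | .right => .left

/-- The quadrant between the incoming half of the strand `s` and the outgoing half of the other
strand, after reversing the strands according to `εx` and `εy`. -/
def quadrantIn (s : Strand) : Bool → Bool → Quadrant
  | true, true => if s.sign then .left else .right
  | true, false => .bottom
  | false, true => .top
  | false, false => if s.sign then .right else .left

/-- The quadrant between the outgoing halves of the strand `s` and of the other strand,
after reversing the strands according to `εx` and `εy`. -/
def quadrantOut (s : Strand) : Bool → Bool → Quadrant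
  | true, true => .top
  | true, false => if s.sign then .right else .left
  | false, true => if s.sign then .left else .right
  | false, false => .bottom

theorem sum_quadrant_in_out {K : Type} [AddCommMonoid K] (s : Strand) (εx εy : Bool)
    (F : Quadrant → K) : ∑ q, F q = F (quadrantIn s εx εy) + F (quadrantOut s εx εy) +
      F (quadrantIn s εx εy).opp + F (quadrantOut s εx εy).opp := by
  rw [sum_quadrant]
  cases s <;> cases εx <;> cases εy <;>
    simp [quadrantIn, quadrantOut, Quadrant.opp, Strand.sign] <;> abel

theorem forall_quadrant_in_out (s : Strand) (εx εy : Bool) (P : Quadrant → Prop) :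
    (∀ q, P q) ↔ P (quadrantIn s εx εy) ∧ P (quadrantOut s εx εy) ∧
      P (quadrantIn s εx εy).opp ∧ P (quadrantOut s εx εy).opp := by
  constructor
  · exact fun h => ⟨h _, h _, h _, h _⟩
  · intro h q
    cases s <;> cases εx <;> cases εy <;> cases q <;>
      simp_all [quadrantIn, quadrantOut, Quadrant.opp, Strand.sign]

namespace Net

variable {V V' E E' K : Type}

/-! ### The regions of a net -/

/-- The two sides of edges that bound a quadrant at a vertex. -/
def corner (N : Net V E) (v : V) : Quadrant → (E × Side) × (E × Side)
  | .top => ((N.out v .nw, .right), (N.out v .ne, .left))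
  | .left => ((N.out v .nw, .left), (N.inn v .ne, .left))
  | .bottom => ((N.inn v .ne, .right), (N.inn v .nw, .left))
  | .right => ((N.inn v .nw, .right), (N.out v .ne, .right))

/-- Two sides of edges that bound the same region near a vertex or at infinity. -/
def sameRegion (N : Net V E) : E × Side → E × Side → Prop :=
  fun a b => (∃ v q, N.corner v q = (a, b)) ∨ ∃ s, a = (N.first, s) ∧ b = (N.last, s)

/-- The regions of a net. -/
def Region (N : Net V E) : Type := Quot N.sameRegion

instance [Finite E] (N : Net V E) : Finite N.Region :=
  inferInstanceAs (Finite (Quot _))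

/-- The region to the side `s` of the edge `e`. -/
def region (N : Net V E) (e : E) (s : Side) : N.Region := Quot.mk _ (e, s)

/-- The region that contains the quadrant `q` at `v`. -/
def regionAt (N : Net V E) (v : V) (q : Quadrant) : N.Region :=
  N.region (N.corner v q).1.1 (N.corner v q).1.2

theorem regionAt_eq (N : Net V E) (v : V) (q : Quadrant) :
    N.region (N.corner v q).1.1 (N.corner v q).1.2 =
      N.region (N.corner v q).2.1 (N.corner v q).2.2 :=
  Quot.sound (Or.inl ⟨v, q, rfl⟩)

theorem region_first (N : Net V E) (s : Side) : N.region N.first s = N.region N.last s :=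
  Quot.sound (Or.inr ⟨s, rfl, rfl⟩)

/-- The sum over the Kauffman states of a net. -/
def alexander [Fintype V] [Finite E] [CommRing K] (N : Net V E) (z : K) (b : V → K) : K :=
  stateSum z b N.regionAt fun s => N.region N.first s

/-- This and the next three lemmas describe the quadrants at a vertex by two strands with chosen
directions. The pair appears in either order, because `corner` lists the sides relative to the
orientation of the net. -/
theorem corner_in (N : Net V E) (v : V) (s : Strand) (εx εy : Bool) :
    let p := N.corner v (quadrantIn s εx εy)
    let a := (N.rin v s εx, Side.ofBool (s.sign == εy))
    let b := (N.rout v s.opp εy, Side.ofBool (s.sign == εx))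
    p = (a, b) ∨ p = (b, a) := by
  cases s <;> cases εx <;> cases εy <;>
    simp [corner, quadrantIn, Strand.sign, Strand.opp, rin, rout, Side.ofBool]

theorem corner_out (N : Net V E) (v : V) (s : Strand) (εx εy : Bool) :
    let p := N.corner v (quadrantOut s εx εy)
    let a := (N.rout v s εx, Side.ofBool (s.sign == εy))
    let b := (N.rout v s.opp εy, Side.ofBool (!(s.sign == εx)))
    p = (a, b) ∨ p = (b, a) := by
  cases s <;> cases εx <;> cases εy <;>
    simp [corner, quadrantOut, Strand.sign, Strand.opp, rout, Side.ofBool]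

theorem corner_in_opp (N : Net V E) (v : V) (s : Strand) (εx εy : Bool) :
    let p := N.corner v (quadrantIn s εx εy).opp
    let a := (N.rout v s εx, Side.ofBool (!(s.sign == εy)))
    let b := (N.rin v s.opp εy, Side.ofBool (!(s.sign == εx)))
    p = (a, b) ∨ p = (b, a) := by
  cases s <;> cases εx <;> cases εy <;>
    simp [corner, quadrantIn, Quadrant.opp, Strand.sign, Strand.opp, rin, rout, Side.ofBool]

theorem corner_out_opp (N : Net V E) (v : V) (s : Strand) (εx εy : Bool) :
    let p := N.corner v (quadrantOut s εx εy).opp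
    let a := (N.rin v s εx, Side.ofBool (!(s.sign == εy)))
    let b := (N.rin v s.opp εy, Side.ofBool (s.sign == εx))
    p = (a, b) ∨ p = (b, a) := by
  cases s <;> cases εx <;> cases εy <;>
    simp [corner, quadrantOut, Quadrant.opp, Strand.sign, Strand.opp, rin, Side.ofBool]

theorem eq_of_pair {α β : Type} {F : α → β} {p : α × α} {a b : α} (h : p = (a, b) ∨ p = (b, a)) :
    F p.1 = F p.2 ↔ F a = F b := by
  rcases h with rfl | rfl
  · rfl
  · exact eq_comm

theorem regionAt_of_pair (N : Net V E) {v : V} {q : Quadrant} {a b : E × Side}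
    (h : N.corner v q = (a, b) ∨ N.corner v q = (b, a)) : N.regionAt v q = N.region a.1 a.2 := by
  rcases h with h | h
  · rw [regionAt, h]
  · rw [regionAt, regionAt_eq, h]

/-- The condition that a function is constant on the corners at `v`. -/
theorem forall_corner {β : Type} (N : Net V E) (v : V) (s : Strand) (εx εy : Bool)
    (F : E × Side → β) : (∀ q, F (N.corner v q).1 = F (N.corner v q).2) ↔
      F (N.rin v s εx, .ofBool (s.sign == εy)) = F (N.rout v s.opp εy, .ofBool (s.sign == εx)) ∧
      F (N.rout v s εx, .ofBool (s.sign == εy)) =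
        F (N.rout v s.opp εy, .ofBool (!(s.sign == εx))) ∧
      F (N.rout v s εx, .ofBool (!(s.sign == εy))) =
        F (N.rin v s.opp εy, .ofBool (!(s.sign == εx))) ∧
      F (N.rin v s εx, .ofBool (!(s.sign == εy))) =
        F (N.rin v s.opp εy, .ofBool (s.sign == εx)) := by
  rw [forall_quadrant_in_out s εx εy, eq_of_pair (N.corner_in v s εx εy),
    eq_of_pair (N.corner_out v s εx εy), eq_of_pair (N.corner_in_opp v s εx εy),
    eq_of_pair (N.corner_out_opp v s εx εy)]

theorem region_corner (N : Net V E) (v : V) (s : Strand) (εx εy : Bool) :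
    N.region (N.rin v s εx) (.ofBool (s.sign == εy)) =
        N.region (N.rout v s.opp εy) (.ofBool (s.sign == εx)) ∧
      N.region (N.rout v s εx) (.ofBool (s.sign == εy)) =
        N.region (N.rout v s.opp εy) (.ofBool (!(s.sign == εx))) ∧
      N.region (N.rout v s εx) (.ofBool (!(s.sign == εy))) =
        N.region (N.rin v s.opp εy) (.ofBool (!(s.sign == εx))) ∧
      N.region (N.rin v s εx) (.ofBool (!(s.sign == εy))) =
        N.region (N.rin v s.opp εy) (.ofBool (s.sign == εx)) :=
  (N.forall_corner v s εx εy fun x => N.region x.1 x.2).1 fun q => N.regionAt_eq v q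

/-- The dots at a vertex, expressed by two strands with chosen directions. -/
theorem dotForm_regionAt [CommRing K] {ρ : Type} (N : Net V E) (F : N.Region → ρ) (v : V)
    (s : Strand) (εx εy : Bool) (z b : K) :
    dotForm z b (fun q => F (N.regionAt v q)) =
      .C (dotCoeff z b (quadrantIn s εx εy)) *
        .X (F (N.region (N.rin v s εx) (.ofBool (s.sign == εy)))) +
      .C (dotCoeff z b (quadrantOut s εx εy)) *
        .X (F (N.region (N.rout v s εx) (.ofBool (s.sign == εy)))) +
      .C (dotCoeff z b (quadrantIn s εx εy).opp) *
        .X (F (N.region (N.rout v s εx) (.ofBool (!(s.sign == εy))))) +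
      .C (dotCoeff z b (quadrantOut s εx εy).opp) *
        .X (F (N.region (N.rin v s εx) (.ofBool (!(s.sign == εy))))) := by
  rw [dotForm, sum_quadrant_in_out s εx εy, N.regionAt_of_pair (N.corner_in v s εx εy),
    N.regionAt_of_pair (N.corner_out v s εx εy), N.regionAt_of_pair (N.corner_in_opp v s εx εy),
    N.regionAt_of_pair (N.corner_out_opp v s εx εy)]

/-- A function that is constant on the corners and at infinity factors through the regions. -/
def liftRegion {β : Type} (N : Net V E) (F : E → Side → β)
    (h : ∀ v q, F (N.corner v q).1.1 (N.corner v q).1.2 = F (N.corner v q).2.1 (N.corner v q).2.2)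
    (h' : ∀ s, F N.first s = F N.last s) : N.Region → β :=
  Quot.lift (fun x => F x.1 x.2) (by
    rintro a b (⟨v, q, hq⟩ | ⟨s, rfl, rfl⟩)
    · have := h v q
      rwa [hq] at this
    · exact h' s)

theorem liftRegion_region {β : Type} (N : Net V E) (F : E → Side → β) (h h') (e : E) (s : Side) :
    N.liftRegion F h h' (N.region e s) = F e s := rfl

theorem corner_map (N : Net V E) (f : V' → V) (g : E → E') (v : V') (q : Quadrant) :
    (N.map f g).corner v q =
      ((g (N.corner (f v) q).1.1, (N.corner (f v) q).1.2),
        g (N.corner (f v) q).2.1, (N.corner (f v) q).2.2) := by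
  cases q <;> rfl

theorem corner_restrict (N : Net (Option V) E) (v : V) (q : Quadrant) :
    N.restrict.corner v q = N.corner (some v) q := by
  cases q <;> rfl

/-- Renaming the vertices and the edges does not change the regions. -/
def regionEquiv (N : Net V E) (f : V' ≃ V) (g : E ≃ E') : (N.map f g).Region ≃ N.Region where
  toFun := liftRegion _ (fun e s => N.region (g.symm e) s)
    (fun v q => by simpa [corner_map] using N.regionAt_eq (f v) q)
    (fun s => by simpa [map] using N.region_first s)
  invFun := N.liftRegion (fun e s => (N.map f g).region (g e) s)
    (fun v q => by simpa [corner_map] using (N.map f g).regionAt_eq (f.symm v) q)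
    (fun s => (N.map f g).region_first s)
  left_inv := by
    rintro ⟨e, s⟩
    change (N.map f g).region (g (g.symm e)) s = _
    rw [g.apply_symm_apply]
    rfl
  right_inv := by
    rintro ⟨e, s⟩
    change N.region (g.symm (g e)) s = _
    rw [g.symm_apply_apply]
    rfl

theorem alexander_map [Fintype V] [Fintype V'] [Finite E] [Finite E'] [CommRing K]
    (N : Net V E) (f : V' ≃ V) (g : E ≃ E') (z : K) (b : V → K) :
    (N.map f g).alexander z (fun v => b (f v)) = N.alexander z b := by
  rw [alexander, ← stateSum_map (N.regionEquiv f g)]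
  have h1 : ∀ v q, N.regionEquiv f g ((N.map f g).regionAt v q) = N.regionAt (f v) q := by
    intro v q
    rw [regionAt, corner_map]
    change N.region (g.symm (g _)) _ = _
    rw [g.symm_apply_apply]
    rfl
  have h2 : ∀ s, N.regionEquiv f g ((N.map f g).region (N.map f g).first s) =
      N.region N.first s := by
    intro s
    change N.region (g.symm (g _)) _ = _
    rw [g.symm_apply_apply]
  simp only [h1, h2]
  rw [stateSum, alexander, stateSum]
  congr 1
  exact Fintype.prod_equiv f _ _ fun v => rfl

end Net

end

/-! ### The Alexander sum and kinks. -/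

section

open MvPolynomial

namespace Net

variable {V V' E E' K : Type}

/-- A function on the sides of the pieces that is compatible with the regions descends to the
regions of the net in which the pieces are put together. -/
theorem exists_lift_of_subdivision {β : Type} {N : Net V E'} {col : E' → E} {sec : E → E'}
    {C : List (E' × E' × E')} (hs : Subdivision col sec C)
    (hN : ∀ t ∈ C, N.Avoids t.2.1 ∧ N.first ≠ t.2.1 ∧ N.last ≠ t.2.1) (F : E' → Side → β)
    (hF : ∀ v q, F (N.corner v q).1.1 (N.corner v q).1.2 = F (N.corner v q).2.1 (N.corner v q).2.2)
    (hF' : ∀ s, F N.first s = F N.last s) (hC : ∀ t ∈ C, ∀ s, F t.1 s = F t.2.2 s) :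
    ∃ G : (N.map id col).Region → β, ∀ e s, (∀ t ∈ C, e ≠ t.2.1) →
      G ((N.map id col).region (col e) s) = F e s := by
  have key : ∀ e s, (∀ t ∈ C, e ≠ t.2.1) → F (sec (col e)) s = F e s := fun e s =>
    hs.sec_col β (fun e => F e s) (fun t ht => hC t ht s) e
  refine ⟨(N.map id col).liftRegion (fun e s => F (sec e) s) ?_ ?_, fun e s he => key e s he⟩
  · intro v q
    rw [corner_map]
    dsimp only [id]
    have h1 : ∀ t ∈ C, (N.corner v q).1.1 ≠ t.2.1 ∧ (N.corner v q).2.1 ≠ t.2.1 := by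
      intro t ht
      have h := (hN t ht).1 v
      cases q <;> simp [corner, h]
    rw [key _ _ fun t ht => (h1 t ht).1, key _ _ fun t ht => (h1 t ht).2]
    exact hF v q
  · intro s
    change F (sec (col N.first)) s = F (sec (col N.last)) s
    rw [key _ _ fun t ht => (hN t ht).2.1, key _ _ fun t ht => (hN t ht).2.2]
    exact hF' s

/-! ### Kinks -/

/-- The inside of the loop is a quadrant of no vertex but the kink, where its weight is `1`. So
every state has its dot at the kink there, and what remains is a state of the diagram without the
kink. -/
theorem Kink.alexander_eq [Fintype V] [Finite E] [Finite E'] [CommRing K]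
    {N : Net (Option V) E'} {s : Strand} {e₀ e₁ e₂ : E'} (h : N.Kink none s e₀ e₁ e₂)
    {col : E' → E} {sec : E → E'} (hs : Subdivision col sec [(e₀, e₁, e₂)])
    (hcard : Nat.card N.Region = Nat.card (N.restrict.map id col).Region + 1)
    (z : K) (b : Option V → K) :
    N.alexander z b = (N.restrict.map id col).alexander z (fun v => b (some v)) := by
  have hr := N.region_corner none s true true
  simp only [rin, rout, if_true, h.inn, h.out, h.inn_opp, h.out_opp] at hr
  set p := s.sign == true with hp
  obtain ⟨h1, h2, -, h4⟩ := hr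
  have hav : ∀ v t, N.inn (some v) t ≠ e₁ ∧ N.out (some v) t ≠ e₁ :=
    fun v t => h.avoids (some v) (by simp) t
  have hloop : ∀ σ, N.region e₀ σ = N.region e₂ σ := by
    intro σ
    rcases σ.eq_ofBool p with rfl | rfl
    · exact h1
    · exact h4.trans h2
  obtain ⟨G, hG⟩ := exists_lift_of_subdivision hs (N := N.restrict)
    (by simpa using ⟨hav, h.first_ne, h.last_ne⟩) N.region
    (fun v q => by rw [corner_restrict]; exact N.regionAt_eq (some v) q)
    N.region_first (by simpa using hloop)
  simp only [List.mem_singleton, forall_eq] at hG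
  -- The point `none` stands for the inside of the loop, the only region not present without the
  -- kink. Surjectivity of this map is direct, and the count `hcard` gives injectivity.
  let χ : Option (N.restrict.map id col).Region → N.Region :=
    fun x => x.elim (N.region e₁ (.ofBool !p)) G
  have hχ : Function.Bijective χ := by
    refine Function.Surjective.bijective_of_nat_card_le ?_ (by rw [Finite.card_option, hcard])
    rintro ⟨e, σ⟩
    by_cases he : e = e₁
    · subst he
      rcases σ.eq_ofBool p with rfl | rfl
      · exact ⟨some _, (hG e₀ (.ofBool !p) h.ne₀).trans h4⟩
      · exact ⟨none, rfl⟩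
    · exact ⟨some _, hG e σ he⟩
  rw [alexander, alexander]
  set e := Equiv.ofBijective χ hχ with he
  have hsome : ∀ v q, N.regionAt (some v) q =
      e (some ((N.restrict.map id col).regionAt v q)) := by
    intro v q
    rw [regionAt, regionAt, corner_map, corner_restrict]
    refine (hG _ _ ?_).symm
    cases q <;> simp [corner, hav]
  have hst : ∀ s, N.region N.first s =
      e (some ((N.restrict.map id col).region (N.restrict.map id col).first s)) :=
    fun s => (hG _ _ h.first_ne).symm
  have hreg : N.regionAt = fun v q => e (e.symm (N.regionAt v q)) := by simp
  rw [hreg, funext hst, stateSum_map e, stateSum_option]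
  simp only [hsome, e.symm_apply_apply, ← rename_prod_dotForm]
  rw [N.dotForm_regionAt e.symm none s true true]
  simp only [rin, rout, if_true, h.inn, h.out]
  rw [← hp]
  have e1 : N.region e₀ (.ofBool p) = e (some ((N.restrict.map id col).region (col e₀)
    (.ofBool p))) := (hG _ _ h.ne₀).symm
  have e2 : N.region e₁ (.ofBool p) = e (some ((N.restrict.map id col).region (col e₂)
    (.ofBool !p))) := h2.trans (hG _ _ h.ne₂).symm
  have e3 : N.region e₁ (.ofBool !p) = e none := rfl
  have e4 : N.region e₀ (.ofBool !p) = e (some ((N.restrict.map id col).region (col e₀)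
    (.ofBool !p))) := (hG _ _ h.ne₀).symm
  -- The loop fills the left or the right quadrant, never the top or the bottom one.
  have hw : dotCoeff z (b none) (quadrantIn s true true).opp = 1 := by
    cases s <;> simp [quadrantIn, Strand.sign, Quadrant.opp, dotCoeff]
  rw [e1, e2, e3, e4, hw]
  simp only [e.symm_apply_apply]
  rw [stateSum]
  conv_rhs => rw [← coeff_X_none_mul]
  rw [← sub_eq_zero, ← coeff_sub]
  -- The difference consists of the terms with the dot in one of the three other quadrants. They do
  -- not involve the variable `none`, whose exponent has to be one.
  refine Eq.trans ?_ (coeff_eq_zero_of_supported (f := none)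
    (N := nonstar fun s => some ((N.restrict.map id col).region (N.restrict.map id col).first s))
    (by rw [nonstar_eq_one (by simp)]; simp)
    (p := (C (dotCoeff z (b none) (quadrantIn s true true)) *
        X (some ((N.restrict.map id col).region (col e₀) (.ofBool p))) +
      C (dotCoeff z (b none) (quadrantOut s true true)) *
        X (some ((N.restrict.map id col).region (col e₂) (.ofBool !p))) +
      C (dotCoeff z (b none) (quadrantOut s true true).opp) *
        X (some ((N.restrict.map id col).region (col e₀) (.ofBool !p)))) *
      rename some (∏ v, dotForm z (b (some v)) ((N.restrict.map id col).regionAt v))) ?_)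
  · congr 1
    rw [C_1]
    ring
  · refine mul_mem (add_mem (add_mem ?_ ?_) ?_) ?_
    · exact C_mul_X_mem_supported _ (by simp)
    · exact C_mul_X_mem_supported _ (by simp)
    · exact C_mul_X_mem_supported _ (by simp)
    · rw [rename_prod_dotForm]
      exact prod_dotForm_mem_supported _ _ _ (by simp)

end Net

end

/-! ### The Alexander sum near a bigon. -/

section

open MvPolynomial

theorem beq_true_eq (a : Bool) : (a == true) = a := by cases a <;> rfl

theorem not_beq_eq (a b : Bool) : ((!a) == b) = !(a == b) := by cases a <;> cases b <;> rfl

namespace Net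

variable {V V' E E' K : Type}

/-! ### Bigons -/

section Bigon

variable {N : Net V E} {c c' : V} {s : Strand} {ε : Bool} {a₀ a₁ a₂ b₀ b₁ b₂ : E}

/-- The regions around a bigon: its interior, and the ones on the two sides and at the two ends. -/
theorem Bigon.region (h : N.Bigon c c' s ε a₀ a₁ a₂ b₀ b₁ b₂) :
    N.region b₁ (.ofBool !s.sign) = N.region a₁ (.ofBool (s.sign == ε)) ∧
    (N.region b₁ (.ofBool s.sign) = N.region a₀ (.ofBool (s.sign == ε)) ∧
      N.region a₂ (.ofBool (s.sign == ε)) = N.region a₀ (.ofBool (s.sign == ε))) ∧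
    (N.region a₁ (.ofBool !(s.sign == ε)) = N.region b₀ (.ofBool !s.sign) ∧
      N.region b₂ (.ofBool !s.sign) = N.region b₀ (.ofBool !s.sign)) ∧
    N.region b₀ (.ofBool s.sign) = N.region a₀ (.ofBool !(s.sign == ε)) ∧
    N.region b₂ (.ofBool s.sign) = N.region a₂ (.ofBool !(s.sign == ε)) := by
  have h1 := N.region_corner c s true ε
  have h2 := N.region_corner c' s.opp true ε
  simp only [h.a_in, h.a_out, h.a_in', h.a_out', h.b_in, h.b_out, h.b_in', h.b_out',
    Strand.opp_opp, Strand.sign_opp, beq_true_eq, not_beq_eq, Bool.not_not] at h1 h2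
  generalize (s.sign == ε) = p at *
  generalize s.sign = q at *
  grind

/-- The inner sides of `a₁` and `b₁` are adjacent, at corners and at infinity, only to each other.
Hence membership in this pair of sides is a function on regions, and it separates the interior from
everything else. -/
theorem Bigon.region_ne (h : N.Bigon c c' s ε a₀ a₁ a₂ b₀ b₁ b₂) {e : E} {σ : Side}
    (ha : e = a₁ → σ ≠ .ofBool (s.sign == ε)) (hb : e = b₁ → σ ≠ .ofBool !s.sign) :
    N.region e σ ≠ N.region a₁ (.ofBool (s.sign == ε)) := by
  intro heq
  obtain ⟨ha0, ha1, ha2, ha3⟩ := h.ne_a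
  obtain ⟨hb0, hb1, hb2, hb3⟩ := h.ne_b
  have hne := h.ne
  let F : E → Side → Prop := fun e σ =>
    (e = a₁ ∧ σ = .ofBool (s.sign == ε)) ∨ (e = b₁ ∧ σ = .ofBool !s.sign)
  have hF : ∀ v q, F (N.corner v q).1.1 (N.corner v q).1.2 =
      F (N.corner v q).2.1 (N.corner v q).2.2 := by
    intro v
    by_cases hc : v = c
    · subst hc
      refine (N.forall_corner v s true ε fun x => F x.1 x.2).2 ?_
      simp only [h.a_in, h.a_out, h.b_in, h.b_out, F, Side.ofBool_inj, beq_true_eq]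
      generalize (s.sign == ε) = p
      generalize s.sign = q
      refine ⟨?_, ?_, ?_, ?_⟩ <;> simp <;> grind
    by_cases hc' : v = c'
    · subst hc'
      refine (N.forall_corner v s.opp true ε fun x => F x.1 x.2).2 ?_
      simp only [Strand.opp_opp, h.a_in', h.a_out', h.b_in', h.b_out', F, Side.ofBool_inj,
        Strand.sign_opp, beq_true_eq, not_beq_eq, Bool.not_not]
      generalize (s.sign == ε) = p
      generalize s.sign = q
      refine ⟨?_, ?_, ?_, ?_⟩ <;> simp <;> grind
    · intro q
      have := h.avoids v hc hc'
      cases q <;> simp [corner, F, this]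
  have h1 := congrArg (N.liftRegion F hF (by simp [F, h.first_ne, h.last_ne])) heq
  simp only [liftRegion_region, F] at h1
  grind

end Bigon

section Bigon

variable {N : Net (Option (Option V)) E} {s : Strand} {ε : Bool} {a₀ a₁ a₂ b₀ b₁ b₂ : E}
variable [Fintype V] [Finite E] [CommRing K]

/-- The state sum of a net with a bigon, after summing over the states near the bigon. -/
theorem Bigon.alexander (h : N.Bigon none (some none) s ε a₀ a₁ a₂ b₀ b₁ b₂) (z : K)
    (b : Option (Option V) → K) : N.alexander z b =
    coeff (nonstar fun σ => N.region N.first σ) (X (N.region a₁ (.ofBool (s.sign == ε))) *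
      ((C (b none + b (some none) - z) * (X (N.region a₀ (.ofBool (s.sign == ε))) +
          X (N.region b₀ (.ofBool !s.sign))) +
        C (if ε then (b none - z) * (b (some none) - z) else 1) *
          X (N.region a₀ (.ofBool !(s.sign == ε))) +
        C (if ε then b none * b (some none) else 1) *
          X (N.region a₂ (.ofBool !(s.sign == ε)))) *
      ∏ v, dotForm z (b (some (some v))) (N.regionAt (some (some v))))) := by
  obtain ⟨ha0, ha1, ha2, ha3⟩ := h.ne_a
  obtain ⟨hb0, hb1, hb2, hb3⟩ := h.ne_b
  have hne := h.ne
  obtain ⟨-, ⟨-, r2⟩, ⟨r3, -⟩, -, -⟩ := h.region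
  have hT1 : N.region a₀ (.ofBool (s.sign == ε)) ≠ N.region a₁ (.ofBool (s.sign == ε)) :=
    h.region_ne (by tauto) (by tauto)
  have hT2 : N.region b₀ (.ofBool !s.sign) ≠ N.region a₁ (.ofBool (s.sign == ε)) :=
    h.region_ne (by tauto) (by tauto)
  have hT3 : N.region a₀ (.ofBool !(s.sign == ε)) ≠ N.region a₁ (.ofBool (s.sign == ε)) :=
    h.region_ne (by tauto) (by tauto)
  have hT4 : N.region a₂ (.ofBool !(s.sign == ε)) ≠ N.region a₁ (.ofBool (s.sign == ε)) :=
    h.region_ne (by tauto) (by tauto)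
  have hT5 : ∀ σ, N.region N.first σ ≠ N.region a₁ (.ofBool (s.sign == ε)) := fun σ =>
    h.region_ne (fun h' => absurd h' h.first_ne.1) (fun h' => absurd h' h.first_ne.2)
  have hT6 : ∀ v q, N.regionAt (some (some v)) q ≠ N.region a₁ (.ofBool (s.sign == ε)) := by
    intro v q
    have := h.avoids (some (some v)) (by simp) (by simp)
    refine h.region_ne (fun h' => absurd h' ?_) (fun h' => absurd h' ?_) <;>
      cases q <;> simp [corner, this]
  have d1 : dotForm z (b none) (N.regionAt none) = _ := N.dotForm_regionAt id none s true ε z _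
  have d2 : dotForm z (b (some none)) (N.regionAt (some none)) = _ :=
    N.dotForm_regionAt id (some none) s.opp true ε z _
  rw [Net.alexander, stateSum, Fintype.prod_option, Fintype.prod_option, d1, d2]
  simp only [h.a_in, h.a_out, h.a_in', h.a_out', Strand.sign_opp, not_beq_eq, Bool.not_not, id, r2, r3]
  set T := N.region a₁ (.ofBool (s.sign == ε))
  set L := N.region a₀ (.ofBool (s.sign == ε))
  set R := N.region b₀ (.ofBool !s.sign)
  set B := N.region a₀ (.ofBool !(s.sign == ε))
  set P := N.region a₂ (.ofBool !(s.sign == ε))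
  -- The interior `T` lies in one quadrant at each vertex of the bigon and in none at the other
  -- vertices. The forms `l₁` and `l₂` collect the three remaining quadrants.
  have key := coeff_two (N := nonstar fun σ => N.region N.first σ) (f := T)
    (nonstar_eq_one hT5)
    (l₁ := C (dotCoeff z (b none) (quadrantIn s true ε)) * X L +
      C (dotCoeff z (b none) (quadrantIn s true ε).opp) * X R +
      C (dotCoeff z (b none) (quadrantOut s true ε).opp) * X B)
    (l₂ := C (dotCoeff z (b (some none)) (quadrantIn s.opp true ε)) * X R +
      C (dotCoeff z (b (some none)) (quadrantOut s.opp true ε)) * X P +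
      C (dotCoeff z (b (some none)) (quadrantIn s.opp true ε).opp) * X L)
    (dotCoeff z (b none) (quadrantOut s true ε))
    (dotCoeff z (b (some none)) (quadrantOut s.opp true ε).opp)
    (add_mem (add_mem (C_mul_X_mem_supported _ hT1) (C_mul_X_mem_supported _ hT2))
      (C_mul_X_mem_supported _ hT3))
    (add_mem (add_mem (C_mul_X_mem_supported _ hT2) (C_mul_X_mem_supported _ hT4))
      (C_mul_X_mem_supported _ hT1))
    (prod_dotForm_mem_supported z (fun v => b (some (some v)))
      (fun v => N.regionAt (some (some v))) hT6)
  refine Eq.trans (congrArg _ ?_) (key.trans (congrArg _ ?_))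
  · ring
  · congr 2
    cases s <;> cases ε <;> simp [quadrantIn, quadrantOut, Quadrant.opp, dotCoeff,
      Strand.sign, Strand.opp] <;> ring

/-- The vertices of a bigon may be exchanged. -/
theorem Bigon.alexander_swap (h : N.Bigon none (some none) s ε a₀ a₁ a₂ b₀ b₁ b₂) (z : K)
    (b b' : Option (Option V) → K) (hc : b' none = b (some none)) (hc' : b' (some none) = b none)
    (hb : ∀ v, b' (some (some v)) = b (some (some v))) :
    N.alexander z b = N.alexander z b' := by
  rw [h.alexander, h.alexander]
  simp only [hc, hc', hb, add_comm (b (some none)) (b none), mul_comm (b (some none)),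
    mul_comm (b (some none) - z)]

end Bigon

end Net

end

/-! ### The second Reidemeister move for the Alexander sum. -/

section

open MvPolynomial

theorem glue_nil {α : Type} (r : α → α → Prop) : glue r [] = r := by
  funext a b
  simp [glue]

namespace Net

variable {V V' E E' K : Type}

/-- The state sum is invariant under the second Reidemeister move. -/
theorem Bigon.alexander_eq [Fintype V] [Finite E] [Finite E'] [CommRing K]
    {N : Net (Option (Option V)) E'} {s : Strand} {ε : Bool} {a₀ a₁ a₂ b₀ b₁ b₂ : E'}
    (h : N.Bigon none (some none) s ε a₀ a₁ a₂ b₀ b₁ b₂) {col : E' → E} {sec : E → E'}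
    (hs : Subdivision col sec [(a₀, a₁, a₂), (b₀, b₁, b₂)])
    (hN : Nat.card N.Region = Fintype.card V + 4)
    (hM : Nat.card (N.restrict.restrict.map id col).Region = Fintype.card V + 2)
    (z : K) (b : Option (Option V) → K) (hb : b (some none) = z - b none)
    (hb' : b none * b none = z * b none - 1) :
    N.alexander z b =
      (N.restrict.restrict.map id col).alexander z (fun v => b (some (some v))) := by
  obtain ⟨ha0, ha1, ha2, ha3⟩ := h.ne_a
  obtain ⟨hb0, hb1, hb2, hb3⟩ := h.ne_b
  have hav : ∀ v t, (N.inn (some (some v)) t ≠ a₁ ∧ N.out (some (some v)) t ≠ a₁) ∧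
      N.inn (some (some v)) t ≠ b₁ ∧ N.out (some (some v)) t ≠ b₁ :=
    fun v t => h.avoids (some (some v)) (by simp) (by simp) t
  obtain ⟨r1, ⟨r2, r3⟩, ⟨r4, r5⟩, r6, r7⟩ := h.region
  have hT : ∀ e σ, e ≠ a₁ → e ≠ b₁ → N.region e σ ≠ N.region a₁ (.ofBool (s.sign == ε)) :=
    fun e σ h1 h2 => h.region_ne (fun h' => absurd h' h1) (fun h' => absurd h' h2)
  have halex := h.alexander z b
  set p := s.sign == ε
  set q := s.sign
  set M := N.restrict.restrict.map id col with hMdef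
  -- The regions at the two ends of the bigon are joined when the bigon is removed. They are
  -- identified before the two diagrams are compared.
  let π : N.Region → Quot (glue N.sameRegion [((a₀, .ofBool !p), (a₂, .ofBool !p))]) :=
    Quot.map id fun _ _ h => Or.inl h
  have hπ : π (N.region a₀ (.ofBool !p)) = π (N.region a₂ (.ofBool !p)) :=
    Quot.sound (Or.inr (by simp))
  have hside : ∀ σ, π (N.region a₀ σ) = π (N.region a₂ σ) ∧
      π (N.region b₀ σ) = π (N.region b₂ σ) := by
    intro σ
    constructor
    · rcases σ.eq_ofBool p with rfl | rfl
      · rw [r3]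
      · exact hπ
    · rcases σ.eq_ofBool q with rfl | rfl
      · rw [r6, r7, hπ]
      · rw [r5]
  obtain ⟨G, hG⟩ := exists_lift_of_subdivision hs (N := N.restrict.restrict)
    (by
      simp only [List.mem_cons, List.not_mem_nil, or_false, forall_eq_or_imp, forall_eq]
      exact ⟨⟨fun v t => (hav v t).1, h.first_ne.1, h.last_ne.1⟩, fun v t => (hav v t).2,
        h.first_ne.2, h.last_ne.2⟩) (fun e σ => π (N.region e σ))
    (fun v q => by
      rw [corner_restrict, corner_restrict]
      exact congrArg π (N.regionAt_eq _ q))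
    (fun σ => congrArg π (N.region_first σ))
    (by simpa using ⟨fun σ => (hside σ).1, fun σ => (hside σ).2⟩)
  have hG' : ∀ e σ, e ≠ a₁ → e ≠ b₁ → G (M.region (col e) σ) = π (N.region e σ) := by
    intro e σ h1 h2
    exact hG e σ (by simpa using ⟨h1, h2⟩)
  let G' : Quot (glue M.sameRegion [((col a₀, .ofBool !p), (col b₀, .ofBool q))]) →
      Quot (glue N.sameRegion [((a₀, .ofBool !p), (a₂, .ofBool !p))]) :=
    Quot.lift (fun x => G (M.region x.1 x.2)) (by
      rintro x y (hxy | hxy)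
      · exact congrArg G (Quot.sound hxy)
      · obtain ⟨rfl, rfl⟩ : x = (col a₀, .ofBool !p) ∧ y = (col b₀, .ofBool q) := by
          simpa using hxy
        dsimp only
        rw [hG' _ _ ha0 hb0, hG' _ _ ha2 hb2, r6])
  -- Apart from the interior of the bigon, for which `none` stands, every class comes from a region
  -- of the diagram without the bigon.
  let χ : Option (Quot (glue M.sameRegion [((col a₀, .ofBool !p), (col b₀, .ofBool q))])) →
      Quot (glue N.sameRegion [((a₀, .ofBool !p), (a₂, .ofBool !p))]) :=
    fun x => x.elim (π (N.region a₁ (.ofBool p))) G'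
  have hχ : Function.Surjective χ := by
    have h1 : ∀ e σ, e ≠ a₁ → e ≠ b₁ → ∃ x, χ x = π (N.region e σ) :=
      fun e σ h1 h2 => ⟨some (Quot.mk _ (col e, σ)), hG' e σ h1 h2⟩
    rintro ⟨e, σ⟩
    change ∃ x, χ x = π (N.region e σ)
    by_cases he : e = a₁
    · subst he
      rcases σ.eq_ofBool p with rfl | rfl
      · exact ⟨none, rfl⟩
      · rw [r4]
        exact h1 _ _ ha2 hb2
    by_cases he' : e = b₁
    · subst he'
      rcases σ.eq_ofBool q with rfl | rfl
      · rw [r2]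
        exact h1 _ _ ha0 hb0
      · rw [r1]
        exact ⟨none, rfl⟩
    exact h1 e σ he he'
  -- With `n = Fintype.card V`, the source of `χ` has at most `n + 3` points. The target has `n + 4`
  -- or `n + 3`, according to whether the two end regions coincide or not. So they are distinct, and
  -- `χ` and the projection `m` are bijective.
  have hle := Nat.card_le_card_of_surjective χ hχ
  rw [Finite.card_option] at hle
  have hcM : Nat.card (Quot (glue M.sameRegion [])) = Fintype.card V + 2 := by
    rw [glue_nil]
    exact hM
  have hcN : Nat.card (Quot (glue N.sameRegion [])) = Fintype.card V + 4 := by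
    rw [glue_nil]
    exact hN
  have hY : Nat.card (Quot (glue M.sameRegion [((col a₀, .ofBool !p), (col b₀, .ofBool q))])) ≤
      Fintype.card V + 2 := by
    rw [← hcM]
    exact Nat.card_le_card_of_surjective (Quot.map id fun _ _ h => Or.inl (by simpa [glue] using h))
      (by rintro ⟨x⟩; exact ⟨Quot.mk _ x, rfl⟩)
  have hne : N.region a₀ (.ofBool !p) ≠ N.region a₂ (.ofBool !p) := by
    intro heq
    have := card_glue_cons_of_eq N.sameRegion (a₀, .ofBool !p) (a₂, .ofBool !p) []
      (by rw [glue_nil]; exact heq)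
    omega
  have hZ := card_glue_cons N.sameRegion (a₀, .ofBool !p) (a₂, .ofBool !p) []
    (by rw [glue_nil]; exact hne)
  have hχ' : Function.Bijective χ :=
    hχ.bijective_of_nat_card_le (by rw [Finite.card_option]; omega)
  let m : M.Region → Quot (glue M.sameRegion [((col a₀, .ofBool !p), (col b₀, .ofBool q))]) :=
    Quot.map id fun _ _ h => Or.inl h
  have hm : Function.Bijective m := by
    refine Function.Surjective.bijective_of_nat_card_le ?_ (by omega)
    rintro ⟨x⟩
    exact ⟨Quot.mk _ x, rfl⟩
  let e := (Equiv.optionCongr (Equiv.ofBijective m hm)).trans (Equiv.ofBijective χ hχ')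
  have he : ∀ x σ, x ≠ a₁ → x ≠ b₁ → e (some (M.region (col x) σ)) = π (N.region x σ) :=
    fun x σ h1 h2 => hG' x σ h1 h2
  have hen : e none = π (N.region a₁ (.ofBool p)) := rfl
  have he' : ∀ x σ, x ≠ a₁ → x ≠ b₁ → e.symm (π (N.region x σ)) = some (M.region (col x) σ) := by
    intro x σ h1 h2
    rw [← he x σ h1 h2, e.symm_apply_apply]
  have hreg : ∀ v q, e.symm (π (N.regionAt (some (some v)) q)) = some (M.regionAt v q) := by
    intro v q
    have h1 := hav v
    have h2 := he' (N.corner (some (some v)) q).1.1 (N.corner (some (some v)) q).1.2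
      (by cases q <;> simp [corner, h1]) (by cases q <;> simp [corner, h1])
    rw [regionAt, h2, regionAt, corner_map, corner_restrict, corner_restrict]
    rfl
  rw [halex]
  refine Eq.trans ?_ (coeff_rename_split (τ := fun x => e.symm (π x)) (n := Fintype.card V)
    (t := N.region a₁ (.ofBool p)) (f := N.region a₀ (.ofBool !p))
    (g := N.region a₂ (.ofBool !p)) ?_ (fun σ => N.region N.first σ)
    (fun σ => M.region M.first σ) (fun σ => he' _ _ h.first_ne.1 h.first_ne.2) ?_ hne ?_ ?_ ?_ hN
    (isHomogeneous_prod_dotForm z (fun v => b (some (some v)))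
      fun v => N.regionAt (some (some v))) ?_ _ ?_)
  · congr 3
    -- For inverse crossings the coefficient of the regions beside the bigon vanishes and those of
    -- the end regions are `1`, so that the factor becomes a sum of two variables, as in
    -- `coeff_rename_split`.
    have h1 : (b none - z) * (b (some none) - z) = 1 := by
      rw [hb]; linear_combination -hb'
    have h2 : b none * b (some none) = 1 := by
      rw [hb]; linear_combination -hb'
    have h3 : b none + b (some none) - z = 0 := by rw [hb]; ring
    rw [h1, h2, h3]
    simp
  · intro x
    obtain ⟨⟨y⟩, hy⟩ := Quot.exists_rep (e x)
    exact ⟨N.region _ _, by rw [← e.symm_apply_apply x, ← hy]; rfl⟩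
  · rw [← hen, e.symm_apply_apply]
  · exact congrArg e.symm hπ
  · rw [he' _ _ ha0 hb0]
    simp
  · rintro ⟨x⟩ ⟨y⟩ hxy
    have := mk_glue_cons_eq N.sameRegion _ _ [] x y (e.symm.injective hxy)
    rw [glue_nil] at this
    exact this
  · refine prod_dotForm_mem_supported _ _ _ fun v q => ?_
    have h1 := hav v
    exact hT _ _ (by cases q <;> simp [corner, h1]) (by cases q <;> simp [corner, h1])
  · rw [rename_prod_dotForm, rename_prod_dotForm]
    simp only [hreg]

end Net

end

/-! ### The local identity and the regions of a triangle. -/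

section

open MvPolynomial

/-- The local identity behind the third Reidemeister move: the parts of the products at the
vertices of a triangle that are linear in the inner region agree up to squares. -/
theorem triangle_weights {R : Type} [CommRing R] (s₁ s₂ s₃ : Strand) (z b₁ b₂ b₃ : R)
    (hb : b₂ = if s₂ = s₃ then z - b₃ else b₃) (hb' : b₃ * b₃ = z * b₃ - 1)
    (qx qy qz pxy pyz pzx : R)
    {α₁ α₂ α₃ β₁ β₂ β₃ γ₁ γ₂ γ₃ δ₁ δ₂ δ₃ : R}
    (hα₁ : α₁ = dotCoeff z b₁ (quadrantIn s₁ s₂.sign s₃.sign))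
    (hα₂ : α₂ = dotCoeff z b₂ (quadrantIn s₂ s₃.sign s₁.sign))
    (hα₃ : α₃ = dotCoeff z b₃ (quadrantIn s₃ s₁.sign s₂.sign))
    (hβ₁ : β₁ = dotCoeff z b₁ (quadrantOut s₁ s₂.sign s₃.sign))
    (hβ₂ : β₂ = dotCoeff z b₂ (quadrantOut s₂ s₃.sign s₁.sign))
    (hβ₃ : β₃ = dotCoeff z b₃ (quadrantOut s₃ s₁.sign s₂.sign))
    (hγ₁ : γ₁ = dotCoeff z b₁ (quadrantIn s₁ s₂.sign s₃.sign).opp)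
    (hγ₂ : γ₂ = dotCoeff z b₂ (quadrantIn s₂ s₃.sign s₁.sign).opp)
    (hγ₃ : γ₃ = dotCoeff z b₃ (quadrantIn s₃ s₁.sign s₂.sign).opp)
    (hδ₁ : δ₁ = dotCoeff z b₁ (quadrantOut s₁ s₂.sign s₃.sign).opp)
    (hδ₂ : δ₂ = dotCoeff z b₂ (quadrantOut s₂ s₃.sign s₁.sign).opp)
    (hδ₃ : δ₃ = dotCoeff z b₃ (quadrantOut s₃ s₁.sign s₂.sign).opp) :
    α₁ * (β₂ * qz + γ₂ * pyz + δ₂ * qy) * (β₃ * qx + γ₃ * pzx + δ₃ * qz) +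
      α₂ * (β₁ * qy + γ₁ * pxy + δ₁ * qx) * (β₃ * qx + γ₃ * pzx + δ₃ * qz) +
      α₃ * (β₁ * qy + γ₁ * pxy + δ₁ * qx) * (β₂ * qz + γ₂ * pyz + δ₂ * qy) =
    γ₁ * (δ₂ * pxy + α₂ * qx + β₂ * pzx) * (δ₃ * pyz + α₃ * qy + β₃ * pxy) +
      γ₂ * (δ₁ * pzx + α₁ * qz + β₁ * pyz) * (δ₃ * pyz + α₃ * qy + β₃ * pxy) +
      γ₃ * (δ₁ * pzx + α₁ * qz + β₁ * pyz) * (δ₂ * pxy + α₂ * qx + β₂ * pzx) +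
    (qz ^ 2 * (α₁ * β₂ * δ₃) + qx ^ 2 * (α₂ * δ₁ * β₃) + qy ^ 2 * (α₃ * β₁ * δ₂) -
      pxy ^ 2 * (γ₁ * δ₂ * β₃) - pyz ^ 2 * (γ₂ * β₁ * δ₃) - pzx ^ 2 * (γ₃ * δ₁ * β₂)) := by
  subst hα₁ hα₂ hα₃ hβ₁ hβ₂ hβ₃ hγ₁ hγ₂ hγ₃ hδ₁ hδ₂ hδ₃ hb
  -- In each of the eight sign patterns the identity is polynomial modulo `hb'`. No relation for
  -- `b₁` is used, so the vertex `xy` may be a double point.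
  cases s₁ <;> cases s₂ <;> cases s₃ <;>
    simp only [Strand.sign, quadrantIn, quadrantOut, Quadrant.opp, dotCoeff, if_true, if_false,
      Bool.false_eq_true, reduceCtorEq] <;> grind

theorem map_dotCoeff {R K : Type} [CommRing R] [CommRing K] (f : K →+* R) (z b : K)
    (q : Quadrant) : f (dotCoeff z b q) = dotCoeff (f z) (f b) q := by
  cases q <;> simp [dotCoeff]

theorem quadrantIn_not (s : Strand) (εx εy : Bool) :
    quadrantIn s (!εx) (!εy) = (quadrantIn s εx εy).opp := by
  cases s <;> cases εx <;> cases εy <;> rfl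

theorem quadrantOut_not (s : Strand) (εx εy : Bool) :
    quadrantOut s (!εx) (!εy) = (quadrantOut s εx εy).opp := by
  cases s <;> cases εx <;> cases εy <;> rfl

theorem Quadrant.opp_opp (q : Quadrant) : q.opp.opp = q := by cases q <;> rfl

/-- The inner region of a triangle lies to the left of the sides `X`, `Y`, `Z`, with their chosen
directions, if `px`, `py`, `pz` are true, and to the right otherwise. -/
structure TriangleSides (s₁ s₂ s₃ : Strand) (εx εy εz px py pz : Bool) : Prop where
  x : (s₁.sign == εy) = px
  x' : (s₃.sign == εz) = px
  y : (s₁.sign == εx) = py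
  y' : (s₂.sign == εz) = py
  z : (s₂.sign == εy) = pz
  z' : (s₃.sign == εx) = pz

theorem TriangleSides.flip {s₁ s₂ s₃ : Strand} {εx εy εz px py pz : Bool}
    (h : TriangleSides s₁ s₂ s₃ εx εy εz px py pz) :
    TriangleSides s₁ s₂ s₃ (!εx) (!εy) (!εz) (!px) (!py) (!pz) := by
  obtain ⟨rfl, h1, rfl, h2, rfl, h3⟩ := h
  have key : ∀ a b : Bool, (a == !b) = !(a == b) := by decide
  constructor <;> simp only [key, h1, h2, h3]

/-- With these directions the sides of the triangle are traversed cyclically, and both ends of a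
side agree about where the inner region lies. -/
theorem triangleSides (s₁ s₂ s₃ : Strand) : TriangleSides s₁ s₂ s₃ s₂.sign s₃.sign s₁.sign
    (s₁.sign == s₃.sign) (s₁.sign == s₂.sign) (s₂.sign == s₃.sign) := by
  constructor <;> cases s₁ <;> cases s₂ <;> cases s₃ <;> rfl

namespace Net

variable {V V' E E' K : Type}

/-! ### Triangles -/

section Triangle

variable {N : Net V E} {xy yz zx : V} {s₁ s₂ s₃ : Strand} {εx εy εz px py pz : Bool}
  {x₀ x₁ x₂ y₀ y₁ y₂ z₀ z₁ z₂ : E}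

theorem Triangle.forall_corner {β : Type}
    (h : N.Triangle xy yz zx s₁ s₂ s₃ εx εy εz x₀ x₁ x₂ y₀ y₁ y₂ z₀ z₁ z₂)
    (hp : TriangleSides s₁ s₂ s₃ εx εy εz px py pz) (F : E × Side → β) :
    ((∀ q, F (N.corner xy q).1 = F (N.corner xy q).2) ↔
      F (x₁, .ofBool px) = F (y₁, .ofBool py) ∧ F (x₂, .ofBool px) = F (y₁, .ofBool !py) ∧
      F (x₂, .ofBool !px) = F (y₀, .ofBool !py) ∧ F (x₁, .ofBool !px) = F (y₀, .ofBool py)) ∧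
    ((∀ q, F (N.corner yz q).1 = F (N.corner yz q).2) ↔
      F (y₁, .ofBool py) = F (z₁, .ofBool pz) ∧ F (y₂, .ofBool py) = F (z₁, .ofBool !pz) ∧
      F (y₂, .ofBool !py) = F (z₀, .ofBool !pz) ∧ F (y₁, .ofBool !py) = F (z₀, .ofBool pz)) ∧
    ((∀ q, F (N.corner zx q).1 = F (N.corner zx q).2) ↔
      F (z₁, .ofBool pz) = F (x₁, .ofBool px) ∧ F (z₂, .ofBool pz) = F (x₁, .ofBool !px) ∧
      F (z₂, .ofBool !pz) = F (x₀, .ofBool !px) ∧ F (z₁, .ofBool !pz) = F (x₀, .ofBool px)) := by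
  refine ⟨?_, ?_, ?_⟩
  · simpa only [h.x_in', h.x_out', h.y_in, h.y_out, hp.x, hp.y] using
      N.forall_corner xy s₁ εx εy F
  · simpa only [h.y_in', h.y_out', h.z_in, h.z_out, hp.y', hp.z] using
      N.forall_corner yz s₂ εy εz F
  · simpa only [h.z_in', h.z_out', h.x_in, h.x_out, hp.z', hp.x'] using
      N.forall_corner zx s₃ εz εx F

theorem Triangle.region
    (h : N.Triangle xy yz zx s₁ s₂ s₃ εx εy εz x₀ x₁ x₂ y₀ y₁ y₂ z₀ z₁ z₂)
    (hp : TriangleSides s₁ s₂ s₃ εx εy εz px py pz) :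
    (N.region x₁ (.ofBool px) = N.region y₁ (.ofBool py) ∧
      N.region x₂ (.ofBool px) = N.region y₁ (.ofBool !py) ∧
      N.region x₂ (.ofBool !px) = N.region y₀ (.ofBool !py) ∧
      N.region x₁ (.ofBool !px) = N.region y₀ (.ofBool py)) ∧
    (N.region y₁ (.ofBool py) = N.region z₁ (.ofBool pz) ∧
      N.region y₂ (.ofBool py) = N.region z₁ (.ofBool !pz) ∧
      N.region y₂ (.ofBool !py) = N.region z₀ (.ofBool !pz) ∧
      N.region y₁ (.ofBool !py) = N.region z₀ (.ofBool pz)) ∧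
    (N.region z₁ (.ofBool pz) = N.region x₁ (.ofBool px) ∧
      N.region z₂ (.ofBool pz) = N.region x₁ (.ofBool !px) ∧
      N.region z₂ (.ofBool !pz) = N.region x₀ (.ofBool !px) ∧
      N.region z₁ (.ofBool !pz) = N.region x₀ (.ofBool px)) := by
  obtain ⟨h1, h2, h3⟩ := h.forall_corner hp fun x => N.region x.1 x.2
  exact ⟨h1.1 fun q => N.regionAt_eq _ q, h2.1 fun q => N.regionAt_eq _ q,
    h3.1 fun q => N.regionAt_eq _ q⟩

/-- As for a bigon: the inner sides of `x₁`, `y₁`, `z₁` are adjacent only to one another, so they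
form a whole region. -/
theorem Triangle.region_ne
    (h : N.Triangle xy yz zx s₁ s₂ s₃ εx εy εz x₀ x₁ x₂ y₀ y₁ y₂ z₀ z₁ z₂)
    (he : N.TriangleEdges xy yz zx x₀ x₁ x₂ y₀ y₁ y₂ z₀ z₁ z₂)
    (hp : TriangleSides s₁ s₂ s₃ εx εy εz px py pz) {e : E} {σ : Side}
    (hx : e ≠ x₁) (hy : e ≠ y₁) (hz : e ≠ z₁) : N.region e σ ≠ N.region x₁ (.ofBool px) := by
  intro heq
  have h1 := he.ne_x
  have h2 := he.ne_y
  have h3 := he.ne_z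
  have h4 := he.ne_xy
  have h5 := he.ne_yz
  have h6 := he.ne_zx
  let F : E → Side → Prop := fun e σ => (e = x₁ ∧ σ = .ofBool px) ∨ (e = y₁ ∧ σ = .ofBool py) ∨
    (e = z₁ ∧ σ = .ofBool pz)
  obtain ⟨c1, c2, c3⟩ := h.forall_corner hp fun x => F x.1 x.2
  have hF : ∀ v q, F (N.corner v q).1.1 (N.corner v q).1.2 =
      F (N.corner v q).2.1 (N.corner v q).2.2 := by
    intro v
    by_cases hv1 : v = xy
    · subst hv1
      refine c1.2 ?_
      simp only [F, Side.ofBool_inj]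
      refine ⟨?_, ?_, ?_, ?_⟩ <;> simp <;> grind
    by_cases hv2 : v = yz
    · subst hv2
      refine c2.2 ?_
      simp only [F, Side.ofBool_inj]
      refine ⟨?_, ?_, ?_, ?_⟩ <;> simp <;> grind
    by_cases hv3 : v = zx
    · subst hv3
      refine c3.2 ?_
      simp only [F, Side.ofBool_inj]
      refine ⟨?_, ?_, ?_, ?_⟩ <;> simp <;> grind
    intro q
    have := he.avoids v hv1 hv2 hv3
    cases q <;> simp [corner, F, this]
  have h7 := congrArg (N.liftRegion F hF (by simp [F, he.first_ne, he.last_ne])) heq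
  simp only [liftRegion_region, F] at h7
  grind

end Triangle

section Triangle

variable {N N' : Net (Option (Option (Option V))) E} {s₁ s₂ s₃ : Strand}
  {εx εy εz px py pz : Bool} {x₀ x₁ x₂ y₀ y₁ y₂ z₀ z₁ z₂ : E}

/-- The regions on the two sides of the third Reidemeister move correspond to each other. -/
theorem Triangle.exists_regionEquiv [Finite E]
    (h : N.Triangle none (some none) (some (some none)) s₁ s₂ s₃ εx εy εz
      x₀ x₁ x₂ y₀ y₁ y₂ z₀ z₁ z₂)
    (he : N.TriangleEdges none (some none) (some (some none)) x₀ x₁ x₂ y₀ y₁ y₂ z₀ z₁ z₂)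
    (h' : N'.Triangle none (some none) (some (some none)) s₁ s₂ s₃ (!εx) (!εy) (!εz)
      x₂ x₁ x₀ y₂ y₁ y₀ z₂ z₁ z₀)
    (hp : TriangleSides s₁ s₂ s₃ εx εy εz px py pz)
    (hN : N'.restrict.restrict.restrict = N.restrict.restrict.restrict)
    (hcard : Nat.card N.Region = Nat.card N'.Region) :
    ∃ e : N.Region ≃ N'.Region,
      (∀ x σ, x ≠ x₁ → x ≠ y₁ → x ≠ z₁ → e (N.region x σ) = N'.region x σ) ∧
      e (N.region x₁ (.ofBool px)) = N'.region x₁ (.ofBool !px) := by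
  classical
  obtain ⟨⟨a1, a2, a3, a4⟩, ⟨a5, a6, a7, a8⟩, a9, a10, a11, a12⟩ := h'.region hp.flip
  simp only [Bool.not_not] at a2 a3 a4 a6 a7 a8 a10 a11 a12
  obtain ⟨ux, vx, uxy, vxy, uxz, vxz⟩ := he.ne_x
  obtain ⟨uyx, vyx, uy, vy, uyz, vyz⟩ := he.ne_y
  obtain ⟨uzx, vzx, uzy, vzy, uz, vz⟩ := he.ne_z
  have g4 := he.ne_xy
  have g5 := he.ne_yz
  have g6 := he.ne_zx
  have hcorner : ∀ v q, N.corner (some (some (some v))) q =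
      N'.corner (some (some (some v))) q := by
    intro v q
    rw [← corner_restrict, ← corner_restrict, ← corner_restrict, ← hN]
    rfl
  have hfirst : N.first = N'.first :=
    (congrArg Net.first hN.symm : N.restrict.restrict.restrict.first = _)
  have hlast : N.last = N'.last :=
    (congrArg Net.last hN.symm : N.restrict.restrict.restrict.last = _)
  -- Sides of outer edges are kept, and the inner region goes to the new inner region. The far side
  -- of an inner edge must go to the region of an outer edge that meets it at a corner before the
  -- move.
  obtain ⟨F, hF, f1, f2, f3, f4, f5, f6⟩ : ∃ F : E × Side → N'.Region,
      (∀ x, x.1 ≠ x₁ → x.1 ≠ y₁ → x.1 ≠ z₁ → F x = N'.region x.1 x.2) ∧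
      F (x₁, .ofBool px) = N'.region x₁ (.ofBool !px) ∧
      F (y₁, .ofBool py) = N'.region x₁ (.ofBool !px) ∧
      F (z₁, .ofBool pz) = N'.region x₁ (.ofBool !px) ∧
      F (x₁, .ofBool !px) = N'.region y₀ (.ofBool py) ∧
      F (y₁, .ofBool !py) = N'.region z₀ (.ofBool pz) ∧
      F (z₁, .ofBool !pz) = N'.region x₀ (.ofBool px) := by
    refine ⟨fun x => if x.1 = x₁ then
        if x.2 = .ofBool px then N'.region x₁ (.ofBool !px) else N'.region y₀ (.ofBool py)
      else if x.1 = y₁ then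
        if x.2 = .ofBool py then N'.region x₁ (.ofBool !px) else N'.region z₀ (.ofBool pz)
      else if x.1 = z₁ then
        if x.2 = .ofBool pz then N'.region x₁ (.ofBool !px) else N'.region x₀ (.ofBool px)
      else N'.region x.1 x.2, ?_, ?_, ?_, ?_, ?_, ?_, ?_⟩
    · intro x h1 h2 h3
      simp [h1, h2, h3]
    all_goals simp [Side.ofBool_inj, g6, g4.symm, g5.symm]
  have kx₀ := fun σ => hF (x₀, σ) ux uyx uzx
  have kx₂ := fun σ => hF (x₂, σ) vx vyx vzx
  have ky₀ := fun σ => hF (y₀, σ) uxy uy uzy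
  have ky₂ := fun σ => hF (y₂, σ) vxy vy vzy
  have kz₀ := fun σ => hF (z₀, σ) uxz uyz uz
  have kz₂ := fun σ => hF (z₂, σ) vxz vyz vz
  obtain ⟨c1, c2, c3⟩ := h.forall_corner hp F
  have hFc : ∀ v q, F (N.corner v q).1 = F (N.corner v q).2 := by
    rintro (_ | _ | _ | v)
    · refine c1.2 ⟨f1.trans f2.symm, ?_, ?_, ?_⟩
      · rw [kx₂, f5]
        exact a11.symm
      · rw [kx₂, ky₀]
        exact a12.symm.trans a6.symm
      · rw [f4, ky₀]
    · refine c2.2 ⟨f2.trans f3.symm, ?_, ?_, ?_⟩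
      · rw [ky₂, f6]
        exact a3.symm
      · rw [ky₂, kz₀]
        exact a4.symm.trans a10.symm
      · rw [f5, kz₀]
    · refine c3.2 ⟨f3.trans f1.symm, ?_, ?_, ?_⟩
      · rw [kz₂, f4]
        exact a7.symm
      · rw [kz₂, kx₀]
        exact a8.symm.trans a2.symm
      · rw [f6, kx₀]
    · intro q
      have hv := he.avoids (some (some (some v))) (by simp) (by simp) (by simp)
      rw [hF, hF]
      · rw [hcorner]
        exact N'.regionAt_eq _ q
      all_goals cases q <;> simp [corner, hv]
  let χ : N.Region → N'.Region := N.liftRegion (fun e σ => F (e, σ)) hFc fun s => by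
    rw [hF _ he.first_ne.1 he.first_ne.2.1 he.first_ne.2.2,
      hF _ he.last_ne.1 he.last_ne.2.1 he.last_ne.2.2]
    change N'.region N.first s = N'.region N.last s
    rw [hfirst, hlast]
    exact N'.region_first s
  have hχ : ∀ x σ, x ≠ x₁ → x ≠ y₁ → x ≠ z₁ → χ (N.region x σ) = N'.region x σ :=
    fun x σ h1 h2 h3 => hF (x, σ) h1 h2 h3
  have hT : χ (N.region x₁ (.ofBool px)) = N'.region x₁ (.ofBool !px) := f1
  have hsurj : Function.Surjective χ := by
    have key : ∀ x σ, x ≠ x₁ → x ≠ y₁ → x ≠ z₁ → ∃ f, χ f = N'.region x σ :=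
      fun x σ h1 h2 h3 => ⟨_, hχ x σ h1 h2 h3⟩
    rintro ⟨x, σ⟩
    change ∃ f, χ f = N'.region x σ
    by_cases hx : x = x₁
    · rw [hx]
      rcases σ.eq_ofBool px with rfl | rfl
      · rw [a4]
        exact key _ _ vxy vy vzy
      · exact ⟨_, hT⟩
    by_cases hy : x = y₁
    · rw [hy]
      rcases σ.eq_ofBool py with rfl | rfl
      · rw [a8]
        exact key _ _ vxz vyz vz
      · rw [← a1]
        exact ⟨_, hT⟩
    by_cases hz : x = z₁
    · rw [hz]
      rcases σ.eq_ofBool pz with rfl | rfl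
      · rw [a12]
        exact key _ _ vx vyx vzx
      · rw [a9]
        exact ⟨_, hT⟩
    exact key _ _ hx hy hz
  -- Every region after the move touches an outer edge or is the inner one, hence surjectivity; the
  -- equality of the numbers of regions does the rest.
  exact ⟨Equiv.ofBijective χ (hsurj.bijective_of_nat_card_le hcard.le), hχ, hT⟩

end Triangle

end Net

end

/-! ### The third Reidemeister move for the Alexander sum. -/

section

open MvPolynomial

namespace Net

variable {V E K : Type}

section Triangle

variable {N N' : Net (Option (Option (Option V))) E} {s₁ s₂ s₃ : Strand}
  {x₀ x₁ x₂ y₀ y₁ y₂ z₀ z₁ z₂ : E}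

/-- After the regions on the two sides of the move are matched, both sums are the same coefficient
of products that differ only in the three forms at the triangle. Their parts linear in the inner
variable agree up to squares. -/
theorem Triangle.alexander_eq [CommRing K] [Fintype V] [Finite E]
    (h : N.Triangle none (some none) (some (some none)) s₁ s₂ s₃ s₂.sign s₃.sign s₁.sign
      x₀ x₁ x₂ y₀ y₁ y₂ z₀ z₁ z₂)
    (he : N.TriangleEdges none (some none) (some (some none)) x₀ x₁ x₂ y₀ y₁ y₂ z₀ z₁ z₂)
    (h' : N'.Triangle none (some none) (some (some none)) s₁ s₂ s₃ (!s₂.sign) (!s₃.sign)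
      (!s₁.sign) x₂ x₁ x₀ y₂ y₁ y₀ z₂ z₁ z₀)
    (he' : N'.TriangleEdges none (some none) (some (some none)) x₂ x₁ x₀ y₂ y₁ y₀ z₂ z₁ z₀)
    (hN : N'.restrict.restrict.restrict = N.restrict.restrict.restrict)
    (hcard : Nat.card N.Region = Nat.card N'.Region) (z : K)
    (b : Option (Option (Option V)) → K)
    (hb : b (some none) = if s₂ = s₃ then z - b (some (some none)) else b (some (some none)))
    (hb' : b (some (some none)) * b (some (some none)) = z * b (some (some none)) - 1) :
    N.alexander z b = N'.alexander z b := by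
  have hp := triangleSides s₁ s₂ s₃
  obtain ⟨e, e1, e2⟩ := h.exists_regionEquiv he h' hp hN hcard
  obtain ⟨⟨n1, n2, n3, n4⟩, ⟨n5, n6, n7, n8⟩, n9, n10, n11, n12⟩ := h.region hp
  obtain ⟨⟨a1, a2, a3, a4⟩, ⟨a5, a6, a7, a8⟩, a9, a10, a11, a12⟩ := h'.region hp.flip
  have hT : ∀ x σ, x ≠ x₁ → x ≠ y₁ → x ≠ z₁ → N'.region x σ ≠ N'.region x₁ (.ofBool !_) :=
    fun x σ h1 h2 h3 => h'.region_ne he' hp.flip h1 h2 h3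
  have hav : ∀ v q, N.corner (some (some (some v))) q = N'.corner (some (some (some v))) q := by
    intro v q
    rw [← corner_restrict, ← corner_restrict, ← corner_restrict, ← hN]
    rfl
  have hfirst : N.first = N'.first :=
    (congrArg Net.first hN.symm : N.restrict.restrict.restrict.first = _)
  have hne := fun v => he.avoids (some (some (some v))) (by simp) (by simp) (by simp)
  have hrest : ∀ v q, e (N.regionAt (some (some (some v))) q) =
      N'.regionAt (some (some (some v))) q := by
    intro v q
    have h1 := hne v
    rw [regionAt, e1, hav]
    · rfl
    all_goals cases q <;> simp [corner, h1]
  have hstar : ∀ s, e (N.region N.first s) = N'.region N'.first s := by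
    intro s
    rw [e1 _ _ he.first_ne.1 he.first_ne.2.1 he.first_ne.2.2, hfirst]
  obtain ⟨ux, vx, uxy, vxy, uxz, vxz⟩ := he.ne_x
  obtain ⟨uyx, vyx, uy, vy, uyz, vyz⟩ := he.ne_y
  obtain ⟨uzx, vzx, uzy, vzy, uz, vz⟩ := he.ne_z
  set px := s₁.sign == s₃.sign with hpx
  set py := s₁.sign == s₂.sign with hpy
  set pz := s₂.sign == s₃.sign with hpz
  have kx₀ := fun σ => e1 x₀ σ ux uyx uzx
  have kx₂ := fun σ => e1 x₂ σ vx vyx vzx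
  have ky₀ := fun σ => e1 y₀ σ uxy uy uzy
  have ky₂ := fun σ => e1 y₂ σ vxy vy vzy
  have kz₀ := fun σ => e1 z₀ σ uxz uyz uz
  have kz₂ := fun σ => e1 z₂ σ vxz vyz vz
  have tx₀ := fun σ => hT x₀ σ ux uyx uzx
  have tx₂ := fun σ => hT x₂ σ vx vyx vzx
  have ty₀ := fun σ => hT y₀ σ uxy uy uzy
  have ty₂ := fun σ => hT y₂ σ vxy vy vzy
  have tz₀ := fun σ => hT z₀ σ uxz uyz uz
  have tz₂ := fun σ => hT z₂ σ vxz vyz vz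
  have l1 := N.dotForm_regionAt (e ·) none s₁ s₂.sign s₃.sign z (b none)
  have l2 := N.dotForm_regionAt (e ·) (some none) s₂ s₃.sign s₁.sign z (b (some none))
  have l3 := N.dotForm_regionAt (e ·) (some (some none)) s₃ s₁.sign s₂.sign z
    (b (some (some none)))
  have r1 := N'.dotForm_regionAt id none s₁ (!s₂.sign) (!s₃.sign) z (b none)
  have r2 := N'.dotForm_regionAt id (some none) s₂ (!s₃.sign) (!s₁.sign) z (b (some none))
  have r3 := N'.dotForm_regionAt id (some (some none)) s₃ (!s₁.sign) (!s₂.sign) z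
    (b (some (some none)))
  rw [hp.x, h.x_in', h.x_out'] at l1
  rw [hp.y', h.y_in', h.y_out'] at l2
  rw [hp.z', h.z_in', h.z_out'] at l3
  rw [hp.flip.x, h'.x_in', h'.x_out'] at r1
  rw [hp.flip.y', h'.y_in', h'.y_out'] at r2
  rw [hp.flip.z', h'.z_in', h'.z_out'] at r3
  simp only [quadrantIn_not, quadrantOut_not, Quadrant.opp_opp, Bool.not_not, id] at l1 l2 l3 r1 r2 r3 a2 a3 a4 a6 a7 a8 a10 a11 a12
  -- `T` is the inner region. Before the move `Qx`, `Qy`, `Qz` lie across the sides and `Pxy`,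
  -- `Pyz`, `Pzx` across the vertices of the triangle; after the move the roles of the two triples
  -- are exchanged.
  set T := N'.region x₁ (.ofBool !px) with hTd
  set Qx := N'.region y₀ (.ofBool py) with hQx
  set Qy := N'.region x₂ (.ofBool px) with hQy
  set Qz := N'.region x₀ (.ofBool px) with hQz
  set Pxy := N'.region x₂ (.ofBool !px) with hPxy
  set Pyz := N'.region z₀ (.ofBool !pz) with hPyz
  set Pzx := N'.region x₀ (.ofBool !px) with hPzx
  rw [e2, kx₂, kx₂, n4, ky₀, ← hQx, ← hQy, ← hPxy] at l1
  rw [← n1, e2, ky₂, ← a3, ky₂, ← a4, ← a10, ← n2, kx₂, ← hQy] at l2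
  rw [n9, e2, kz₂, ← a7, kz₂, ← a8, ← a2, ← n6, ky₂, ← a3] at l3
  rw [← a10] at r1
  rw [← a1, a6, a12, ← a2] at r2
  rw [a9, a11, a12] at r3
  rw [alexander, ← stateSum_map e]
  simp only [hrest, hstar, alexander, stateSum, Fintype.prod_option]
  rw [l1, l2, l3, r1, r2, r3]
  have hone : nonstar (fun s => N'.region N'.first s) T = 1 :=
    nonstar_eq_one fun s => hT _ _ (hfirst ▸ he.first_ne.1) (hfirst ▸ he.first_ne.2.1)
      (hfirst ▸ he.first_ne.2.2)
  have hsq := fun f => coeff_X_sq_mul (K := K)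
    (nonstar_le_one (fun s => N'.region N'.first s) f)
  have hsup : ∀ {f g k : N'.Region} (a c d : K), f ≠ T → g ≠ T → k ≠ T →
      C a * X f + C c * X g + C d * X k ∈ supported K ({T}ᶜ : Set N'.Region) :=
    fun a c d h1 h2 h3 => add_mem (add_mem (C_mul_X_mem_supported a h1)
      (C_mul_X_mem_supported c h2)) (C_mul_X_mem_supported d h3)
  have hrest' : ∏ v, dotForm z (b (some (some (some v)))) (N'.regionAt (some (some (some v)))) ∈
      supported K ({T}ᶜ : Set N'.Region) := by
    refine prod_dotForm_mem_supported _ _ _ fun v q => ?_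
    have h1 := hne v
    rw [regionAt, ← hav]
    refine hT _ _ ?_ ?_ ?_ <;> cases q <;> simp [corner, h1]
  have hw := triangle_weights s₁ s₂ s₃ (C z) (C (b none)) (C (b (some none)))
    (C (b (some (some none)))) (by rw [hb]; split_ifs <;> simp)
    (by rw [← C_mul, hb']; simp) (X Qx) (X Qy) (X Qz) (X Pxy) (X Pyz) (X Pzx)
    (map_dotCoeff C _ _ _) (map_dotCoeff C _ _ _) (map_dotCoeff C _ _ _)
    (map_dotCoeff C _ _ _) (map_dotCoeff C _ _ _) (map_dotCoeff C _ _ _)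
    (map_dotCoeff C _ _ _) (map_dotCoeff C _ _ _) (map_dotCoeff C _ _ _)
    (map_dotCoeff C _ _ _) (map_dotCoeff C _ _ _) (map_dotCoeff C _ _ _)
  have assoc : ∀ p q r t : MvPolynomial N'.Region K, p + q + r + t = p + (q + r + t) :=
    fun p q r t => by ring
  rw [assoc, assoc (C (dotCoeff z (b (some none)) _) * _),
    assoc (C (dotCoeff z (b (some (some none))) _) * _), coeff_three hone _ _ _
    (hsup _ _ _ (tx₂ _) (tx₂ _) (ty₀ _)) (hsup _ _ _ (tx₀ _) (tz₀ _) (tx₂ _))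
    (hsup _ _ _ (ty₀ _) (tx₀ _) (tx₀ _)) hrest', hw]
  rw [assoc (C (dotCoeff z (b none) _) * X T), assoc (C (dotCoeff z (b (some none)) _) * _),
    assoc (C (dotCoeff z (b (some (some none))) _) * _), coeff_three hone _ _ _
    (hsup _ _ _ (tx₀ _) (tx₀ _) (tz₀ _)) (hsup _ _ _ (tx₂ _) (ty₀ _) (tx₀ _))
    (hsup _ _ _ (tz₀ _) (tx₂ _) (tx₂ _)) hrest']
  generalize ∏ v, dotForm z (b (some (some (some v)))) (N'.regionAt (some (some (some v)))) = P
  -- The error terms of `triangle_weights` are multiples of squares and do not affect the squarefree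
  -- coefficient.
  have hlin : ∀ c₁ c₂ c₃ c₄ c₅ c₆ L : MvPolynomial N'.Region K,
      coeff (nonstar fun s => N'.region N'.first s) (X T * ((L + (X Qz ^ 2 * c₁ + X Qx ^ 2 * c₂ +
        X Qy ^ 2 * c₃ - X Pxy ^ 2 * c₄ - X Pyz ^ 2 * c₅ - X Pzx ^ 2 * c₆)) * P)) =
      coeff (nonstar fun s => N'.region N'.first s) (X T * (L * P)) := by
    intro c₁ c₂ c₃ c₄ c₅ c₆ L
    have : X T * ((L + (X Qz ^ 2 * c₁ + X Qx ^ 2 * c₂ + X Qy ^ 2 * c₃ - X Pxy ^ 2 * c₄ -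
        X Pyz ^ 2 * c₅ - X Pzx ^ 2 * c₆)) * P) = X T * (L * P) + (X Qz ^ 2 * (X T * c₁ * P) +
        X Qx ^ 2 * (X T * c₂ * P) + X Qy ^ 2 * (X T * c₃ * P) - X Pxy ^ 2 * (X T * c₄ * P) -
        X Pyz ^ 2 * (X T * c₅ * P) - X Pzx ^ 2 * (X T * c₆ * P)) := by
      ring
    rw [this]
    simp only [coeff_add, coeff_sub, hsq, add_zero, sub_zero]
  exact hlin _ _ _ _ _ _ _

end Triangle
end Net

end

/-! ### From Gauss codes to nets. -/

section

open MvPolynomial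

section StateSum

variable {K ρ V : Type} [CommRing K]

open Classical in
theorem sum_single_eq_nonstar_iff [Fintype V] [Finite ρ] (st : Side → ρ) (r : V → ρ) :
    ∑ v, Finsupp.single (r v) 1 = nonstar st ↔
      (∀ v, ¬∃ s, st s = r v) ∧ ∀ f, (¬∃ s, st s = f) → ∃! v, r v = f := by
  have h1 : ∀ f, (∑ v, Finsupp.single (r v) 1 : ρ →₀ ℕ) f =
      (Finset.univ.filter fun v => r v = f).card := by
    intro f
    rw [Finsupp.finsetSum_apply, Finset.card_filter]
    exact Finset.sum_congr rfl fun v _ => by rw [Finsupp.single_apply]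
  rw [Finsupp.ext_iff]
  simp only [h1, nonstar_apply]
  constructor
  · intro h
    refine ⟨fun v hv => ?_, fun f hf => ?_⟩
    · have := h (r v)
      rw [if_pos hv, Finset.card_eq_zero] at this
      simpa using Finset.ext_iff.1 this v
    · have := h f
      rw [if_neg hf, Finset.card_eq_one] at this
      obtain ⟨v, hv⟩ := this
      refine ⟨v, ?_, fun w hw => ?_⟩
      · simpa using Finset.ext_iff.1 hv v
      · simpa [hw] using Finset.ext_iff.1 hv w
  · rintro ⟨h, h'⟩ f
    split_ifs with hf
    · rw [Finset.card_eq_zero]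
      ext v
      simp only [Finset.mem_filter, Finset.mem_univ, true_and, Finset.notMem_empty, iff_false]
      rintro rfl
      exact h v hf
    · rw [Finset.card_eq_one]
      obtain ⟨v, hv, hv'⟩ := h' f hf
      refine ⟨v, ?_⟩
      ext w
      simp only [Finset.mem_filter, Finset.mem_univ, true_and, Finset.mem_singleton]
      exact ⟨hv' w, by rintro rfl; exact hv⟩

open Classical in
-- Expanding the product chooses a quadrant at every vertex. The resulting monomial is the
-- prescribed one exactly when each region that is not a star region is chosen once and the star
-- regions are not chosen, that is, for a Kauffman state.
theorem stateSum_eq_sum [Fintype V] [Finite ρ] (z : K) (b : V → K) (reg : V → Quadrant → ρ)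
    (st : Side → ρ) :
    stateSum z b reg st = ∑ t : V → Quadrant with (∀ v, ¬∃ s, st s = reg v (t v)) ∧
      ∀ f, (¬∃ s, st s = f) → ∃! v, reg v (t v) = f, ∏ v, dotCoeff z (b v) (t v) := by
  have h1 : ∏ v, dotForm z (b v) (reg v) = ∑ t : V → Quadrant,
      monomial (∑ v, Finsupp.single (reg v (t v)) 1) (∏ v, dotCoeff z (b v) (t v)) := by
    simp only [dotForm]
    rw [Finset.prod_univ_sum, Fintype.piFinset_univ]
    refine Finset.sum_congr rfl fun t _ => ?_
    rw [monomial_sum_prod]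
    exact Finset.prod_congr rfl fun v _ => by rw [C_mul_X_eq_monomial]
  rw [stateSum, h1, coeff_sum, Finset.sum_filter]
  refine Finset.sum_congr rfl fun t _ => ?_
  rw [coeff_monomial]
  exact if_congr (sum_single_eq_nonstar_iff st _) rfl rfl

end StateSum

namespace GaussCode

variable (D : GaussCode)

/-- The net of a Gauss code. -/
def net : Net D.Vertex D.Edge := ⟨D.inEdge, D.outEdge, 0, Fin.last _⟩

theorem joined_iff (S : D.Vertex → Smoothing) (a b : D.Edge) :
    D.Joined S a b ↔ D.net.joined S a b := by
  constructor
  · rintro (⟨v, s, h⟩ | ⟨v, h⟩ | ⟨v, h⟩)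
    · refine ⟨v, ?_⟩
      rw [h]
      cases s <;> simp [Net.pairs, net, Strand.opp]
    · exact ⟨v, by rw [h]; simp [Net.pairs, net]⟩
    · exact ⟨v, by rw [h]; simp [Net.pairs, net]⟩
  · rintro ⟨v, hv⟩
    rcases h : S v with _ | _ <;> rw [h] at hv <;> simp only [Net.pairs, net, List.mem_cons,
      Prod.mk.injEq, List.not_mem_nil, or_false] at hv
    · rcases hv with ⟨rfl, rfl⟩ | ⟨rfl, rfl⟩
      · exact .oriented v .ne h
      · exact .oriented v .nw h
    · rcases hv with ⟨rfl, rfl⟩ | ⟨rfl, rfl⟩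
      · exact .unoriented_in v h
      · exact .unoriented_out v h

theorem bracket_eq_net {d : ℕ} (hd : D.numDouble = d) :
    D.bracket hd =
      D.net.bracket (-JonesRing.A d 2 - JonesRing.A d (-2)) (D.smoothingWeight hd) := by
  have h : ∀ S, D.numComponents S = Nat.card (Quot (D.net.joined S)) := by
    intro S
    rw [numComponents, show D.Joined S = D.net.joined S from by
      funext a b; exact propext (D.joined_iff S a b)]
  simp only [bracket, Net.bracket, h]

theorem corner_net (v : D.Vertex) (q : Quadrant) : D.net.corner v q = D.corner v q := by
  cases q <;> rfl

theorem sameRegion_iff (a b : D.Edge × Side) : D.SameRegion a b ↔ D.net.sameRegion a b := by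
  constructor
  · rintro (⟨v, q⟩ | ⟨s⟩)
    · exact Or.inl ⟨v, q, D.corner_net v q⟩
    · exact Or.inr ⟨s, rfl, rfl⟩
  · rintro (⟨v, q, h⟩ | ⟨s, rfl, rfl⟩)
    · rw [corner_net] at h
      obtain ⟨rfl, rfl⟩ := Prod.ext_iff.1 h
      exact .corner v q
    · exact .unbounded s

/-- The regions of a Gauss code are those of its net. -/
def regionNet : D.Region ≃ D.net.Region := Quot.congrRight D.sameRegion_iff

theorem regionNet_regionAt (v : D.Vertex) (q : Quadrant) :
    D.regionNet (D.regionAt v q) = D.net.regionAt v q := by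
  cases q <;> rfl

theorem isStar_iff (f : D.Region) :
    D.IsStar f ↔ ∃ s, D.net.region D.net.first s = D.regionNet f := by
  refine exists_congr fun s => ⟨?_, fun h => D.regionNet.injective h.symm⟩
  rintro rfl
  rfl

/-- The weight of a dot at the top of a vertex. -/
def topWeight {d : ℕ} (hd : D.numDouble = d) (v : D.Vertex) : AlexanderRing d :=
  if hv : D.kind v.1 = .dbl then AlexanderRing.B (D.ordinal hd v hv)
  else if D.kind v.1 = .pos then AlexanderRing.A d 1 else AlexanderRing.A d (-1)

/-- For all three kinds of vertices the bottom weight is the top weight minus `A + A⁻¹`. Hence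
crossings and double points can be treated alike. -/
theorem dotWeight_eq {d : ℕ} (hd : D.numDouble = d) (v : D.Vertex) (q : Quadrant) :
    D.dotWeight hd v q =
      dotCoeff (AlexanderRing.A d 1 + AlexanderRing.A d (-1)) (D.topWeight hd v) q := by
  unfold dotWeight topWeight
  split_ifs <;> cases q <;> simp only [dotCoeff] <;> ring

theorem alexander_eq_net {d : ℕ} (hd : D.numDouble = d) :
    D.alexander hd = D.net.alexander (AlexanderRing.A d 1 + AlexanderRing.A d (-1))
      (D.topWeight hd) := by
  classical
  rw [Net.alexander, stateSum_eq_sum, alexander]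
  simp only [dotWeight_eq]
  refine Finset.sum_congr ?_ fun _ _ => rfl
  ext t
  simp only [Finset.mem_filter, Finset.mem_univ, true_and, IsKauffmanState, isStar_iff,
    regionNet_regionAt]
  refine and_congr_right fun _ => ?_
  constructor
  · intro h f hf
    simpa only [Equiv.eq_symm_apply, regionNet_regionAt] using
      h (D.regionNet.symm f) (by simpa using hf)
  · intro h f hf
    simpa only [← regionNet_regionAt, Equiv.apply_eq_iff_eq] using h _ hf

/-- Euler's formula in the form in which planarity is used: it turns surjections between regions
into bijections. -/
theorem IsPlanar.card_region {D : GaussCode} (h : D.IsPlanar) :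
    Nat.card D.net.Region = Fintype.card D.Vertex + 2 := by
  rw [← Nat.card_congr D.regionNet, h, Fintype.card_coe]

end GaussCode

end

/-! ### The order of the double points and the weights of the vertices. -/

section

/-- Filtering keeps the relative order of first occurrences, so double points can be ordered without
reference to the crossings between them. -/
theorem idxOf_filter_lt_iff {l : List ℕ} (p : ℕ → Bool) {u v : ℕ} (hu : u ∈ l.filter p)
    (hv : v ∈ l.filter p) :
    (l.filter p).idxOf u < (l.filter p).idxOf v ↔ l.idxOf u < l.idxOf v := by
  induction l with
  | nil => simp at hu
  | cons a l ih =>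
    have hpu := (List.mem_filter.1 hu).2
    have hpv := (List.mem_filter.1 hv).2
    by_cases ha : p a = true
    · rw [List.filter_cons_of_pos ha] at hu hv ⊢
      by_cases h1 : a = u
      · subst h1
        by_cases h2 : a = v
        · subst h2; simp
        · simp [List.idxOf_cons_ne _ h2]
      · by_cases h2 : a = v
        · subst h2; simp
        · rw [List.idxOf_cons_ne _ h1, List.idxOf_cons_ne _ h1, List.idxOf_cons_ne _ h2,
            List.idxOf_cons_ne _ h2, Nat.succ_lt_succ_iff, Nat.succ_lt_succ_iff]
          exact ih ((List.mem_cons.1 hu).resolve_left (Ne.symm h1))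
            ((List.mem_cons.1 hv).resolve_left (Ne.symm h2))
    · rw [List.filter_cons_of_neg ha] at hu hv ⊢
      have h1 : a ≠ u := by rintro rfl; exact ha hpu
      have h2 : a ≠ v := by rintro rfl; exact ha hpv
      rw [List.idxOf_cons_ne _ h1, List.idxOf_cons_ne _ h2, Nat.succ_lt_succ_iff]
      exact ih hu hv

theorem idxOf_map_of_injOn {α β : Type} [BEq α] [LawfulBEq α] [BEq β] [LawfulBEq β] {l : List α} {f : α → β}
    {u : α} (hf : ∀ w ∈ l, f w = f u → w = u) : (l.map f).idxOf (f u) = l.idxOf u := by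
  induction l with
  | nil => rfl
  | cons a l ih =>
    rw [List.map_cons]
    by_cases h : a = u
    · subst h; simp
    · have h' : f a ≠ f u := fun h' => h (hf a (by simp) h')
      rw [List.idxOf_cons_ne _ h, List.idxOf_cons_ne _ h',
        ih fun w hw => hf w (List.mem_cons_of_mem _ hw)]

namespace GaussCode

variable (D D' : GaussCode)

/-- The singular double points, in the order in which they are passed. -/
def dblWord : List ℕ := (D.word.map Prod.fst).filter fun v => D.kind v = .dbl

theorem doublePoints_eq : D.doublePoints = D.dblWord.toFinset := by
  ext v
  simp [doublePoints, dblWord, verts]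

/-- The right side involves nothing but `dblWord`. A move that preserves this word therefore
preserves the indeterminate attached to each double point. -/
theorem rank_eq {v : ℕ} (hv : v ∈ D.dblWord) :
    D.rank v = (D.dblWord.toFinset.filter fun u => D.dblWord.idxOf u < D.dblWord.idxOf v).card := by
  rw [rank, doublePoints_eq]
  congr 1
  refine Finset.filter_congr fun u hu => ?_
  exact (idxOf_filter_lt_iff _ (List.mem_toFinset.1 hu) hv).symm

variable {D D'}

theorem mem_dblWord (v : D.Vertex) (hv : D.kind v.1 = .dbl) : v.1 ∈ D.dblWord := by
  rw [← List.mem_toFinset, ← doublePoints_eq]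
  exact Finset.mem_filter.2 ⟨v.2, hv⟩

theorem numDouble_eq_of_map {f : ℕ → ℕ} (h : D'.dblWord = D.dblWord.map f)
    (hf : Set.InjOn f {v | v ∈ D.dblWord}) : D.numDouble = D'.numDouble := by
  rw [numDouble, numDouble, doublePoints_eq, doublePoints_eq, h, ← Finset.card_image_of_injOn
    (s := D.dblWord.toFinset) (f := f) (by simpa using hf)]
  congr 1
  ext x
  simp

theorem rank_eq_of_map {f : ℕ → ℕ} (h : D'.dblWord = D.dblWord.map f)
    (hf : Set.InjOn f {v | v ∈ D.dblWord}) {v : ℕ} (hv : v ∈ D.dblWord) :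
    D'.rank (f v) = D.rank v := by
  have hv' : f v ∈ D'.dblWord := h ▸ List.mem_map_of_mem hv
  rw [rank_eq _ hv, rank_eq _ hv', h]
  have himg : (D.dblWord.map f).toFinset = D.dblWord.toFinset.image f := by ext x; simp
  have hidx : ∀ u ∈ D.dblWord, (D.dblWord.map f).idxOf (f u) = D.dblWord.idxOf u :=
    fun u hu => idxOf_map_of_injOn fun w hw e => hf hw hu e
  rw [himg, Finset.filter_image, Finset.card_image_of_injOn]
  · congr 1
    refine Finset.filter_congr fun u hu => ?_
    rw [hidx u (List.mem_toFinset.1 hu), hidx v hv]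
  · intro a ha b hb
    simp only [Finset.coe_filter, List.mem_toFinset, Set.mem_ofPred_eq] at ha hb
    exact hf ha.1 hb.1

theorem smoothingWeight_congr {d : ℕ} (hd : D.numDouble = d) (hd' : D'.numDouble = d)
    {v : D.Vertex} {v' : D'.Vertex} (hk : D.kind v.1 = D'.kind v'.1)
    (hr : D.kind v.1 = .dbl → D.rank v.1 = D'.rank v'.1) (t : Smoothing) :
    D.smoothingWeight hd v t = D'.smoothingWeight hd' v' t := by
  by_cases hv : D.kind v.1 = .dbl
  · have : D.ordinal hd v hv = D'.ordinal hd' v' (hk ▸ hv) := Fin.ext (hr hv)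
    have hv' := hv
    rw [hk] at hv'
    simp only [smoothingWeight, hv, hv', dif_pos, this]
  · have hv' := hv
    rw [hk] at hv'
    simp only [smoothingWeight, hv', hk, dif_neg, not_false_eq_true]

theorem topWeight_congr {d : ℕ} (hd : D.numDouble = d) (hd' : D'.numDouble = d)
    {v : D.Vertex} {v' : D'.Vertex} (hk : D.kind v.1 = D'.kind v'.1)
    (hr : D.kind v.1 = .dbl → D.rank v.1 = D'.rank v'.1) :
    D.topWeight hd v = D'.topWeight hd' v' := by
  by_cases hv : D.kind v.1 = .dbl
  · have : D.ordinal hd v hv = D'.ordinal hd' v' (hk ▸ hv) := Fin.ext (hr hv)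
    rw [topWeight, topWeight, dif_pos hv, dif_pos (hk ▸ hv), this]
  · rw [topWeight, topWeight, dif_neg hv, dif_neg (hk ▸ hv), hk]

/-- The contribution of a vertex to the writhe. -/
def _root_.LongSingular.Kind.sign : Kind → ℤ
  | .pos => 1
  | .neg => -1
  | .dbl => 0

theorem writhe_eq_sum : D.writhe = ∑ v : D.Vertex, (D.kind v.1).sign :=
  Finset.sum_congr rfl fun v _ => by cases D.kind v.1 <;> rfl

theorem smoothingWeight_crossing {d : ℕ} (hd : D.numDouble = d) (v : D.Vertex)
    (hv : D.kind v.1 ≠ .dbl) (t : Smoothing) : D.smoothingWeight hd v t =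
      JonesRing.A d (if t = .oriented then (D.kind v.1).sign else -(D.kind v.1).sign) := by
  simp only [smoothingWeight, hv, dif_neg, not_false_eq_true]
  rcases h : D.kind v.1 with _ | _ | _
  · cases t <;> simp [Kind.sign]
  · cases t <;> simp [Kind.sign]
  · exact absurd h hv

theorem topWeight_crossing {d : ℕ} (hd : D.numDouble = d) (v : D.Vertex)
    (hv : D.kind v.1 ≠ .dbl) : D.topWeight hd v = AlexanderRing.A d (D.kind v.1).sign := by
  rw [topWeight, dif_neg hv]
  rcases h : D.kind v.1 with _ | _ | _
  · simp [Kind.sign]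
  · simp [Kind.sign]
  · exact absurd h hv

theorem _root_.LongSingular.JonesRing.A_mul_A (d : ℕ) (k l : ℤ) :
    JonesRing.A d k * JonesRing.A d l = JonesRing.A d (k + l) := by
  rw [JonesRing.A, JonesRing.A, JonesRing.A, AddMonoidAlgebra.single_mul_single, add_zero,
    LaurentPolynomial.T_add]

theorem _root_.LongSingular.JonesRing.A_zero (d : ℕ) : JonesRing.A d 0 = 1 := by
  rw [JonesRing.A, LaurentPolynomial.T_zero]
  rfl

theorem _root_.LongSingular.AlexanderRing.A_mul_A (d : ℕ) (k l : ℤ) :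
    AlexanderRing.A d k * AlexanderRing.A d l = AlexanderRing.A d (k + l) := by
  rw [AlexanderRing.A, AlexanderRing.A, AlexanderRing.A, ← map_mul, LaurentPolynomial.T_add]

theorem _root_.LongSingular.AlexanderRing.A_zero (d : ℕ) : AlexanderRing.A d 0 = 1 := by
  simp [AlexanderRing.A]

/-- Two Gauss codes with the same number of double points and the same invariants. -/
def SameInvariants (D D' : GaussCode) : Prop :=
  D.numDouble = D'.numDouble ∧ ∀ (d : ℕ) (hd : D.numDouble = d) (hd' : D'.numDouble = d),
    D.jones hd = D'.jones hd' ∧ D.alexander hd = D'.alexander hd'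

theorem SameInvariants.refl (D : GaussCode) : D.SameInvariants D := ⟨rfl, fun _ _ _ => ⟨rfl, rfl⟩⟩

theorem SameInvariants.symm (h : D.SameInvariants D') : D'.SameInvariants D :=
  ⟨h.1.symm, fun d hd hd' => ⟨(h.2 d hd' hd).1.symm, (h.2 d hd' hd).2.symm⟩⟩

theorem SameInvariants.trans {D'' : GaussCode} (h : D.SameInvariants D')
    (h' : D'.SameInvariants D'') : D.SameInvariants D'' :=
  ⟨h.1.trans h'.1, fun d hd hd' => ⟨(h.2 d hd (h.1 ▸ hd)).1.trans (h'.2 d (h.1 ▸ hd) hd').1,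
    (h.2 d hd (h.1 ▸ hd)).2.trans (h'.2 d (h.1 ▸ hd) hd').2⟩⟩

end GaussCode

end

/-! ### Long nets: incidence conditions satisfied by Gauss codes. -/

section

theorem Strand.opp_ne (s : Strand) : s.opp ≠ s := by cases s <;> simp [Strand.opp]

namespace Net

variable {V V' E E' : Type}

/-- Every edge of the net, except for the first (last) one, comes from exactly one (goes to
exactly one) half-edge of a vertex, and no edge closes up. -/
structure IsLong (N : Net V E) : Prop where
  inn_inj : ∀ v s v' s', N.inn v s = N.inn v' s' → v = v' ∧ s = s'
  out_inj : ∀ v s v' s', N.out v s = N.out v' s' → v = v' ∧ s = s'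
  inn_ne_out : ∀ v s, N.inn v s ≠ N.out v s
  first_ne : ∀ v s, N.first ≠ N.out v s
  last_ne : ∀ v s, N.last ≠ N.inn v s

variable {N : Net V E}

theorem IsLong.map (hN : N.IsLong) {f : V' → V} (hf : Function.Injective f) {g : E → E'}
    (hg : Function.Injective g) : (N.map f g).IsLong where
  inn_inj _ _ _ _ h := ⟨hf (hN.inn_inj _ _ _ _ (hg h)).1, (hN.inn_inj _ _ _ _ (hg h)).2⟩
  out_inj _ _ _ _ h := ⟨hf (hN.out_inj _ _ _ _ (hg h)).1, (hN.out_inj _ _ _ _ (hg h)).2⟩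
  inn_ne_out _ s := hg.ne (hN.inn_ne_out _ s)
  first_ne _ s := hg.ne (hN.first_ne _ s)
  last_ne _ s := hg.ne (hN.last_ne _ s)

variable {a b v : V} {σ τ s : Strand} {ε : Bool}

/-- An edge has one source and one target. If it is known to run from the strand `σ` at `a` to the
strand `τ` at `b`, up to reversal, no other strand at a vertex meets it. -/
theorem IsLong.ne_of_ne (hN : N.IsLong) (h : N.rout a σ ε = N.rin b τ ε)
    (ha : v = a → s ≠ σ) (hb : v = b → s ≠ τ) (ε' : Bool) :
    N.rin v s ε' ≠ N.rout a σ ε ∧ N.rout v s ε' ≠ N.rout a σ ε := by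
  have h1 : ∀ w t, (w = v → t ≠ s) → N.inn v s ≠ N.inn w t ∧ N.out v s ≠ N.out w t :=
    fun w t hw => ⟨fun h => hw (hN.inn_inj _ _ _ _ h).1.symm (hN.inn_inj _ _ _ _ h).2.symm,
      fun h => hw (hN.out_inj _ _ _ _ h).1.symm (hN.out_inj _ _ _ _ h).2.symm⟩
  have h2 := h1 a σ fun h h' => ha h.symm h'.symm
  have h3 := h1 b τ fun h h' => hb h.symm h'.symm
  have h4 : N.inn v s ≠ N.rout a σ ε ∧ N.out v s ≠ N.rout a σ ε := by
    cases ε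
    · exact ⟨h2.1, h ▸ h3.2⟩
    · exact ⟨h ▸ h3.1, h2.2⟩
  cases ε'
  · exact h4.symm
  · exact h4

theorem IsLong.rin_ne_rout (hN : N.IsLong) (v : V) (s : Strand) (ε : Bool) :
    N.rin v s ε ≠ N.rout v s ε := by
  cases ε
  · exact (hN.inn_ne_out v s).symm
  · exact hN.inn_ne_out v s

theorem IsLong.ends_ne (hN : N.IsLong) (h : N.rout a σ ε = N.rin b τ ε) :
    N.first ≠ N.rout a σ ε ∧ N.last ≠ N.rout a σ ε := by
  cases ε
  · exact ⟨h ▸ hN.first_ne _ _, hN.last_ne _ _⟩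
  · exact ⟨hN.first_ne _ _, h ▸ hN.last_ne _ _⟩

/-- In a long net the equation for the inner edge already implies all the distinctness conditions.
The same holds for bigons and triangles below. -/
theorem IsLong.kink (hN : N.IsLong) {c : V} (h : N.out c s = N.inn c s.opp) :
    N.Kink c s (N.inn c s) (N.out c s) (N.out c s.opp) where
  inn := rfl
  out := rfl
  inn_opp := h.symm
  out_opp := rfl
  ne₀ := hN.inn_ne_out c s
  ne₂ := h ▸ (hN.inn_ne_out c s.opp).symm
  avoids _ hv t := hN.ne_of_ne (ε := true) (s := t) h (absurd · hv) (absurd · hv) true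
  first_ne := hN.first_ne c s
  last_ne := h ▸ hN.last_ne c s.opp

theorem IsLong.bigon (hN : N.IsLong) {c c' : V} (hc : c ≠ c')
    (ha : N.rout c s true = N.rin c' s.opp true) (hb : N.rout c s.opp ε = N.rin c' s ε) :
    N.Bigon c c' s ε (N.rin c s true) (N.rout c s true) (N.rout c' s.opp true)
      (N.rin c s.opp ε) (N.rout c s.opp ε) (N.rout c' s ε) where
  a_in := rfl
  a_out := rfl
  a_in' := ha.symm
  a_out' := rfl
  b_in := rfl
  b_out := rfl
  b_in' := hb.symm
  b_out' := rfl
  ne := (hN.ne_of_ne hb (fun _ => s.opp_ne.symm) (absurd · hc) true).2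
  ne_a := ⟨hN.rin_ne_rout _ _ _, ha ▸ (hN.rin_ne_rout _ _ _).symm,
    (hN.ne_of_ne ha (fun _ => s.opp_ne) (absurd · hc) ε).1,
    (hN.ne_of_ne ha (absurd · hc.symm) (fun _ => s.opp_ne.symm) ε).2⟩
  ne_b := ⟨(hN.ne_of_ne hb (fun _ => s.opp_ne.symm) (absurd · hc) true).1,
    (hN.ne_of_ne hb (absurd · hc.symm) (fun _ => s.opp_ne) true).2,
    hN.rin_ne_rout _ _ _, hb ▸ (hN.rin_ne_rout _ _ _).symm⟩
  avoids _ h1 h2 t := ⟨hN.ne_of_ne (s := t) ha (absurd · h1) (absurd · h2) true,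
    hN.ne_of_ne (s := t) hb (absurd · h1) (absurd · h2) true⟩
  first_ne := ⟨(hN.ends_ne ha).1, (hN.ends_ne hb).1⟩
  last_ne := ⟨(hN.ends_ne ha).2, (hN.ends_ne hb).2⟩

theorem IsLong.triangleEdges (hN : N.IsLong) {xy yz zx : V} {s₁ s₂ s₃ : Strand}
    {εx εy εz : Bool} {x₀ x₁ x₂ y₀ y₁ y₂ z₀ z₁ z₂ : E}
    (h : N.Triangle xy yz zx s₁ s₂ s₃ εx εy εz x₀ x₁ x₂ y₀ y₁ y₂ z₀ z₁ z₂)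
    (h1 : xy ≠ yz) (h2 : yz ≠ zx) (h3 : zx ≠ xy) :
    N.TriangleEdges xy yz zx x₀ x₁ x₂ y₀ y₁ y₂ z₀ z₁ z₂ := by
  have hx := h.x_out.trans h.x_in'.symm
  have hy := h.y_out.trans h.y_in'.symm
  have hz := h.z_out.trans h.z_in'.symm
  have o := Strand.opp_ne
  have kx : ∀ v s, (v = zx → s ≠ s₃.opp) → (v = xy → s ≠ s₁) → ∀ ε,
      N.rin v s ε ≠ x₁ ∧ N.rout v s ε ≠ x₁ :=
    fun v s ha hb ε => h.x_out ▸ hN.ne_of_ne hx ha hb ε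
  have ky : ∀ v s, (v = xy → s ≠ s₁.opp) → (v = yz → s ≠ s₂) → ∀ ε,
      N.rin v s ε ≠ y₁ ∧ N.rout v s ε ≠ y₁ :=
    fun v s ha hb ε => h.y_out ▸ hN.ne_of_ne hy ha hb ε
  have kz : ∀ v s, (v = yz → s ≠ s₂.opp) → (v = zx → s ≠ s₃) → ∀ ε,
      N.rin v s ε ≠ z₁ ∧ N.rout v s ε ≠ z₁ :=
    fun v s ha hb ε => h.z_out ▸ hN.ne_of_ne hz ha hb ε
  have ex := hN.ends_ne hx
  have ey := hN.ends_ne hy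
  have ez := hN.ends_ne hz
  rw [h.x_out] at ex
  rw [h.y_out] at ey
  rw [h.z_out] at ez
  refine ⟨?_, ?_, ?_, ⟨?_, ?_, ?_, ?_, ?_, ?_⟩, ⟨?_, ?_, ?_, ?_, ?_, ?_⟩,
    ⟨?_, ?_, ?_, ?_, ?_, ?_⟩, fun v hv hv' hv'' t => ⟨?_, ?_, ?_⟩, ⟨ex.1, ey.1, ez.1⟩,
    ⟨ex.2, ey.2, ez.2⟩⟩
  · rw [← h.x_in']
    exact (ky _ _ (fun _ => (o _).symm) (absurd · h1) _).1
  · rw [← h.y_in']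
    exact (kz _ _ (fun _ => (o _).symm) (absurd · h2) _).1
  · rw [← h.z_in']
    exact (kx _ _ (fun _ => (o _).symm) (absurd · h3) _).1
  · rw [← h.x_in, ← h.x_out]
    exact hN.rin_ne_rout _ _ _
  · rw [← h.x_out', ← h.x_in']
    exact (hN.rin_ne_rout _ _ _).symm
  · rw [← h.y_in]
    exact (kx _ _ (absurd · h3.symm) (fun _ => o _) _).1
  · rw [← h.y_out']
    exact (kx _ _ (absurd · h2) (absurd · h1.symm) _).2
  · rw [← h.z_in]
    exact (kx _ _ (absurd · h2) (absurd · h1.symm) _).1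
  · rw [← h.z_out']
    exact (kx _ _ (fun _ => (o _).symm) (absurd · h3) _).2
  · rw [← h.x_in]
    exact (ky _ _ (absurd · h3) (absurd · h2.symm) _).1
  · rw [← h.x_out']
    exact (ky _ _ (fun _ => (o _).symm) (absurd · h1) _).2
  · rw [← h.y_in, ← h.y_out]
    exact hN.rin_ne_rout _ _ _
  · rw [← h.y_out', ← h.y_in']
    exact (hN.rin_ne_rout _ _ _).symm
  · rw [← h.z_in]
    exact (ky _ _ (absurd · h1.symm) (fun _ => o _) _).1
  · rw [← h.z_out']
    exact (ky _ _ (absurd · h3) (absurd · h2.symm) _).2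
  · rw [← h.x_in]
    exact (kz _ _ (absurd · h2.symm) (fun _ => o _) _).1
  · rw [← h.x_out']
    exact (kz _ _ (absurd · h1) (absurd · h3.symm) _).2
  · rw [← h.y_in]
    exact (kz _ _ (absurd · h1) (absurd · h3.symm) _).1
  · rw [← h.y_out']
    exact (kz _ _ (fun _ => (o _).symm) (absurd · h2) _).2
  · rw [← h.z_in, ← h.z_out]
    exact hN.rin_ne_rout _ _ _
  · rw [← h.z_out', ← h.z_in']
    exact (hN.rin_ne_rout _ _ _).symm
  · exact kx v t (absurd · hv'') (absurd · hv) true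
  · exact ky v t (absurd · hv) (absurd · hv') true
  · exact kz v t (absurd · hv') (absurd · hv'') true

end Net

namespace GaussCode

variable (D : GaussCode)

theorem pos_inj {v v' : D.Vertex} {s s' : Strand} (h : D.pos v s = D.pos v' s') :
    v = v' ∧ s = s' := by
  have := (List.idxOf_inj (D.mem_word v s)).1 (Fin.ext_iff.1 h)
  exact ⟨Subtype.ext (congrArg Prod.fst this), congrArg Prod.snd this⟩

theorem isLong_net : D.net.IsLong where
  inn_inj _ _ _ _ h := D.pos_inj (Fin.castSucc_injective _ h)
  out_inj _ _ _ _ h := D.pos_inj (Fin.succ_injective _ h)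
  inn_ne_out v s := (Fin.castSucc_lt_succ (i := D.pos v s)).ne
  first_ne v s := (Fin.succ_ne_zero (D.pos v s)).symm
  last_ne v s := (Fin.castSucc_lt_last (D.pos v s)).ne'

theorem mem_verts {v : ℕ} : v ∈ D.verts ↔ ∃ s, (v, s) ∈ D.word := by
  simp [verts]

variable {D}

theorem pos_eq_of_word {A B : List (ℕ × Strand)} {v : D.Vertex} {s : Strand}
    (h : D.word = A ++ (v.1, s) :: B) : (D.pos v s : ℕ) = A.length := by
  have hn := D.nodup
  rw [h] at hn
  have : (v.1, s) ∉ A := fun hA => (List.nodup_append.1 hn).2.2 _ hA _ (by simp) rfl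
  simp [pos, h, List.idxOf_append_of_notMem this]

end GaussCode

/-- The subtype of a finite set with one more element. -/
def optionVertex {s t : Finset ℕ} {c : ℕ} (hc : c ∉ s) (ht : ∀ v, v ∈ t ↔ v = c ∨ v ∈ s) :
    Option {v // v ∈ s} ≃ {v // v ∈ t} where
  toFun x := x.elim ⟨c, (ht c).2 (Or.inl rfl)⟩ fun v => ⟨v.1, (ht _).2 (Or.inr v.2)⟩
  invFun v := if h : v.1 ∈ s then some ⟨v.1, h⟩ else none
  left_inv x := by rcases x with _ | v <;> simp [hc]
  right_inv v := by
    obtain ⟨v, hv⟩ := v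
    by_cases h : v ∈ s
    · simp [h]
    · simp [hc, ((ht v).1 hv).resolve_right h]

end

section

namespace GaussCode

variable {D D' : GaussCode}

/-! ### Renaming the vertices -/

/-- Injectivity need not be assumed: labels with the same image would produce a repeated letter in
the new word, since every vertex is passed on both strands. -/
theorem injOn_of_relabel {f : ℕ → ℕ} (hw : D'.word = D.word.map fun x => (f x.1, x.2)) :
    Set.InjOn f {v | v ∈ D.verts} := by
  intro u hu v hv huv
  obtain ⟨s, hs⟩ := D.mem_verts.1 hu
  have h1 := D.mem_word ⟨v, hv⟩ s
  have hn := D'.nodup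
  rw [hw] at hn
  exact congrArg Prod.fst (List.inj_on_of_nodup_map hn hs h1 (Prod.ext huv rfl))

theorem pos_relabel {f : ℕ → ℕ} (hw : D'.word = D.word.map fun x => (f x.1, x.2))
    {v : D.Vertex} {v' : D'.Vertex} (h : v'.1 = f v.1) (s : Strand) :
    (D'.pos v' s : ℕ) = D.pos v s := by
  have hi := injOn_of_relabel hw
  have h1 : D'.word.idxOf (f v.1, s) = D.word.idxOf (v.1, s) := by
    rw [hw]
    refine idxOf_map_of_injOn (u := (v.1, s))
      (f := fun x : ℕ × Strand => (f x.1, x.2)) fun w hx e => ?_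
    rw [Prod.mk.injEq] at e
    exact Prod.ext (hi (D.mem_verts.2 ⟨_, hx⟩) v.2 e.1) e.2
  simpa [pos, h] using h1

theorem exists_relabel_equiv {f : ℕ → ℕ} (hw : D'.word = D.word.map fun x => (f x.1, x.2)) :
    ∃ (e : D.Vertex ≃ D'.Vertex) (g : D'.Edge ≃ D.Edge), (∀ v, (e v).1 = f v.1) ∧
      D.net = D'.net.map e g := by
  have hi := injOn_of_relabel hw
  have hmem : ∀ v : D.Vertex, f v.1 ∈ D'.verts := by
    intro v
    have := D.mem_word v .ne
    refine D'.mem_verts.2 ⟨.ne, ?_⟩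
    rw [hw]
    exact List.mem_map_of_mem (f := fun x : ℕ × Strand => (f x.1, x.2)) this
  let e : D.Vertex ≃ D'.Vertex := Equiv.ofBijective (fun v => ⟨f v.1, hmem v⟩) (by
    constructor
    · intro u v h
      exact Subtype.ext (hi u.2 v.2 (congrArg Subtype.val h))
    · rintro ⟨v, hv⟩
      obtain ⟨s, hs⟩ := D'.mem_verts.1 hv
      rw [hw] at hs
      obtain ⟨x, hx, hxs⟩ := List.mem_map.1 hs
      exact ⟨⟨x.1, D.mem_verts.2 ⟨_, hx⟩⟩, Subtype.ext (congrArg Prod.fst hxs)⟩)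
  have hlen : D'.word.length + 1 = D.word.length + 1 := by rw [hw, List.length_map]
  have hnet : D.net = D'.net.map e (finCongr hlen) := by
    have h1 : ∀ v s, D.pos v s = (D'.pos (e v) s : ℕ) := fun v s => (pos_relabel hw rfl s).symm
    have h2 : D.net.inn = (D'.net.map e (finCongr hlen)).inn := by
      funext v s
      exact Fin.ext (h1 v s)
    have h3 : D.net.out = (D'.net.map e (finCongr hlen)).out := by
      funext v s
      exact Fin.ext (congrArg (· + 1) (h1 v s))
    have h4 : D.net.first = (D'.net.map e (finCongr hlen)).first := Fin.ext rfl
    have h5 : D.net.last = (D'.net.map e (finCongr hlen)).last :=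
      Fin.ext (by simp [net, Net.map])
    calc D.net = ⟨D.net.inn, D.net.out, D.net.first, D.net.last⟩ := rfl
      _ = _ := by rw [h2, h3, h4, h5]
  exact ⟨e, finCongr hlen, fun _ => rfl, hnet⟩

theorem sameInvariants_of_relabel {f : ℕ → ℕ}
    (hw : D'.word = D.word.map fun x => (f x.1, x.2))
    (hk : ∀ v ∈ D.verts, D'.kind (f v) = D.kind v) : D.SameInvariants D' := by
  have hi := injOn_of_relabel hw
  have hdv : ∀ v ∈ D.dblWord, v ∈ D.verts := fun v hv =>
    (Finset.mem_filter.1 (D.doublePoints_eq ▸ List.mem_toFinset.2 hv)).1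
  have hi' : Set.InjOn f {v | v ∈ D.dblWord} := hi.mono hdv
  have hdbl : D'.dblWord = D.dblWord.map f := by
    have h1 : D'.word.map Prod.fst = (D.word.map Prod.fst).map f := by
      rw [hw, List.map_map, List.map_map]
      rfl
    rw [dblWord, dblWord, h1, List.filter_map]
    congr 1
    refine List.filter_congr fun v hv => ?_
    rw [Function.comp_apply, hk v (List.mem_toFinset.2 hv)]
  have hnum := numDouble_eq_of_map hdbl hi'
  obtain ⟨e, g, he, hnet⟩ := exists_relabel_equiv hw
  have hkind : ∀ v : D.Vertex, D.kind v.1 = D'.kind (e v).1 := fun v => by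
    rw [he, hk v.1 v.2]
  have hrank : ∀ v : D.Vertex, D.kind v.1 = .dbl → D.rank v.1 = D'.rank (e v).1 :=
    fun v hv => by
    rw [he, rank_eq_of_map hdbl hi' (mem_dblWord v hv)]
  refine ⟨hnum, fun d hd hd' => ⟨?_, ?_⟩⟩
  · have hwr : D.writhe = D'.writhe := by
      rw [writhe_eq_sum, writhe_eq_sum]
      exact Fintype.sum_equiv e _ _ fun v => by rw [hkind]
    rw [jones, jones, hwr, bracket_eq_net, bracket_eq_net, hnet, ← Net.bracket_map _ e g]
    congr 2
    funext v t
    exact smoothingWeight_congr hd hd' (hkind v) (hrank v) t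
  · rw [alexander_eq_net, alexander_eq_net, hnet, ← Net.alexander_map _ e g]
    congr 1
    funext v
    exact topWeight_congr hd hd' (hkind v) (hrank v)

end GaussCode

end

/-! ### Bigons in Gauss codes and the move SII. -/

section

open GaussCode (Smoothing)

/-- The two sides of the bigon use up both passages through each of its vertices, so no letter is
left for the rest of the word. -/
theorem bigon_nodup {l₁ l₂ l₃ : List (ℕ × Strand)} {par : Bool} {s : Strand} {c c' : ℕ}
    (h : (l₁ ++ (bigon par s c c').1 ++ l₂ ++ (bigon par s c c').2 ++ l₃).Nodup) :
    c ≠ c' ∧ ∀ x ∈ l₁ ++ l₂ ++ l₃, x.1 ≠ c ∧ x.1 ≠ c' := by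
  have key : (bigon par s c c').1.Nodup ∧
      ∀ t, ((c, t) ∈ (bigon par s c c').1 ∨ (c, t) ∈ (bigon par s c c').2) ∧
      ((c', t) ∈ (bigon par s c c').1 ∨ (c', t) ∈ (bigon par s c c').2) ∧
      ((c, t) ∈ (bigon par s c c').1 → (c, t) ∉ (bigon par s c c').2) := by
    refine ⟨by grind, fun t => ⟨?_, ?_, by grind⟩⟩ <;>
      cases par <;> cases s <;> cases t <;> simp [bigon, Strand.opp]
  have hx : ∀ x ∈ l₁ ++ l₂ ++ l₃, x ∉ (bigon par s c c').1 ∧ x ∉ (bigon par s c c').2 := by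
    grind
  refine ⟨?_, fun x hx' => ⟨?_, ?_⟩⟩
  -- With equal labels the letter `(c, s.opp)` would occur on both sides of the bigon.
  · rintro rfl
    have h1 := (key.2 s.opp).2.2
    revert h1
    cases par <;> simp [bigon]
  · rintro rfl
    have := (key.2 x.2).1
    have := hx x hx'
    grind
  · rintro rfl
    have := (key.2 x.2).2.1
    have := hx x hx'
    grind

namespace GaussCode

variable {D D' : GaussCode}

theorem numDouble_eq_of_dblWord (h : D'.dblWord = D.dblWord) : D.numDouble = D'.numDouble := by
  rw [numDouble, numDouble, doublePoints_eq, doublePoints_eq, h]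

theorem rank_eq_of_dblWord (h : D'.dblWord = D.dblWord) {v : ℕ} (hv : v ∈ D.dblWord) :
    D'.rank v = D.rank v := by
  rw [rank_eq _ hv, rank_eq _ (h ▸ hv), h]

/-- The positions of the passages of a bigon. -/
theorem pos_bigon {l₁ l₂ l₃ : List (ℕ × Strand)} {par : Bool} {s : Strand} {c c' : D.Vertex}
    (h : D.word = l₁ ++ (bigon par s c.1 c'.1).1 ++ l₂ ++ (bigon par s c.1 c'.1).2 ++ l₃) :
    (D.pos c s : ℕ) = l₁.length ∧ (D.pos c' s.opp : ℕ) = l₁.length + 1 ∧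
    (D.pos c s.opp : ℕ) = l₁.length + l₂.length + (if par then 2 else 3) ∧
    (D.pos c' s : ℕ) = l₁.length + l₂.length + (if par then 3 else 2) := by
  refine ⟨?_, ?_, ?_, ?_⟩
  · exact pos_eq_of_word (h.trans (by simp [bigon]; rfl))
  · exact (pos_eq_of_word (A := l₁ ++ [(c.1, s)]) (h.trans (by simp [bigon]; rfl))).trans
      (by simp)
  · cases par
    · exact (pos_eq_of_word (A := l₁ ++ [(c.1, s), (c'.1, s.opp)] ++ l₂ ++ [(c'.1, s)])
        (h.trans (by simp [bigon]; rfl))).trans (by simp; omega)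
    · exact (pos_eq_of_word (A := l₁ ++ [(c.1, s), (c'.1, s.opp)] ++ l₂)
        (h.trans (by simp [bigon]; rfl))).trans (by simp; omega)
  · cases par
    · exact (pos_eq_of_word (A := l₁ ++ [(c.1, s), (c'.1, s.opp)] ++ l₂)
        (h.trans (by simp [bigon]; rfl))).trans (by simp; omega)
    · exact (pos_eq_of_word (A := l₁ ++ [(c.1, s), (c'.1, s.opp)] ++ l₂ ++ [(c.1, s.opp)])
        (h.trans (by simp [bigon]; rfl))).trans (by simp; omega)

theorem bigon_net {l₁ l₂ l₃ : List (ℕ × Strand)} {par : Bool} {s : Strand} {c c' : D.Vertex}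
    (h : D.word = l₁ ++ (bigon par s c.1 c'.1).1 ++ l₂ ++ (bigon par s c.1 c'.1).2 ++ l₃) :
    c ≠ c' ∧ D.net.rout c s true = D.net.rin c' s.opp true ∧
      D.net.rout c s.opp par = D.net.rin c' s par := by
  obtain ⟨h1, h2, h3, h4⟩ := pos_bigon h
  refine ⟨fun e => (bigon_nodup (h ▸ D.nodup)).1 (congrArg Subtype.val e), Fin.ext ?_,
    Fin.ext ?_⟩
  · change (D.pos c s : ℕ) + 1 = D.pos c' s.opp
    omega
  · cases par
    · change (D.pos c s.opp : ℕ) = (D.pos c' s : ℕ) + 1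
      simp at h3 h4
      omega
    · change (D.pos c s.opp : ℕ) + 1 = (D.pos c' s : ℕ)
      simp at h3 h4
      omega

end GaussCode

namespace Net

variable {V V' E K : Type} [Fintype V] [Fintype V'] [CommRing K]

theorem bracket_map_vertices [DecidableEq V] [DecidableEq V'] (N : Net V E) (f : V' ≃ V) (δ : K)
    (w : V → Smoothing → K) :
    N.bracket δ w = (N.map f id).bracket δ fun v => w (f v) :=
  (N.bracket_map f (Equiv.refl _) δ w).symm

theorem alexander_map_vertices [Finite E] (N : Net V E) (f : V' ≃ V) (z : K) (b : V → K) :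
    N.alexander z b = (N.map f id).alexander z fun v => b (f v) :=
  (N.alexander_map f (Equiv.refl _) z b).symm

end Net

/-- The subtype of a finite set with two more elements. -/
def optionVertex₂ {s t : Finset ℕ} {c c' : ℕ} (hc : c ∉ s) (hc' : c' ∉ s) (hne : c ≠ c')
    (ht : ∀ v, v ∈ t ↔ v = c ∨ v = c' ∨ v ∈ s) :
    Option (Option {v // v ∈ s}) ≃ {v // v ∈ t} :=
  (Equiv.optionCongr (optionVertex (t := insert c' s) hc' (by simp))).trans
    (optionVertex (c := c) (by simp [hc, hne]) (by simpa using ht))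

theorem bigon_mem {par : Bool} {s : Strand} {c c' : ℕ} {x : ℕ × Strand}
    (hx : x ∈ (bigon par s c c').1 ∨ x ∈ (bigon par s c c').2) : x.1 = c ∨ x.1 = c' := by
  cases par <;> simp [bigon] at hx <;> grind

namespace GaussCode

variable {D D' : GaussCode}

/-- As a word, the new diagram arises from the old one by exchanging the labels `p` and `c`. Since
the labels keep their kinds, the net is the same up to this renaming and only the weights at the two
vertices of the bigon are exchanged; both state sums are symmetric in them. -/
theorem sameInvariants_of_SII {l₁ l₂ l₃ : List (ℕ × Strand)} {par : Bool} {p c : ℕ} {s : Strand}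
    (hk : D'.kind = D.kind) (hp : D.kind p = .dbl) (hc : D.kind c ≠ .dbl)
    (hw : D.word = l₁ ++ (bigon par s p c).1 ++ l₂ ++ (bigon par s p c).2 ++ l₃)
    (hw' : D'.word = l₁ ++ (bigon par s c p).1 ++ l₂ ++ (bigon par s c p).2 ++ l₃) :
    D.SameInvariants D' := by
  obtain ⟨hne, hl⟩ := bigon_nodup (hw ▸ D.nodup)
  have hdbl : D'.dblWord = D.dblWord := by
    -- On each side of the bigon `p` is the only double point, so moving it past `c` does not change
    -- the order of double points.
    simp only [dblWord, hk, hw, hw', List.map_append, List.filter_append]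
    cases par <;> simp [bigon, hp, hc]
  have hnum := numDouble_eq_of_dblWord hdbl
  have hmap : D'.word = D.word.map fun x => (Equiv.swap p c x.1, x.2) := by
    have h1 : ∀ l : List (ℕ × Strand), (∀ x ∈ l, x.1 ≠ p ∧ x.1 ≠ c) →
        l.map (fun x => (Equiv.swap p c x.1, x.2)) = l := by
      intro l hl
      conv_rhs => rw [← List.map_id l]
      refine List.map_congr_left fun x hx => ?_
      rw [Equiv.swap_apply_of_ne_of_ne (hl x hx).1 (hl x hx).2]
      rfl
    rw [hw, hw', List.map_append, List.map_append, List.map_append, List.map_append,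
      h1 l₁ fun x hx => hl x (by simp [hx]), h1 l₂ fun x hx => hl x (by simp [hx]),
      h1 l₃ fun x hx => hl x (by simp [hx])]
    cases par <;> simp [bigon]
  obtain ⟨e, g, he, hnet⟩ := exists_relabel_equiv hmap
  have hpD : p ∈ D.verts := D.mem_verts.2 ⟨s, by simp [hw, bigon]⟩
  have hcD : c ∈ D.verts := D.mem_verts.2 ⟨s.opp, by simp [hw, bigon]⟩
  let vp : D.Vertex := ⟨p, hpD⟩
  let vc : D.Vertex := ⟨c, hcD⟩
  let o : Option (Option {v // v ∈ (D.verts.erase p).erase c}) ≃ D.Vertex :=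
    optionVertex₂ (c := p) (c' := c) (by simp) (by simp) hne (by
      intro v
      by_cases h1 : v = p
      · simp [h1, hpD]
      · by_cases h2 : v = c
        · simp [h2, hcD]
        · simp [h1, h2])
  have op : o none = vp := rfl
  have oc : o (some none) = vc := rfl
  have hlong := D.isLong_net.map o.injective Function.injective_id
  obtain ⟨-, b2, b3⟩ := bigon_net (c := vp) (c' := vc) hw
  have hbig := hlong.bigon (c := none) (c' := some none) (s := s) (ε := par) (by simp) b2 b3
  have hrank : ∀ v, v ∈ D.dblWord → D.rank v = D'.rank v :=
    fun v hv => (rank_eq_of_dblWord hdbl hv).symm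
  have ep : (e vp).1 = c := (he vp).trans (Equiv.swap_apply_left _ _)
  have ec : (e vc).1 = p := (he vc).trans (Equiv.swap_apply_right _ _)
  have ev : ∀ v, (e (o (some (some v)))).1 = (o (some (some v))).1 := by
    intro v
    obtain ⟨v, hv⟩ := v
    simp only [Finset.mem_erase] at hv
    exact (he _).trans (Equiv.swap_apply_of_ne_of_ne hv.2.1 hv.1)
  have kp : D'.kind (e (o none)).1 = D.kind (o (some none)).1 := by rw [op, ep, hk, oc]
  have kc : D'.kind (e (o (some none))).1 = D.kind (o none).1 := by rw [oc, ec, hk, op]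
  have kv : ∀ v, D'.kind (e (o (some (some v)))).1 = D.kind (o (some (some v))).1 := fun v => by
    rw [ev, hk]
  have rp : D'.kind (e (o none)).1 = .dbl → D'.rank (e (o none)).1 = D.rank (o (some none)).1 :=
    fun hv => absurd (kp.symm.trans hv) hc
  have rc : D'.rank (e (o (some none))).1 = D.rank (o none).1 := by
    rw [oc, ec, op, hrank _ (mem_dblWord vp hp)]
  have rv : ∀ v, D'.kind (e (o (some (some v)))).1 = .dbl →
      D'.rank (e (o (some (some v)))).1 = D.rank (o (some (some v))).1 := fun v hv => by
    rw [ev, hrank _ (mem_dblWord _ ((kv v).symm.trans hv))]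
  have hB : ∀ (d : ℕ) (δ : JonesRing d) (w : D'.Vertex → Smoothing → JonesRing d),
      D'.net.bracket δ w = D.net.bracket δ fun v => w (e v) := fun d δ w => by
    rw [hnet]
    exact (D'.net.bracket_map e g δ w).symm
  have hA : ∀ (d : ℕ) (z : AlexanderRing d) (b : D'.Vertex → AlexanderRing d),
      D'.net.alexander z b = D.net.alexander z fun v => b (e v) := fun d z b => by
    rw [hnet]
    exact (D'.net.alexander_map e g z b).symm
  refine ⟨hnum, fun d hd hd' => ⟨?_, ?_⟩⟩
  · have hwr : D.writhe = D'.writhe := by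
      rw [writhe_eq_sum, writhe_eq_sum, ← o.sum_comp, ← (o.trans e).sum_comp]
      simp only [Fintype.sum_option, Equiv.trans_apply, hk, ev, op, oc, ep, ec, vp, vc]
      ring
    rw [jones, jones, hwr, bracket_eq_net, bracket_eq_net, hB, D.net.bracket_map_vertices o,
      D.net.bracket_map_vertices o]
    refine congrArg _ ?_
    exact hbig.bracket_swap _ _ _ (funext fun t => smoothingWeight_congr hd' hd kp rp t)
      (funext fun t => smoothingWeight_congr hd' hd kc (fun _ => rc) t)
      fun v => funext fun t => smoothingWeight_congr hd' hd (kv v) (rv v) t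
  · rw [alexander_eq_net, alexander_eq_net, hA, D.net.alexander_map_vertices o,
      D.net.alexander_map_vertices o]
    exact hbig.alexander_swap _ _ _ (topWeight_congr hd' hd kp rp)
      (topWeight_congr hd' hd kc fun _ => rc) fun v => topWeight_congr hd' hd (kv v) (rv v)

end GaussCode

end

/-! ### Removing passages from a Gauss code, and the move RI. -/

section

open GaussCode (Smoothing)

namespace Net

variable {V E E' : Type}

theorem ext_of_eq {N M : Net V E} (h₁ : ∀ v s, N.inn v s = M.inn v s)
    (h₂ : ∀ v s, N.out v s = M.out v s) (h₃ : N.first = M.first) (h₄ : N.last = M.last) :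
    N = M := by
  cases N
  cases M
  simp only [mk.injEq]
  exact ⟨funext fun v => funext (h₁ v), funext fun v => funext (h₂ v), h₃, h₄⟩

theorem Subdivision.flip {col : E' → E} {sec : E → E'} {t : E' × E' × E'} {x y z : E'}
    (h : Subdivision col sec [t, (x, y, z)]) : Subdivision col sec [t, (z, y, x)] where
  col_sec := h.col_sec
  col_eq := by
    have h1 := h.col_eq
    simp only [List.mem_cons, List.not_mem_nil, or_false, forall_eq_or_imp, forall_eq] at h1 ⊢
    exact ⟨h1.1, h1.2.2.symm, h1.2.1.symm⟩
  sec_col β φ := by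
    have h1 := h.sec_col β φ
    simp only [List.mem_cons, List.not_mem_nil, or_false, forall_eq_or_imp, forall_eq] at h1 ⊢
    exact fun h2 => h1 ⟨h2.1, h2.2.symm⟩

end Net

/-- Deleting two adjacent letters at position `p` merges the edges `p`, `p + 1`, `p + 2` into one
and shifts the later edges by two. The truncated subtraction in the formula for `col` encodes this.
-/
theorem exists_subdivision {m m' p : ℕ} (hm : m' = m + 2) (hp : p < m) :
    ∃ (col : Fin m' → Fin m) (sec : Fin m → Fin m'),
      Net.Subdivision col sec [(⟨p, by omega⟩, ⟨p + 1, by omega⟩, ⟨p + 2, by omega⟩)] ∧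
      ∀ j, (col j : ℕ) = min (j : ℕ) p + (j - (p + 2)) := by
  refine ⟨fun j => ⟨min (j : ℕ) p + (j - (p + 2)), by omega⟩,
    fun j => ⟨if (j : ℕ) ≤ p then j else j + 2, by split_ifs <;> omega⟩, ⟨?_, ?_, ?_⟩,
    fun j => rfl⟩
  · intro j
    ext
    simp only
    split_ifs <;> omega
  · simp
  · intro β φ h e he
    simp only [List.mem_cons, List.not_mem_nil, or_false, forall_eq] at h he
    by_cases h1 : (e : ℕ) = p + 2
    · have h2 : e = ⟨p + 2, by omega⟩ := Fin.ext h1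
      rw [h2, ← h]
      congr 1
      ext
      simp
    · congr 1
      ext
      have h2 : (e : ℕ) ≠ p + 1 := fun h => he (Fin.ext h)
      simp only
      split_ifs <;> omega

/-- The same for two pairs of letters. The position `q` is measured in the shorter word, so the
second pair starts at `q + 2` in the longer one. -/
theorem exists_subdivision₂ {m m' p q : ℕ} (hm : m' = m + 4) (hpq : p ≤ q) (hq : q < m) :
    ∃ (col : Fin m' → Fin m) (sec : Fin m → Fin m'),
      Net.Subdivision col sec [(⟨p, by omega⟩, ⟨p + 1, by omega⟩, ⟨p + 2, by omega⟩),
        (⟨q + 2, by omega⟩, ⟨q + 3, by omega⟩, ⟨q + 4, by omega⟩)] ∧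
      ∀ j, (col j : ℕ) = min (j : ℕ) p + min (j - (p + 2)) (q - p) + (j - (q + 4)) := by
  refine ⟨fun j => ⟨min (j : ℕ) p + min (j - (p + 2)) (q - p) + (j - (q + 4)), by omega⟩,
    fun j => ⟨if (j : ℕ) ≤ p then j else if (j : ℕ) ≤ q then j + 2 else j + 4, by
      split_ifs <;> omega⟩, ⟨?_, ?_, ?_⟩, fun j => rfl⟩
  · intro j
    ext
    simp only
    split_ifs <;> omega
  · simp only [List.mem_cons, List.not_mem_nil, or_false, forall_eq_or_imp, forall_eq,
      Fin.mk.injEq]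
    omega
  · intro β φ h e he
    simp only [List.mem_cons, List.not_mem_nil, or_false, forall_eq_or_imp, forall_eq] at h he
    obtain ⟨h3, h4⟩ := h
    have h5 : (e : ℕ) ≠ p + 1 := fun h => he.1 (Fin.ext h)
    have h6 : (e : ℕ) ≠ q + 3 := fun h => he.2 (Fin.ext h)
    by_cases h1 : (e : ℕ) = p + 2
    · have h2 : e = ⟨p + 2, by omega⟩ := Fin.ext h1
      rw [h2, ← h3]
      congr 1
      ext
      simp only
      split_ifs <;> omega
    by_cases h1' : (e : ℕ) = q + 4
    · have h2 : e = ⟨q + 4, by omega⟩ := Fin.ext h1'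
      rw [h2, ← h4]
      -- If nothing separates the two pairs, the last piece of the first triple is the first piece
      -- of the second one, and the two identifications have to be chained.
      rcases hpq.eq_or_lt with rfl | hlt
      · rw [← h3]
        congr 1
        ext
        simp
      · congr 1
        ext
        simp only
        split_ifs <;> omega
    · congr 1
      ext
      simp only
      split_ifs <;> omega

namespace GaussCode

variable {D D' : GaussCode}

theorem card_region_map (hD : D.IsPlanar) {V : Type} [Fintype V] (f : V ≃ D.Vertex) :
    Nat.card (D.net.map f id).Region = Fintype.card V + 2 := by
  rw [Fintype.card_congr f, ← hD.card_region]
  exact Nat.card_congr (D.net.regionEquiv f (Equiv.refl _))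

/-- With the sign of `neg_one_zpow_sign`, this is the inverse of the change of the writhe factor
caused by one crossing. -/
theorem kink_weight (d : ℕ) {k : Kind} (hk : k ≠ .dbl) :
    JonesRing.A d k.sign * (-JonesRing.A d 2 - JonesRing.A d (-2)) + JonesRing.A d (-k.sign) =
      -JonesRing.A d (3 * k.sign) := by
  have h1 := JonesRing.A_mul_A d k.sign 2
  have h2 := JonesRing.A_mul_A d k.sign (-2)
  cases k
  · norm_num [Kind.sign] at h1 h2 ⊢
    linear_combination -h1 - h2
  · norm_num [Kind.sign] at h1 h2 ⊢
    linear_combination -h1 - h2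
  · exact absurd rfl hk

theorem neg_one_zpow_sign {k : Kind} (hk : k ≠ .dbl) : (-1 : ℤˣ) ^ (-3 * k.sign) = -1 := by
  cases k
  · rfl
  · rfl
  · exact absurd rfl hk

/-- The kink is the vertex `none`; merging the three edges along it recovers the net of the smaller
diagram. It then remains to match the kink factor with the writhe, and the numbers of regions with
Euler's formula. -/
theorem sameInvariants_of_RI (hD : D.IsPlanar) (hD' : D'.IsPlanar)
    {l₁ l₂ : List (ℕ × Strand)} {c : ℕ} {s : Strand}
    (hk : D'.kind = D.kind) (hc : D.kind c ≠ .dbl) (hw : D.word = l₁ ++ l₂)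
    (hw' : D'.word = l₁ ++ [(c, s), (c, s.opp)] ++ l₂) : D.SameInvariants D' := by
  have hdbl : D'.dblWord = D.dblWord := by
    simp only [dblWord, hk, hw, hw', List.map_append, List.filter_append]
    simp [hc]
  have hnum := numDouble_eq_of_dblWord hdbl
  have hcD : c ∉ D.verts := by
    intro h
    have h1 := D.mem_word ⟨c, h⟩ s
    have h2 := D'.nodup
    rw [hw] at h1
    rw [hw'] at h2
    grind
  have hverts : ∀ v, v ∈ D'.verts ↔ v = c ∨ v ∈ D.verts := by
    intro v
    simp [verts, hw, hw']
  let o : Option D.Vertex ≃ D'.Vertex := optionVertex hcD hverts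
  have hp : (D'.pos (o none) s : ℕ) = l₁.length :=
    pos_eq_of_word (B := (c, s.opp) :: l₂) (hw'.trans (by simp; rfl))
  have hp' : (D'.pos (o none) s.opp : ℕ) = l₁.length + 1 :=
    (pos_eq_of_word (A := l₁ ++ [(c, s)]) (B := l₂) (hw'.trans (by simp; rfl))).trans (by simp)
  -- The two letters of the kink shift only the passages behind them.
  have hpos : ∀ v t, (D'.pos (o (some v)) t : ℕ) =
      if (D.pos v t : ℕ) < l₁.length then (D.pos v t : ℕ) else D.pos v t + 2 := by
    intro v t
    have hne : v.1 ≠ c := fun h => hcD (h ▸ v.2)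
    have h1 : (D.pos v t : ℕ) = (l₁ ++ l₂).idxOf (v.1, t) := by rw [← hw]; rfl
    have h2 : (D'.pos (o (some v)) t : ℕ) =
        (l₁ ++ [(c, s), (c, s.opp)] ++ l₂).idxOf (v.1, t) := by rw [← hw']; rfl
    rw [h1, h2, List.idxOf_append, List.idxOf_append, List.idxOf_append]
    by_cases h : (v.1, t) ∈ l₁
    · have := List.idxOf_lt_length_of_mem h
      simp [h, this]
    · simp [h, hne]
      omega
  have hlong := D'.isLong_net.map o.injective Function.injective_id
  have hlen : D'.word.length + 1 = D.word.length + 1 + 2 := by simp [hw, hw']; omega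
  obtain ⟨col, sec, hs, hcol⟩ := exists_subdivision hlen
    (p := l₁.length) (by simp [hw])
  have hkink := hlong.kink (c := none) (s := s) (Fin.ext (by
    change (D'.pos (o none) s : ℕ) + 1 = D'.pos (o none) s.opp
    omega))
  have e0 : (D'.net.map o id).inn none s = ⟨l₁.length, by omega⟩ := Fin.ext hp
  have e1 : (D'.net.map o id).out none s = ⟨l₁.length + 1, by omega⟩ :=
    Fin.ext (congrArg (· + 1) hp)
  have e2 : (D'.net.map o id).out none s.opp = ⟨l₁.length + 2, by omega⟩ :=
    Fin.ext (congrArg (· + 1) hp')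
  rw [e0, e1, e2] at hkink
  have hnet : (D'.net.map o id).restrict.map id col = D.net := by
    refine Net.ext_of_eq (fun v t => ?_) (fun v t => ?_) ?_ ?_
    · refine Fin.ext ((hcol _).trans ?_)
      change min (D'.pos (o (some v)) t : ℕ) _ + ((D'.pos (o (some v)) t : ℕ) - _) = D.pos v t
      rw [hpos]
      split_ifs <;> omega
    · refine Fin.ext ((hcol _).trans ?_)
      change min ((D'.pos (o (some v)) t : ℕ) + 1) _ + ((D'.pos (o (some v)) t : ℕ) + 1 - _) =
        (D.pos v t : ℕ) + 1
      rw [hpos]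
      split_ifs <;> omega
    · refine Fin.ext ((hcol _).trans ?_)
      change min 0 _ + (0 - _) = 0
      omega
    · refine Fin.ext ((hcol _).trans ?_)
      change min D'.word.length _ + (D'.word.length - _) = D.word.length
      simp [hw, hw']
      omega
  have hkind : ∀ v : D.Vertex, D.kind v.1 = D'.kind (o (some v)).1 := fun v => by
    rw [hk]
    rfl
  have hrank : ∀ v : D.Vertex, D.kind v.1 = .dbl → D.rank v.1 = D'.rank (o (some v)).1 :=
    fun v hv => (rank_eq_of_dblWord hdbl (mem_dblWord v hv)).symm
  have hkc : D'.kind (o none).1 ≠ .dbl := by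
    rw [hk]
    exact hc
  refine ⟨hnum, fun d hd hd' => ⟨?_, ?_⟩⟩
  · have hwr : D'.writhe = D.writhe + (D'.kind (o none).1).sign := by
      rw [writhe_eq_sum, writhe_eq_sum, ← o.sum_comp, Fintype.sum_option, add_comm]
      simp only [hkind]
    have hbr : D'.bracket hd' = -JonesRing.A d (3 * (D'.kind (o none).1).sign) * D.bracket hd := by
      rw [bracket_eq_net, bracket_eq_net, D'.net.bracket_map_vertices o,
        Net.bracket_kink hkink hs, hnet, smoothingWeight_crossing _ _ hkc,
        smoothingWeight_crossing _ _ hkc, if_pos rfl, if_neg (by simp), kink_weight d hkc]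
      congr 2
      funext v t
      exact (smoothingWeight_congr hd hd' (hkind v) (hrank v) t).symm
    rw [jones, jones, hbr, hwr, mul_add, zpow_add, neg_one_zpow_sign hkc, ← JonesRing.A_mul_A]
    have h1 := JonesRing.A_mul_A d (-3 * (D'.kind (o none).1).sign) (3 * (D'.kind (o none).1).sign)
    rw [neg_mul, neg_add_cancel, JonesRing.A_zero, ← neg_mul] at h1
    generalize JonesRing.A d (-3 * (D'.kind (o none).1).sign) = b at h1 ⊢
    generalize JonesRing.A d (3 * (D'.kind (o none).1).sign) = a at h1 ⊢
    rw [Units.val_mul, Units.val_neg, Units.val_one, zsmul_eq_mul, zsmul_eq_mul]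
    push_cast
    linear_combination (-(((-1 : ℤˣ) ^ (-3 * D.writhe) : ℤˣ) : ℤ) *
      JonesRing.A d (-3 * D.writhe) * D.bracket hd) * h1
  · rw [alexander_eq_net, alexander_eq_net, D'.net.alexander_map_vertices o,
      hkink.alexander_eq hs, hnet]
    · congr 1
      funext v
      exact topWeight_congr hd hd' (hkind v) (hrank v)
    · rw [hnet, card_region_map hD', hD.card_region, Fintype.card_option]

end GaussCode

end

/-! ### The second Reidemeister move for Gauss codes. -/

section

open GaussCode (Smoothing)

theorem idxOf_insert_two {α : Type} [BEq α] [LawfulBEq α] {l₁ u l₂ v l₃ : List α} {x : α}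
    (hu : x ∉ u) (hv : x ∉ v) : (l₁ ++ u ++ l₂ ++ v ++ l₃).idxOf x =
      let n := (l₁ ++ l₂ ++ l₃).idxOf x
      if n < l₁.length then n else if n < l₁.length + l₂.length then n + u.length
      else n + u.length + v.length := by
  by_cases h₁ : x ∈ l₁
  · have := List.idxOf_lt_length_of_mem h₁
    simp [List.idxOf_append, h₁, this]
  by_cases h₂ : x ∈ l₂
  · have := List.idxOf_lt_length_of_mem h₂
    simp only [List.idxOf_append, List.mem_append, h₁, h₂, hu, or_true, or_self, if_true,
      if_false, List.length_append, true_or]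
    split_ifs <;> omega
  · simp only [List.idxOf_append, List.mem_append, h₁, h₂, hu, hv, or_self, if_false,
      List.length_append]
    split_ifs <;> omega

theorem length_bigon (par : Bool) (s : Strand) (c c' : ℕ) :
    (bigon par s c c').1.length = 2 ∧ (bigon par s c c').2.length = 2 := by
  cases par <;> simp [bigon]

theorem mem_map_bigon {l₁ l₂ l₃ : List (ℕ × Strand)} {par : Bool} {s : Strand} {c c' v : ℕ} :
    v ∈ (l₁ ++ (bigon par s c c').1 ++ l₂ ++ (bigon par s c c').2 ++ l₃).map Prod.fst ↔
      v = c ∨ v = c' ∨ v ∈ (l₁ ++ l₂ ++ l₃).map Prod.fst := by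
  have h₁ : v ∈ (bigon par s c c').1.map Prod.fst ↔ v = c ∨ v = c' := by simp [bigon]
  have h₂ : v ∈ (bigon par s c c').2.map Prod.fst ↔ v = c ∨ v = c' := by
    cases par <;> simp [bigon, or_comm]
  simp only [List.map_append, List.mem_append, h₁, h₂]
  tauto

theorem Kind.sign_cases {k k' : Kind} (h : (k = .pos ∧ k' = .neg) ∨ (k = .neg ∧ k' = .pos)) :
    k ≠ .dbl ∧ k' ≠ .dbl ∧ k'.sign = -k.sign ∧ (k.sign = 1 ∨ k.sign = -1) := by
  rcases h with ⟨rfl, rfl⟩ | ⟨rfl, rfl⟩ <;> simp [Kind.sign]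

namespace GaussCode

variable {D D' : GaussCode}

/-- Merging the pieces of the two strands of the bigon recovers the net of the smaller diagram. The
opposite signs of `c` and `c'` leave the writhe unchanged and give the weight relations required by
the two bigon lemmas. -/
theorem sameInvariants_of_RII (hD : D.IsPlanar) (hD' : D'.IsPlanar)
    {l₁ l₂ l₃ : List (ℕ × Strand)} {par : Bool} {c c' : ℕ} {s : Strand}
    (hk : D'.kind = D.kind)
    (hc : (D.kind c = .pos ∧ D.kind c' = .neg) ∨ (D.kind c = .neg ∧ D.kind c' = .pos))
    (hw : D.word = l₁ ++ l₂ ++ l₃)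
    (hw' : D'.word = l₁ ++ (bigon par s c c').1 ++ l₂ ++ (bigon par s c c').2 ++ l₃) :
    D.SameInvariants D' := by
  obtain ⟨hkc, hkc', hsign, hone⟩ := Kind.sign_cases hc
  obtain ⟨hne, hl⟩ := bigon_nodup (hw' ▸ D'.nodup)
  have hdbl : D'.dblWord = D.dblWord := by
    simp only [dblWord, hk, hw, hw', List.map_append, List.filter_append]
    cases par <;> simp [bigon, hkc, hkc']
  have hnum := numDouble_eq_of_dblWord hdbl
  have hcD : c ∉ D.verts := fun h => by
    obtain ⟨t, ht⟩ := D.mem_verts.1 h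
    exact (hl _ (hw ▸ ht)).1 rfl
  have hcD' : c' ∉ D.verts := fun h => by
    obtain ⟨t, ht⟩ := D.mem_verts.1 h
    exact (hl _ (hw ▸ ht)).2 rfl
  have hverts : ∀ v, v ∈ D'.verts ↔ v = c ∨ v = c' ∨ v ∈ D.verts := by
    intro v
    rw [verts, verts, List.mem_toFinset, List.mem_toFinset, hw, hw', mem_map_bigon]
  let o : Option (Option D.Vertex) ≃ D'.Vertex := optionVertex₂ hcD hcD' hne hverts
  let vc : D'.Vertex := ⟨c, (hverts c).2 (by simp)⟩
  let vc' : D'.Vertex := ⟨c', (hverts c').2 (by simp)⟩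
  have oc : o none = vc := rfl
  have oc' : o (some none) = vc' := rfl
  obtain ⟨p1, p2, p3, p4⟩ := pos_bigon (c := vc) (c' := vc') hw'
  obtain ⟨-, n1, n2⟩ := bigon_net (c := vc) (c' := vc') hw'
  rw [← oc] at p1 p3 n1 n2
  rw [← oc'] at p2 p4 n1 n2
  have hlen₂ := length_bigon par s c c'
  have hpos : ∀ v t, (D'.pos (o (some (some v))) t : ℕ) =
      if (D.pos v t : ℕ) < l₁.length then (D.pos v t : ℕ) else
        if (D.pos v t : ℕ) < l₁.length + l₂.length then D.pos v t + 2 else D.pos v t + 4 := by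
    intro v t
    have h1 : (D.pos v t : ℕ) = (l₁ ++ l₂ ++ l₃).idxOf (v.1, t) := by rw [← hw]; rfl
    have h2 : (D'.pos (o (some (some v))) t : ℕ) = (l₁ ++ (bigon par s c c').1 ++ l₂ ++
        (bigon par s c c').2 ++ l₃).idxOf (v.1, t) := by rw [← hw']; rfl
    have h3 : ¬(v.1 = c ∨ v.1 = c') := by
      rintro (h | h)
      · exact hcD (h ▸ v.2)
      · exact hcD' (h ▸ v.2)
    rw [h1, h2, idxOf_insert_two (fun h => h3 (bigon_mem (Or.inl h)))
      (fun h => h3 (bigon_mem (Or.inr h))), hlen₂.1, hlen₂.2]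
  have hlong := D'.isLong_net.map o.injective Function.injective_id
  have hlen : D'.word.length + 1 = D.word.length + 1 + 4 := by
    simp [hw, hw', hlen₂]
    omega
  have hq : l₁.length + l₂.length < D.word.length + 1 := by simp [hw]
  obtain ⟨col, sec, hs, hcol⟩ := exists_subdivision₂ hlen
    (p := l₁.length) (q := l₁.length + l₂.length) (by omega) hq
  have hbig := hlong.bigon (c := none) (c' := some none) (s := s) (ε := par) (by simp) n1 n2
  have hnet : (D'.net.map o id).restrict.restrict.map id col = D.net := by
    refine Net.ext_of_eq (fun v t => ?_) (fun v t => ?_) ?_ ?_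
    · refine Fin.ext ((hcol _).trans ?_)
      change min (D'.pos (o (some (some v))) t : ℕ) _ +
        min ((D'.pos (o (some (some v))) t : ℕ) - _) _ +
        ((D'.pos (o (some (some v))) t : ℕ) - _) = D.pos v t
      rw [hpos]
      split_ifs <;> omega
    · refine Fin.ext ((hcol _).trans ?_)
      change min ((D'.pos (o (some (some v))) t : ℕ) + 1) _ +
        min ((D'.pos (o (some (some v))) t : ℕ) + 1 - _) _ +
        ((D'.pos (o (some (some v))) t : ℕ) + 1 - _) = (D.pos v t : ℕ) + 1
      rw [hpos]
      split_ifs <;> omega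
    · refine Fin.ext ((hcol _).trans ?_)
      change min 0 _ + min (0 - _) _ + (0 - _) = 0
      omega
    · refine Fin.ext ((hcol _).trans ?_)
      change min D'.word.length _ + min (D'.word.length - _) _ + (D'.word.length - _) =
        D.word.length
      simp only [hw, hw', hlen₂, List.length_append]
      omega
  obtain ⟨a₀, a₁, a₂, b₀, b₁, b₂, hbig, hs⟩ : ∃ a₀ a₁ a₂ b₀ b₁ b₂,
      (D'.net.map o id).Bigon none (some none) s par a₀ a₁ a₂ b₀ b₁ b₂ ∧
      Net.Subdivision col sec [(a₀, a₁, a₂), (b₀, b₁, b₂)] := by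
    refine ⟨_, _, _, _, _, _, hbig, ?_⟩
    have e0 : (D'.net.map o id).rin none s true = ⟨l₁.length, by omega⟩ := Fin.ext p1
    have e1 : (D'.net.map o id).rout none s true = ⟨l₁.length + 1, by omega⟩ :=
      Fin.ext (congrArg (· + 1) p1)
    have e2 : (D'.net.map o id).rout (some none) s.opp true = ⟨l₁.length + 2, by omega⟩ :=
      Fin.ext (congrArg (· + 1) p2)
    rw [e0, e1, e2]
    -- In the antiparallel case the second strand is read against its orientation, so its three
    -- pieces appear in reverse order.
    cases par
    · have e3 : (D'.net.map o id).rin none s.opp false = ⟨l₁.length + l₂.length + 4, by omega⟩ :=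
        Fin.ext (congrArg (· + 1) p3)
      have e4 : (D'.net.map o id).rout none s.opp false = ⟨l₁.length + l₂.length + 3, by omega⟩ :=
        Fin.ext p3
      have e5 : (D'.net.map o id).rout (some none) s false =
        ⟨l₁.length + l₂.length + 2, by omega⟩ := Fin.ext p4
      rw [e3, e4, e5]
      exact hs.flip
    · have e3 : (D'.net.map o id).rin none s.opp true = ⟨l₁.length + l₂.length + 2, by omega⟩ :=
        Fin.ext p3
      have e4 : (D'.net.map o id).rout none s.opp true = ⟨l₁.length + l₂.length + 3, by omega⟩ :=
        Fin.ext (congrArg (· + 1) p3)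
      have e5 : (D'.net.map o id).rout (some none) s true =
        ⟨l₁.length + l₂.length + 4, by omega⟩ := Fin.ext (congrArg (· + 1) p4)
      rw [e3, e4, e5]
      exact hs
  have hkind : ∀ v : D.Vertex, D.kind v.1 = D'.kind (o (some (some v))).1 := fun v => by
    rw [hk]
    rfl
  have hrank : ∀ v : D.Vertex, D.kind v.1 = .dbl → D.rank v.1 = D'.rank (o (some (some v))).1 :=
    fun v hv => (rank_eq_of_dblWord hdbl (mem_dblWord v hv)).symm
  have kc : D'.kind (o none).1 = D.kind c := by
    rw [hk]
    rfl
  have kc' : D'.kind (o (some none)).1 = D.kind c' := by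
    rw [hk]
    rfl
  refine ⟨hnum, fun d hd hd' => ⟨?_, ?_⟩⟩
  · have hwr : D'.writhe = D.writhe := by
      rw [writhe_eq_sum, writhe_eq_sum, ← o.sum_comp, Fintype.sum_option, Fintype.sum_option, kc,
        kc', hsign]
      simp only [hkind]
      ring
    have w1 := D'.smoothingWeight_crossing hd' (o none) (kc ▸ hkc)
    have w2 := D'.smoothingWeight_crossing hd' (o (some none)) (kc' ▸ hkc')
    have w1o := (w1 .oriented).trans (by rw [if_pos rfl, kc])
    have w1u := (w1 .unoriented).trans (by rw [if_neg (by simp), kc])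
    have w2o := (w2 .oriented).trans (by rw [if_pos rfl, kc', hsign])
    have w2u := (w2 .unoriented).trans (by rw [if_neg (by simp), kc', hsign, neg_neg])
    have hinv : ∀ k l, k + l = 0 → JonesRing.A d k * JonesRing.A d l = 1 := fun k l h => by
      rw [JonesRing.A_mul_A, h, JonesRing.A_zero]
    -- The two mixed states together carry the weight `A^2 + A^(-2) = -δ`, for either sign of the
    -- first crossing.
    have hsum : JonesRing.A d ((D.kind c).sign + (D.kind c).sign) +
        JonesRing.A d (-(D.kind c).sign + -(D.kind c).sign) =
        -(-JonesRing.A d 2 - JonesRing.A d (-2)) := by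
      rcases hone with h | h <;> rw [h] <;> norm_num [add_comm]
    rw [jones, jones, hwr, bracket_eq_net, bracket_eq_net, D'.net.bracket_map_vertices o]
    refine congrArg _ (Eq.trans ?_ (hbig.bracket_eq hs _ _ ?_ ?_ ?_).symm)
    · rw [hnet]
      congr 1
      funext v t
      exact smoothingWeight_congr hd hd' (hkind v) (hrank v) t
    -- For antiparallel strands the smoothing along the chosen directions is the unoriented one.
    · cases par
      · exact (congrArg₂ _ w1u w2u).trans (hinv _ _ (by ring))
      · exact (congrArg₂ _ w1o w2o).trans (hinv _ _ (by ring))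
    · cases par
      · exact (congrArg₂ _ w1o w2o).trans (hinv _ _ (by ring))
      · exact (congrArg₂ _ w1u w2u).trans (hinv _ _ (by ring))
    · rw [← hsum, ← JonesRing.A_mul_A, ← JonesRing.A_mul_A]
      cases par
      · exact (congrArg₂ _ (congrArg₂ _ w1u w2o) (congrArg₂ _ w1o w2u)).trans (add_comm _ _)
      · exact congrArg₂ _ (congrArg₂ _ w1o w2u) (congrArg₂ _ w1u w2o)
  · rw [alexander_eq_net, alexander_eq_net, D'.net.alexander_map_vertices o,
      hbig.alexander_eq hs, hnet]
    · congr 1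
      funext v
      exact topWeight_congr hd hd' (hkind v) (hrank v)
    · rw [card_region_map hD']
      simp
    · rw [hnet, hD.card_region]
    · rw [D'.topWeight_crossing hd' (o none) (kc ▸ hkc),
        D'.topWeight_crossing hd' (o (some none)) (kc' ▸ hkc'), kc, kc', hsign]
      rcases hone with h | h <;> rw [h] <;> simp
    · rw [D'.topWeight_crossing hd' (o none) (kc ▸ hkc), kc, add_mul, AlexanderRing.A_mul_A,
        AlexanderRing.A_mul_A, AlexanderRing.A_mul_A]
      rcases hone with h | h <;> rw [h] <;> norm_num [AlexanderRing.A_zero]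

end GaussCode

end

/-! ### Triangles in Gauss codes. -/

section

open GaussCode (Smoothing)

theorem Net.rin_not {V E : Type} (N : Net V E) (v : V) (s : Strand) (ε : Bool) :
    N.rin v s (!ε) = N.rout v s ε := by
  cases ε <;> rfl

theorem Net.rout_not {V E : Type} (N : Net V E) (v : V) (s : Strand) (ε : Bool) :
    N.rout v s (!ε) = N.rin v s ε := by
  cases ε <;> rfl

/-- The move exchanges the two passages on each side. Hence the new net contains a triangle with the
same vertices and strands, whose sides are read in the opposite directions and whose outer edges
change places. -/
theorem Net.triangle_flip {V E : Type} (N' : Net V E) {N : Net V E} {xy yz zx : V}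
    {s₁ s₂ s₃ : Strand} {εx εy εz : Bool}
    (hx : ∀ ε, N'.rin zx s₃.opp ε = N.rin xy s₁ ε ∧ N'.rout zx s₃.opp ε = N.rout xy s₁ ε ∧
      N'.rin xy s₁ ε = N.rin zx s₃.opp ε ∧ N'.rout xy s₁ ε = N.rout zx s₃.opp ε)
    (hx' : N.rout zx s₃.opp εx = N.rin xy s₁ εx)
    (hy : ∀ ε, N'.rin xy s₁.opp ε = N.rin yz s₂ ε ∧ N'.rout xy s₁.opp ε = N.rout yz s₂ ε ∧
      N'.rin yz s₂ ε = N.rin xy s₁.opp ε ∧ N'.rout yz s₂ ε = N.rout xy s₁.opp ε)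
    (hy' : N.rout xy s₁.opp εy = N.rin yz s₂ εy)
    (hz : ∀ ε, N'.rin yz s₂.opp ε = N.rin zx s₃ ε ∧ N'.rout yz s₂.opp ε = N.rout zx s₃ ε ∧
      N'.rin zx s₃ ε = N.rin yz s₂.opp ε ∧ N'.rout zx s₃ ε = N.rout yz s₂.opp ε)
    (hz' : N.rout yz s₂.opp εz = N.rin zx s₃ εz) :
    N'.Triangle xy yz zx s₁ s₂ s₃ (!εx) (!εy) (!εz) (N.rout xy s₁ εx) (N.rout zx s₃.opp εx)
      (N.rin zx s₃.opp εx) (N.rout yz s₂ εy) (N.rout xy s₁.opp εy) (N.rin xy s₁.opp εy)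
      (N.rout zx s₃ εz) (N.rout yz s₂.opp εz) (N.rin yz s₂.opp εz) := by
  constructor <;> simp only [rin_not, rout_not, hx, hy, hz, hx', hy', hz']

/-- That `Z` is over both other strands or under both determines how the signs of its two crossings
are related: they are opposite exactly when `s₂ = s₃`. -/
theorem overKind_cases {k k' : Kind} {s₂ s₃ : Strand}
    (h : (k = overKind s₃ ∧ k' = overKind s₂.opp) ∨ (k = overKind s₃.opp ∧ k' = overKind s₂)) :
    k ≠ .dbl ∧ k' ≠ .dbl ∧ k'.sign = (if s₂ = s₃ then -k.sign else k.sign) ∧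
      (k.sign = 1 ∨ k.sign = -1) := by
  rcases h with ⟨rfl, rfl⟩ | ⟨rfl, rfl⟩ <;> cases s₂ <;> cases s₃ <;>
    simp [overKind, Strand.opp, Kind.sign]

/-- Relative to the directions of the triangle, the two crossings of `Z` carry mutually inverse
weights, just like the crossings of an RII bigon, whatever their orientations are. -/
theorem triangle_smoothingWeights {d : ℕ} {s₁ s₂ s₃ : Strand} {k k' : ℤ}
    (hk' : k' = if s₂ = s₃ then -k else k) (hk : k = 1 ∨ k = -1)
    {w w' : Smoothing → JonesRing d} (ho : w .oriented = JonesRing.A d k)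
    (hu : w .unoriented = JonesRing.A d (-k)) (ho' : w' .oriented = JonesRing.A d k')
    (hu' : w' .unoriented = JonesRing.A d (-k')) :
    w' (Net.along s₃.sign s₁.sign) * w (Net.along s₁.sign s₂.sign) = 1 ∧
    w' (Net.against s₃.sign s₁.sign) * w (Net.against s₁.sign s₂.sign) = 1 ∧
    w' (Net.along s₃.sign s₁.sign) * w (Net.against s₁.sign s₂.sign) +
      w' (Net.against s₃.sign s₁.sign) * w (Net.along s₁.sign s₂.sign) =
      -(-JonesRing.A d 2 - JonesRing.A d (-2)) := by
  have h0 := JonesRing.A_zero d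
  rcases hk with rfl | rfl <;> cases s₁ <;> cases s₂ <;> cases s₃ <;>
    simp [Net.along, Net.against, Strand.sign, ho, hu, ho', hu', hk', JonesRing.A_mul_A, h0,
      add_comm]

/-- The sides occur in any order along the knot. Isolating one of them suffices, since reversing the
others does not change the length of the prefix. -/
theorem exists_of_mem_sides {α : Type} {l₀ l₁ l₂ l₃ u₁ u₂ u₃ u : List α}
    (hu : u ∈ [u₁, u₂, u₃]) : ∃ A B A' B',
      l₀ ++ u₁ ++ l₁ ++ u₂ ++ l₂ ++ u₃ ++ l₃ = A ++ u ++ B ∧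
      l₀ ++ u₁.reverse ++ l₁ ++ u₂.reverse ++ l₂ ++ u₃.reverse ++ l₃ = A' ++ u.reverse ++ B' ∧
      A'.length = A.length := by
  simp only [List.mem_cons, List.not_mem_nil, or_false] at hu
  rcases hu with rfl | rfl | rfl
  · exact ⟨l₀, l₁ ++ u₂ ++ l₂ ++ u₃ ++ l₃, l₀, l₁ ++ u₂.reverse ++ l₂ ++ u₃.reverse ++ l₃,
      by simp, by simp, rfl⟩
  · exact ⟨l₀ ++ u₁ ++ l₁, l₂ ++ u₃ ++ l₃, l₀ ++ u₁.reverse ++ l₁, l₂ ++ u₃.reverse ++ l₃,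
      by simp, by simp, by simp⟩
  · exact ⟨l₀ ++ u₁ ++ l₁ ++ u₂ ++ l₂, l₃, l₀ ++ u₁.reverse ++ l₁ ++ u₂.reverse ++ l₂, l₃,
      by simp, by simp, by simp⟩

theorem idxOf_reverse_sides {α : Type} [BEq α] [LawfulBEq α] {l₀ l₁ l₂ l₃ u₁ u₂ u₃ : List α}
    {x : α} (hx : ∀ u ∈ [u₁, u₂, u₃], x ∉ u) :
    (l₀ ++ u₁.reverse ++ l₁ ++ u₂.reverse ++ l₂ ++ u₃.reverse ++ l₃).idxOf x =
      (l₀ ++ u₁ ++ l₁ ++ u₂ ++ l₂ ++ u₃ ++ l₃).idxOf x := by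
  simp only [List.mem_cons, List.not_mem_nil, or_false, forall_eq_or_imp, forall_eq] at hx
  simp only [List.idxOf_append, List.mem_append, List.mem_reverse, hx, List.length_append,
    List.length_reverse, or_false]
  split_ifs <;> rfl

theorem triangle_mem {xy yz zx : ℕ} {s₁ s₂ s₃ : Strand} {u : List (ℕ × Strand)}
    (hu : u ∈ triangle xy yz zx s₁ s₂ s₃) {x : ℕ × Strand} (hx : x ∈ u) :
    x.1 = xy ∨ x.1 = yz ∨ x.1 = zx := by
  cases s₁ <;> cases s₂ <;> cases s₃ <;> simp [triangle] at hu <;>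
    rcases hu with rfl | rfl | rfl <;> simp at hx <;> rcases hx with rfl | rfl <;> simp

theorem triangle_ne {xy yz zx : ℕ} {s₁ s₂ s₃ : Strand}
    (h : (triangle xy yz zx s₁ s₂ s₃).flatten.Nodup) : xy ≠ yz ∧ yz ≠ zx ∧ zx ≠ xy := by
  refine ⟨?_, ?_, ?_⟩ <;> rintro rfl <;> revert h <;>
    cases s₁ <;> cases s₂ <;> cases s₃ <;> simp [triangle, Strand.opp]

/-- The subtype of a finite set with three more elements. -/
def optionVertex₃ {s t : Finset ℕ} {c c' c'' : ℕ} (hc : c ∉ s) (hc' : c' ∉ s) (hc'' : c'' ∉ s)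
    (h₁ : c ≠ c') (h₂ : c' ≠ c'') (h₃ : c'' ≠ c)
    (ht : ∀ v, v ∈ t ↔ v = c ∨ v = c' ∨ v = c'' ∨ v ∈ s) :
    Option (Option (Option {v // v ∈ s})) ≃ {v // v ∈ t} :=
  (Equiv.optionCongr (optionVertex₂ (t := insert c' (insert c'' s)) hc' hc'' h₂ (by simp))).trans
    (optionVertex (c := c) (by simp [hc, h₁, h₃.symm]) (by simpa using ht))

namespace GaussCode

variable {D D' : GaussCode}

/-- The positions of two consecutive passages that are exchanged. -/
theorem pos_swap {A B A' B' : List (ℕ × Strand)} {a b : ℕ × Strand} {s : Strand}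
    (h : D.word = A ++ (if s = .ne then [a, b] else [b, a]) ++ B)
    (h' : D'.word = A' ++ (if s = .ne then [a, b] else [b, a]).reverse ++ B')
    (hA : A'.length = A.length) {v w : D.Vertex} {v' w' : D'.Vertex} {σ τ : Strand}
    (hv : a = (v.1, σ)) (hw : b = (w.1, τ)) (hv' : v'.1 = v.1) (hw' : w'.1 = w.1) :
    (D'.pos v' σ : ℕ) = D.pos w τ ∧ (D'.pos w' τ : ℕ) = D.pos v σ ∧
      D.net.rout v σ s.sign = D.net.rin w τ s.sign := by
  subst hv hw
  cases s
  · simp only [if_true, List.reverse_cons, List.reverse_nil, List.nil_append,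
      List.cons_append] at h h'
    have h1 := pos_eq_of_word (A := A) (v := v) (s := σ) (B := (w.1, τ) :: B) (by simpa using h)
    have h2 := pos_eq_of_word (A := A ++ [(v.1, σ)]) (v := w) (s := τ) (B := B) (by simpa using h)
    have h3 := pos_eq_of_word (D := D') (A := A') (v := w') (s := τ) (B := (v.1, σ) :: B')
      (by simpa [hw'] using h')
    have h4 := pos_eq_of_word (D := D') (A := A' ++ [(w.1, τ)]) (v := v') (s := σ) (B := B')
      (by simpa [hv'] using h')
    rw [List.length_append, List.length_singleton] at h2 h4
    refine ⟨by omega, by omega, Fin.ext ?_⟩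
    change (D.pos v σ : ℕ) + 1 = D.pos w τ
    omega
  · simp only [if_false, reduceCtorEq, List.reverse_cons, List.reverse_nil, List.nil_append,
      List.cons_append] at h h'
    have h1 := pos_eq_of_word (A := A) (v := w) (s := τ) (B := (v.1, σ) :: B) (by simpa using h)
    have h2 := pos_eq_of_word (A := A ++ [(w.1, τ)]) (v := v) (s := σ) (B := B) (by simpa using h)
    have h3 := pos_eq_of_word (D := D') (A := A') (v := v') (s := σ) (B := (w.1, τ) :: B')
      (by simpa [hv'] using h')
    have h4 := pos_eq_of_word (D := D') (A := A' ++ [(v.1, σ)]) (v := w') (s := τ) (B := B')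
      (by simpa [hw'] using h')
    rw [List.length_append, List.length_singleton] at h2 h4
    refine ⟨by omega, by omega, Fin.ext ?_⟩
    change (D.pos v σ : ℕ) = (D.pos w τ : ℕ) + 1
    omega

end GaussCode

end

/-! ### The moves RIII and SIII for Gauss codes. -/

section

namespace GaussCode

variable {D D' : GaussCode}

/-- The two words have the same letters, and only the two passages on each side of the triangle
exchange positions. So the nets agree away from the triangle, and `Triangle.bracket_eq` and
`Triangle.alexander_eq` apply; the kind of `xy` plays no role. -/
theorem sameInvariants_of_RIII_SIII (hD : D.IsPlanar) (hD' : D'.IsPlanar)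
    {l₀ l₁ l₂ l₃ u₁ u₂ u₃ : List (ℕ × Strand)} {xy yz zx : ℕ} {s₁ s₂ s₃ : Strand}
    (hk : D'.kind = D.kind)
    (hc : (D.kind zx = overKind s₃ ∧ D.kind yz = overKind s₂.opp) ∨
      (D.kind zx = overKind s₃.opp ∧ D.kind yz = overKind s₂))
    (hu : [u₁, u₂, u₃].Perm (triangle xy yz zx s₁ s₂ s₃))
    (hw : D.word = l₀ ++ u₁ ++ l₁ ++ u₂ ++ l₂ ++ u₃ ++ l₃)
    (hw' : D'.word = l₀ ++ u₁.reverse ++ l₁ ++ u₂.reverse ++ l₂ ++ u₃.reverse ++ l₃) :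
    D.SameInvariants D' := by
  obtain ⟨hkc, hkc', hsign, hone⟩ := overKind_cases hc
  have hdbl : D'.dblWord = D.dblWord := by
    -- Each side contains at most one double point, namely `xy`, so reversing it leaves the order of
    -- double points unchanged.
    have h1 : ∀ u ∈ triangle xy yz zx s₁ s₂ s₃, (u.reverse.map Prod.fst).filter
        (fun v => D.kind v = .dbl) = (u.map Prod.fst).filter (fun v => D.kind v = .dbl) := by
      intro u hu
      cases s₁ <;> cases s₂ <;> cases s₃ <;> simp [triangle] at hu <;>
        rcases hu with rfl | rfl | rfl <;> simp [List.filter_cons, hkc, hkc']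
    simp only [dblWord, hk, hw, hw', List.map_append, List.filter_append]
    rw [h1 u₁ (hu.mem_iff.1 (by simp)), h1 u₂ (hu.mem_iff.1 (by simp)),
      h1 u₃ (hu.mem_iff.1 (by simp))]
  have hnum := numDouble_eq_of_dblWord hdbl
  have hverts : ∀ v, v ∈ D'.verts ↔ v ∈ D.verts := by
    intro v
    simp [verts, hw, hw']
  obtain ⟨hn1, hn2, hn3⟩ : xy ≠ yz ∧ yz ≠ zx ∧ zx ≠ xy := by
    refine triangle_ne (hu.flatten.nodup_iff.1 ?_)
    have h1 := D.nodup
    rw [hw] at h1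
    refine h1.sublist ?_
    simp only [List.flatten_cons, List.flatten_nil, List.append_nil, List.append_assoc]
    exact ((List.Sublist.refl u₁).append (((List.Sublist.refl u₂).append
      ((List.sublist_append_left u₃ l₃).trans (List.sublist_append_right l₂ _))).trans
      (List.sublist_append_right l₁ _))).trans (List.sublist_append_right l₀ _)
  have hside := fun u (hu' : u ∈ triangle xy yz zx s₁ s₂ s₃) =>
    exists_of_mem_sides (l₀ := l₀) (l₁ := l₁) (l₂ := l₂) (l₃ := l₃) (hu.mem_iff.2 hu')
  rw [← hw, ← hw'] at hside
  have hmem : ∀ u ∈ triangle xy yz zx s₁ s₂ s₃, ∀ x ∈ u, x.1 ∈ D.verts := by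
    intro u hu x hx
    obtain ⟨A, B, -, -, h, -⟩ := hside u hu
    exact D.mem_verts.2 ⟨x.2, by simp [h, hx]⟩
  have hxy : xy ∈ D.verts := hmem (if s₂ = .ne then _ else _) (List.mem_cons_self ..) (xy, s₁)
    (by split_ifs <;> simp)
  have hzx : zx ∈ D.verts := hmem (if s₂ = .ne then _ else _) (List.mem_cons_self ..) (zx, s₃.opp)
    (by split_ifs <;> simp)
  have hyz : yz ∈ D.verts := hmem (if s₃ = .ne then _ else _)
    (List.mem_cons_of_mem _ (List.mem_cons_self ..)) (yz, s₂) (by split_ifs <;> simp)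
  let rest : Finset ℕ := ((D.verts.erase xy).erase yz).erase zx
  have hmem' : ∀ v, v ∈ D.verts ↔ v = xy ∨ v = yz ∨ v = zx ∨ v ∈ rest := by
    intro v
    simp only [rest, Finset.mem_erase]
    by_cases h1 : v = xy
    · simp [h1, hxy]
    by_cases h2 : v = yz
    · simp [h2, hyz]
    by_cases h3 : v = zx
    · simp [h3, hzx]
    simp [h1, h2, h3]
  have hrest : xy ∉ rest ∧ yz ∉ rest ∧ zx ∉ rest := by simp [rest]
  let o : Option (Option (Option {v // v ∈ rest})) ≃ D.Vertex :=
    optionVertex₃ hrest.1 hrest.2.1 hrest.2.2 hn1 hn2 hn3 hmem'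
  let o' : Option (Option (Option {v // v ∈ rest})) ≃ D'.Vertex :=
    optionVertex₃ hrest.1 hrest.2.1 hrest.2.2 hn1 hn2 hn3 fun v => (hverts v).trans (hmem' v)
  have oo : ∀ x, (o' x).1 = (o x).1 := by rintro (_ | _ | _ | v) <;> rfl
  have hlen : D'.word.length + 1 = D.word.length + 1 := by simp [hw, hw']
  have hpos : ∀ v t, (D'.pos (o' (some (some (some v)))) t : ℕ) =
      D.pos (o (some (some (some v)))) t := by
    intro v t
    have h1 : (D.pos (o (some (some (some v)))) t : ℕ) =
      (l₀ ++ u₁ ++ l₁ ++ u₂ ++ l₂ ++ u₃ ++ l₃).idxOf (v.1, t) := by rw [← hw]; rfl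
    have h2 : (D'.pos (o' (some (some (some v)))) t : ℕ) = (l₀ ++ u₁.reverse ++ l₁ ++
      u₂.reverse ++ l₂ ++ u₃.reverse ++ l₃).idxOf (v.1, t) := by rw [← hw']; rfl
    rw [h1, h2]
    refine idxOf_reverse_sides fun u hu' hx => ?_
    have hv := v.2
    rcases triangle_mem (hu.mem_iff.1 hu') hx with h | h | h <;> dsimp only at h <;> rw [h] at hv
    exacts [hrest.1 hv, hrest.2.1 hv, hrest.2.2 hv]
  let N := D.net.map o id
  let N' := D'.net.map o' (finCongr hlen)
  -- The exchange of the two passages on one side, translated to the nets: the half-edges of the two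
  -- strands change places, and the inner edge runs from `a` to `b` in the direction given by `s`.
  have hswap : ∀ (a b : Option (Option (Option {v // v ∈ rest}))) (σ τ s : Strand),
      (if s = .ne then [((o a).1, σ), ((o b).1, τ)] else [((o b).1, τ), ((o a).1, σ)]) ∈
        triangle xy yz zx s₁ s₂ s₃ →
      (∀ ε, N'.rin a σ ε = N.rin b τ ε ∧ N'.rout a σ ε = N.rout b τ ε ∧
        N'.rin b τ ε = N.rin a σ ε ∧ N'.rout b τ ε = N.rout a σ ε) ∧
      N.rout a σ s.sign = N.rin b τ s.sign := by
    intro a b σ τ s hab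
    obtain ⟨A, B, A', B', h, h', hA⟩ := hside _ hab
    obtain ⟨h1, h2, h3⟩ := pos_swap h h' hA rfl rfl (oo a) (oo b)
    have e1 : N'.inn a σ = N.inn b τ := Fin.ext h1
    have e2 : N'.out a σ = N.out b τ := Fin.ext (congrArg (· + 1) h1)
    have e3 : N'.inn b τ = N.inn a σ := Fin.ext h2
    have e4 : N'.out b τ = N.out a σ := Fin.ext (congrArg (· + 1) h2)
    refine ⟨fun ε => ?_, h3⟩
    cases ε
    · exact ⟨e2, e1, e4, e3⟩
    · exact ⟨e1, e2, e3, e4⟩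
  obtain ⟨hx, hx'⟩ := hswap (some (some none)) none s₃.opp s₁ s₂ (List.mem_cons_self ..)
  obtain ⟨hy, hy'⟩ := hswap none (some none) s₁.opp s₂ s₃
    (List.mem_cons_of_mem _ (List.mem_cons_self ..))
  obtain ⟨hz, hz'⟩ := hswap (some none) (some (some none)) s₂.opp s₃ s₁
    (List.mem_cons_of_mem _ (List.mem_cons_of_mem _ (List.mem_cons_self ..)))
  have hlong : N.IsLong := D.isLong_net.map o.injective Function.injective_id
  have hlong' : N'.IsLong := D'.isLong_net.map o'.injective (finCongr hlen).injective
  have htri : N.Triangle none (some none) (some (some none)) s₁ s₂ s₃ s₂.sign s₃.sign s₁.sign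
      _ _ _ _ _ _ _ _ _ := ⟨rfl, rfl, hx'.symm, rfl, rfl, rfl, hy'.symm, rfl, rfl, rfl,
      hz'.symm, rfl⟩
  have htri' := N'.triangle_flip hx hx' hy hy' hz hz'
  have hedges := hlong.triangleEdges htri (by simp) (by simp) (by simp)
  have hedges' := hlong'.triangleEdges htri' (by simp) (by simp) (by simp)
  have hN : N'.restrict.restrict.restrict = N.restrict.restrict.restrict := by
    refine Net.ext_of_eq (fun v t => Fin.ext (hpos v t))
      (fun v t => Fin.ext (congrArg (· + 1) (hpos v t))) (Fin.ext rfl) (Fin.ext ?_)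
    change D'.word.length = D.word.length
    omega
  have hkind : ∀ x, D'.kind (o' x).1 = D.kind (o x).1 := fun x => by rw [hk, oo]
  have hrank : ∀ x, D'.kind (o' x).1 = .dbl → D'.rank (o' x).1 = D.rank (o x).1 := fun x hx => by
    rw [oo]
    exact rank_eq_of_dblWord hdbl (mem_dblWord (o x) ((hkind x).symm.trans hx))
  refine ⟨hnum, fun d hd hd' => ⟨?_, ?_⟩⟩
  · have hwr : D.writhe = D'.writhe := by
      rw [writhe_eq_sum, writhe_eq_sum, ← o.sum_comp, ← o'.sum_comp]
      exact Finset.sum_congr rfl fun x _ => by rw [hkind]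
    have w1 := D.smoothingWeight_crossing hd (o (some (some none))) hkc
    have w2 := D.smoothingWeight_crossing hd (o (some none)) hkc'
    obtain ⟨c1, c2, c3⟩ := triangle_smoothingWeights (s₁ := s₁) hsign hone
      ((w1 .oriented).trans (by rw [if_pos rfl]; rfl))
      ((w1 .unoriented).trans (by rw [if_neg (by simp)]; rfl))
      ((w2 .oriented).trans (by rw [if_pos rfl]; rfl))
      ((w2 .unoriented).trans (by rw [if_neg (by simp)]; rfl))
    have h1 : D'.net.bracket (-JonesRing.A d 2 - JonesRing.A d (-2)) (D'.smoothingWeight hd') =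
        N'.bracket (-JonesRing.A d 2 - JonesRing.A d (-2))
          fun x => D.smoothingWeight hd (o x) := by
      rw [← D'.net.bracket_map o' (finCongr hlen)]
      refine congrArg _ (funext fun x => funext fun t => ?_)
      exact smoothingWeight_congr hd' hd (hkind x) (hrank x) t
    rw [jones, jones, hwr, bracket_eq_net, bracket_eq_net, D.net.bracket_map_vertices o, h1]
    exact congrArg _ (htri.bracket_eq hedges htri' hedges' hN _ _ c1 c2 c3)
  · have h1 : D'.net.alexander (AlexanderRing.A d 1 + AlexanderRing.A d (-1)) (D'.topWeight hd') =
        N'.alexander (AlexanderRing.A d 1 + AlexanderRing.A d (-1))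
          fun x => D.topWeight hd (o x) := by
      rw [← D'.net.alexander_map o' (finCongr hlen)]
      refine congrArg _ (funext fun x => ?_)
      exact topWeight_congr hd' hd (hkind x) (hrank x)
    rw [alexander_eq_net, alexander_eq_net, D.net.alexander_map_vertices o, h1]
    have t1 := (D.topWeight_crossing hd (o (some (some none))) hkc).trans
      (congrArg (fun k => AlexanderRing.A d (Kind.sign k)) (rfl : _ = D.kind zx))
    have t2 := (D.topWeight_crossing hd (o (some none)) hkc').trans
      (congrArg (fun k => AlexanderRing.A d (Kind.sign k)) (rfl : _ = D.kind yz))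
    refine htri.alexander_eq hedges htri' hedges' hN ?_ _ _ ?_ ?_
    · rw [card_region_map hD]
      refine Eq.trans ?_ (Nat.card_congr (D'.net.regionEquiv o' (finCongr hlen))).symm
      rw [hD'.card_region, Fintype.card_congr o']
    · rw [t1, t2, hsign]
      split_ifs
      · rcases hone with h | h <;> rw [h] <;> simp
      · rfl
    · rw [t1, add_mul, AlexanderRing.A_mul_A, AlexanderRing.A_mul_A, AlexanderRing.A_mul_A]
      rcases hone with h | h <;> rw [h] <;> norm_num [AlexanderRing.A_zero]

end GaussCode

end

/-! ### From single moves to isotopies. -/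

section

/-- Each elementary move between diagrams in the plane preserves the invariants. -/
theorem Move.sameInvariants {D D' : GaussCode} (h : Move D D') (hD : D.IsPlanar)
    (hD' : D'.IsPlanar) : D.SameInvariants D' := by
  cases h with
  | relabel f hw hk => exact GaussCode.sameInvariants_of_relabel hw hk
  | RI l₁ l₂ c s hk hc hw hw' => exact GaussCode.sameInvariants_of_RI hD hD' hk hc hw hw'
  | RII l₁ l₂ l₃ par c c' s hk hc hw hw' =>
    exact GaussCode.sameInvariants_of_RII hD hD' hk hc hw hw'
  | RIII_SIII l₀ l₁ l₂ l₃ u₁ u₂ u₃ xy yz zx s₁ s₂ s₃ hk hc hu hw hw' =>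
    exact GaussCode.sameInvariants_of_RIII_SIII hD hD' hk hc hu hw hw'
  | SII l₁ l₂ l₃ par p c s hk hp hc hw hw' =>
    exact GaussCode.sameInvariants_of_SII hk hp hc hw hw'

/-- The invariants of isotopic long singular knots agree. -/
theorem Isotopic.sameInvariants {D D' : Diagram} (h : Isotopic D D') :
    D.toGaussCode.SameInvariants D'.toGaussCode := by
  induction h with
  | rel D D' h => exact h.sameInvariants D.planar D'.planar
  | refl D => exact .refl _
  | symm D D' _ ih => exact ih.symm
  | trans D D' D'' _ _ ih ih' => exact ih.trans ih'

end

end LongSingular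

end

theorem theorem2 (D D' : LongSingular.Diagram) (h : LongSingular.Isotopic D D') :
    D.numDouble = D'.numDouble ∧
      ∀ (d : ℕ) (hd : D.numDouble = d) (hd' : D'.numDouble = d),
        D.jones hd = D'.jones hd' ∧ D.alexander hd = D'.alexander hd' := by
  exact h.sameInvariants
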